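/- Let $E$ be a locally complete locally convex Hausdorff space over $\mathbb{C}$ whose topology is generated by the seminorms $(p_\alpha)_{\alpha\in\mathfrak{A}}$ (locally complete: for every closed bounded absolutely convex $D\subset E$, the linear span of $D$, normed by the Minkowski functional of $D$, is a Banach space). Let $-\infty<a\le b<\infty$ and $K:=[a,b]\subset\mathbb{R}\subset\mathbb{C}$. For a compact set $M\subset\mathbb{R}$ and $c>0$ let $U_{1/c}(M):=\{z\in\mathbb{C} : \mathrm{d}(z,M)<c\}$ (so $U_{1/c}(\emptyset)=\emptyset$), and for $n\in\mathbb{N}=\{1,2,\dots\}$ let $S_n(M):=(\mathbb{C}\setminus\overline{U_n(M)})\cap\{z : |\operatorname{Im} z|<n\}$. Let $\mathcal{O}^{exp}(\overline{\mathbb{C}}\setminus M,E)$ be the space of all holomorphic functions $F\colon\mathbb{C}\setminus M\to E$ such that $$|||F|||_{n,\alpha,M}:=\sup_{z\in S_n(M)}p_\alpha(F(z))\,e^{-\frac1n|\operatorname{Re} z|}<\infty\quad\text{for all } n\in\mathbb{N},\ \alpha\in\mathfrak{A},$$ with the locally convex topology given by these seminorms. Let $bv_K(E):=\mathcal{O}^{exp}(\overline{\mathbb{C}}\setminus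 K,E)/\mathcal{O}^{exp}(\overline{\mathbb{C}},E)$ with the quotient topology, where $\mathcal{O}^{exp}(\overline{\mathbb{C}},E)$ (the case $M=\emptyset$) is regarded as a subspace by restriction to $\mathbb{C}\setminus K$. Let $H_{[a,b]}(t):=\sup_{x\in[a,b]}xt$ for $t\in\mathbb{R}$, and let $\mathcal{FO}_{[a,b]}(E)$ be the space of all entire functions $f\colon\mathbb{C}\to E$ such that $$|f|_{k,\alpha,[a,b]}:=\sup_{z\in\mathbb{C}}p_\alpha(f(z))\,e^{-\frac1k|z|-H_{[a,b]}(\operatorname{Im} z)}<\infty\quad\text{for all } k\in\mathbb{N},\ \alpha\in\mathfrak{A},$$ with the locally convex topology given by these seminorms. Then the Fourier transform $$\mathcal{F}\colon bv_K(E)\to\mathcal{FO}_{[a,b]}(E),\qquad \mathcal{F}([F])(\zeta):=\int_{\gamma_K}F(z)\,e^{-iz\zeta}\,\mathrm{d}z,\quad \zeta\in\mathbb{C},$$ where $\gamma_K$ is the boundary of $U_{1/c}(K)$ with clockwise orientation and the integral is a Pettis integral, is well-defined (the integral exists and depends neither on the choice of $c>0$ nor on the representative $F$) and is a topological isomorphism,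 that is, a linear homeomorphism of $bv_K(E)$ onto $\mathcal{FO}_{[a,b]}(E)$. -/

import Mathlib

open Complex Set Filter Topology

noncomputable section

namespace FourierHyp

/-! ### Local completeness -/

/-- A Banach disk: a bounded absolutely convex set `D` such that the linear span `E_D` of `D`,
normed by the Minkowski functional of `D`, is complete (every Cauchy sequence converges). -/
def IsBanachDisk {E : Type*} [AddCommGroup E] [Module ℂ E] [TopologicalSpace E]
    (D : Set E) : Prop :=
  Balanced ℂ D ∧ Convex ℝ D ∧ Bornology.IsVonNBounded ℂ D ∧
    ∀ x : ℕ → E, (∀ n, x n ∈ Submodule.span ℂ D) →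
      (∀ ε : ℝ, 0 < ε → ∃ N : ℕ, ∀ m ≥ N, ∀ n ≥ N, gauge D (x m - x n) < ε) →
      ∃ y ∈ Submodule.span ℂ D, Tendsto (fun n => gauge D (x n - y)) atTop (𝓝 0)

/-- Local completeness: every closed bounded absolutely convex set is a Banach disk. -/
def LocallyComplete (E : Type*) [AddCommGroup E] [Module ℂ E] [TopologicalSpace E] : Prop :=
  ∀ D : Set E, IsClosed D → Balanced ℂ D → Convex ℝ D → Bornology.IsVonNBounded ℂ D →
    IsBanachDisk D

/-! ### Weighted sup-seminorms on spaces of vector-valued functions -/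

section Weighted

variable {E : Type*} [AddCommGroup E] [Module ℂ E] {X : Type*}

/-- `q(f(x)) w(x)` is bounded for `x ∈ S`, i.e. its supremum over `S` is finite. -/
def WBdd (q : Seminorm ℂ E) (S : Set X) (w : X → ℝ) (f : X → E) : Prop :=
  BddAbove (range fun x : S => q (f x) * w x)

theorem WBdd.zero (q : Seminorm ℂ E) (S : Set X) (w : X → ℝ) :
    WBdd q S w (0 : X → E) :=
  ⟨0, by rintro _ ⟨x, rfl⟩; simp⟩

theorem WBdd.add {q : Seminorm ℂ E} {S : Set X} {w : X → ℝ} (hw : ∀ x, 0 ≤ w x)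
    {f g : X → E} (hf : WBdd q S w f) (hg : WBdd q S w g) : WBdd q S w (f + g) := by
  obtain ⟨A, hA⟩ := hf
  obtain ⟨B, hB⟩ := hg
  refine ⟨A + B, ?_⟩
  rintro _ ⟨x, rfl⟩
  have h1 := hA ⟨x, rfl⟩
  have h2 := hB ⟨x, rfl⟩
  have h3 := mul_le_mul_of_nonneg_right (map_add_le_add q (f x) (g x)) (hw x)
  simp only [Pi.add_apply] at *
  linarith

theorem WBdd.smul {q : Seminorm ℂ E} {S : Set X} {w : X → ℝ}
    {f : X → E} (c : ℂ) (hf : WBdd q S w f) : WBdd q S w (c • f) := by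
  obtain ⟨A, hA⟩ := hf
  refine ⟨‖c‖ * A, ?_⟩
  rintro _ ⟨x, rfl⟩
  have h1 := mul_le_mul_of_nonneg_left (hA ⟨x, rfl⟩) (norm_nonneg c)
  simpa [map_smul_eq_mul, mul_assoc] using h1

/-- The seminorm `f ↦ sup_{x ∈ S} q(f(x)) w(x)` on a space of functions for which all these
suprema are finite. -/
def supSeminorm (V : Submodule ℂ (X → E)) (q : Seminorm ℂ E) (S : Set X) (w : X → ℝ)
    (hw : ∀ x, 0 ≤ w x) (hV : ∀ f ∈ V, WBdd q S w f) : Seminorm ℂ V :=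
  Seminorm.of (fun f => ⨆ x : S, q (f.1 x) * w x)
    (by
      intro f g
      refine Real.iSup_le (fun x => ?_) (add_nonneg
        (Real.iSup_nonneg fun x => mul_nonneg (apply_nonneg q _) (hw x))
        (Real.iSup_nonneg fun x => mul_nonneg (apply_nonneg q _) (hw x)))
      have h1 := le_ciSup (hV f.1 f.2) x
      have h2 := le_ciSup (hV g.1 g.2) x
      have h3 := mul_le_mul_of_nonneg_right (map_add_le_add q (f.1 x) (g.1 x)) (hw x)
      simp only [Submodule.coe_add, Pi.add_apply] at *
      linarith)
    (by
      intro c f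
      rw [Real.mul_iSup_of_nonneg (norm_nonneg c)]
      refine iSup_congr fun x => ?_
      simp [map_smul_eq_mul, mul_assoc])

end Weighted

/-! ### Holomorphic functions with values in a topological vector space -/

section Holomorphic

variable {E : Type*} [AddCommGroup E] [Module ℂ E] [TopologicalSpace E]

/-- The extension by zero of a function defined on `ℂ ∖ K`. -/
def zeroExt {K : Set ℂ} (F : ↥(Kᶜ) → E) : ℂ → E :=
  open Classical in fun z => if h : z ∈ Kᶜ then F ⟨z, h⟩ else 0

theorem differentiableOn_add [IsTopologicalAddGroup E] [ContinuousSMul ℂ E] {f g : ℂ → E}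
    {Ω : Set ℂ} (hf : DifferentiableOn ℂ f Ω) (hg : DifferentiableOn ℂ g Ω) :
    DifferentiableOn ℂ (f + g) Ω := by
  intro z hz
  obtain ⟨f', hf'⟩ := hf z hz
  obtain ⟨g', hg'⟩ := hg z hz
  refine ⟨f' + g', ?_⟩
  rw [hasFDerivWithinAt_iff_isLittleOTVS] at *
  refine (hf'.add hg').congr_left fun w => ?_
  simp only [Pi.add_apply, _root_.add_apply]
  abel

theorem differentiableOn_smul [IsTopologicalAddGroup E] [ContinuousSMul ℂ E] {f : ℂ → E}
    {Ω : Set ℂ} (c : ℂ) (hf : DifferentiableOn ℂ f Ω) : DifferentiableOn ℂ (c • f) Ω := by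
  intro z hz
  obtain ⟨f', hf'⟩ := hf z hz
  refine ⟨c • f', ?_⟩
  rw [hasFDerivWithinAt_iff_isLittleOTVS] at *
  have h := ((c • ContinuousLinearMap.id ℂ E).isBigOTVS_comp (l := 𝓝[Ω] z)
    (f := fun w => f w - f z - f' (w - z))).trans_isLittleOTVS hf'
  refine h.congr_left fun w => ?_
  simp [smul_sub]

theorem differentiableOn_zero' (Ω : Set ℂ) : DifferentiableOn ℂ (0 : ℂ → E) Ω := by
  intro z _
  refine ⟨0, ?_⟩
  rw [hasFDerivWithinAt_iff_isLittleOTVS]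
  exact (Asymptotics.IsLittleOTVS.zero (𝕜 := ℂ) (E := E) (fun w : ℂ => w - z) (𝓝[Ω] z)).congr_left
    fun w => by simp

end Holomorphic

/-! ### The spaces `𝒪^exp(ℂ̄ ∖ K, E)` and `bv_K(E)` -/

section Exp

variable {E : Type*} [AddCommGroup E] [Module ℂ E] {ι : Type*}

/-- `S_n(K) = (ℂ ∖ closure (U_n(K))) ∩ {|Im z| < n}`, where `U_n(K) = {z | d(z, K) < 1 / n}`
(this is empty for empty `K`). -/
def S (K : Set ℂ) (n : ℕ+) : Set ℂ :=
  (closure (Metric.thickening (1 / (n : ℝ)) K))ᶜ ∩ {z | |z.im| < (n : ℝ)}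

/-- The weight `z ↦ exp (-|Re z| / n)`. -/
def expWeight (n : ℕ+) (z : ℂ) : ℝ := Real.exp (-(1 / (n : ℝ)) * |z.re|)

variable [TopologicalSpace E] [IsTopologicalAddGroup E] [ContinuousSMul ℂ E]
  (p : SeminormFamily ℂ E ι) (K : Set ℂ)

/-- The holomorphic functions `F : ℂ ∖ K → E` with
`sup_{z ∈ S_n(K)} p_α(F(z)) exp (-|Re z| / n) < ∞` for all `n ≥ 1` and all `α`. -/
def expHolSubmodule : Submodule ℂ (↥(Kᶜ) → E) where
  carrier := {F | DifferentiableOn ℂ (zeroExt F) Kᶜ ∧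
    ∀ (n : ℕ+) (α : ι), WBdd (p α) {z : ↥(Kᶜ) | (z : ℂ) ∈ S K n} (fun z => expWeight n z) F}
  zero_mem' := by
    refine ⟨?_, fun n α => WBdd.zero _ _ _⟩
    have : zeroExt (0 : ↥(Kᶜ) → E) = 0 := by
      funext z; simp [zeroExt]
    rw [this]
    exact differentiableOn_zero' _
  add_mem' := by
    rintro F G ⟨hF, hF'⟩ ⟨hG, hG'⟩
    refine ⟨?_, fun n α => (hF' n α).add (fun z => (Real.exp_pos _).le) (hG' n α)⟩
    have : zeroExt (F + G) = zeroExt F + zeroExt G := by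
      funext z; by_cases h : z ∈ K <;> simp [zeroExt, h]
    rw [this]
    exact differentiableOn_add hF hG
  smul_mem' := by
    rintro c F ⟨hF, hF'⟩
    refine ⟨?_, fun n α => (hF' n α).smul c⟩
    have : zeroExt (c • F) = c • zeroExt F := by
      funext z; by_cases h : z ∈ K <;> simp [zeroExt, h]
    rw [this]
    exact differentiableOn_smul c hF

/-- The space `𝒪^exp(ℂ̄ ∖ K, E)`. It is a separate type since its topology, given below, is not
the topology of pointwise convergence. -/
def ExpHol : Type _ := ↥(expHolSubmodule p K)

instance : AddCommGroup (ExpHol p K) := inferInstanceAs (AddCommGroup ↥(expHolSubmodule p K))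

instance : Module ℂ (ExpHol p K) := inferInstanceAs (Module ℂ ↥(expHolSubmodule p K))

/-- The underlying function `ℂ ∖ K → E`. -/
def ExpHol.toFun {p : SeminormFamily ℂ E ι} {K : Set ℂ} (F : ExpHol p K) : ↥(Kᶜ) → E :=
  Subtype.val F

/-- The seminorms `|||F|||_{n,α,K} = sup_{z ∈ S_n(K)} p_α(F(z)) exp (-|Re z| / n)`. -/
def ExpHol.seminorms : SeminormFamily ℂ (ExpHol p K) (ℕ+ × ι) := fun nα =>
  supSeminorm (expHolSubmodule p K) (p nα.2) {z : ↥(Kᶜ) | (z : ℂ) ∈ S K nα.1}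
    (fun z => expWeight nα.1 z) (fun _ => (Real.exp_pos _).le) (fun _ hF => hF.2 nα.1 nα.2)

/-- The locally convex topology of `𝒪^exp(ℂ̄ ∖ K, E)`. -/
instance : TopologicalSpace (ExpHol p K) := (ExpHol.seminorms p K).moduleFilterBasis.topology

theorem ExpHol.withSeminorms : WithSeminorms (ExpHol.seminorms p K) := ⟨rfl⟩

/-- The subspace of `𝒪^exp(ℂ̄ ∖ K, E)` of the restrictions to `ℂ ∖ K` of the (entire) functions
in `𝒪^exp(ℂ̄, E) = 𝒪^exp(ℂ̄ ∖ ∅, E)`. -/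
def entirePart : Submodule ℂ (ExpHol p K) where
  carrier := {F | ∃ G : ExpHol p (∅ : Set ℂ), ∀ z : ↥(Kᶜ),
    F.toFun z = G.toFun ⟨z, fun h => h⟩}
  zero_mem' := ⟨0, fun _ => rfl⟩
  add_mem' := by
    rintro F₁ F₂ ⟨G₁, h₁⟩ ⟨G₂, h₂⟩
    exact ⟨G₁ + G₂, fun z => congrArg₂ (· + ·) (h₁ z) (h₂ z)⟩
  smul_mem' := by
    rintro c F ⟨G, h⟩
    exact ⟨c • G, fun z => congrArg (c • ·) (h z)⟩

/-- `bv_K(E) = 𝒪^exp(ℂ̄ ∖ K, E) / 𝒪^exp(ℂ̄, E)`, with the quotient topology. -/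
abbrev BV : Type _ := ExpHol p K ⧸ entirePart p K

end Exp

/-! ### The space `ℱ𝒪_{[a,b]}(E)` -/

section FO

variable {E : Type*} [AddCommGroup E] [Module ℂ E] {ι : Type*}

/-- The supporting function `H_{[a,b]}(t) = sup_{x ∈ [a,b]} x t`. -/
def supportFun (a b t : ℝ) : ℝ := sSup ((fun x => x * t) '' Icc a b)

/-- The weight `z ↦ exp (-|z| / k - H_{[a,b]}(Im z))`. -/
def foWeight (a b : ℝ) (k : ℕ+) (z : ℂ) : ℝ :=
  Real.exp (-(1 / (k : ℝ)) * ‖z‖ - supportFun a b z.im)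

variable [TopologicalSpace E] [IsTopologicalAddGroup E] [ContinuousSMul ℂ E]
  (p : SeminormFamily ℂ E ι) (a b : ℝ)

/-- The entire functions `f : ℂ → E` with
`sup_{z ∈ ℂ} p_α(f(z)) exp (-|z| / k - H_{[a,b]}(Im z)) < ∞` for all `k ≥ 1` and all `α`. -/
def foSubmodule : Submodule ℂ (ℂ → E) where
  carrier := {f | DifferentiableOn ℂ f univ ∧
    ∀ (k : ℕ+) (α : ι), WBdd (p α) univ (foWeight a b k) f}
  zero_mem' := ⟨differentiableOn_zero' _, fun k α => WBdd.zero _ _ _⟩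
  add_mem' := by
    rintro F G ⟨hF, hF'⟩ ⟨hG, hG'⟩
    exact ⟨differentiableOn_add hF hG,
      fun n α => (hF' n α).add (fun z => (Real.exp_pos _).le) (hG' n α)⟩
  smul_mem' := by
    rintro c F ⟨hF, hF'⟩
    exact ⟨differentiableOn_smul c hF, fun n α => (hF' n α).smul c⟩

/-- The space `ℱ𝒪_{[a,b]}(E)`; its topology is given below. -/
def FO : Type _ := ↥(foSubmodule p a b)

instance : AddCommGroup (FO p a b) := inferInstanceAs (AddCommGroup ↥(foSubmodule p a b))

instance : Module ℂ (FO p a b) := inferInstanceAs (Module ℂ ↥(foSubmodule p a b))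

/-- The underlying entire function. -/
def FO.toFun {p : SeminormFamily ℂ E ι} {a b : ℝ} (f : FO p a b) : ℂ → E := Subtype.val f

/-- The seminorms `|f|_{k,α,[a,b]} = sup_{z ∈ ℂ} p_α(f(z)) exp (-|z| / k - H_{[a,b]}(Im z))`. -/
def FO.seminorms : SeminormFamily ℂ (FO p a b) (ℕ+ × ι) := fun kα =>
  supSeminorm (foSubmodule p a b) (p kα.2) univ (foWeight a b kα.1)
    (fun _ => (Real.exp_pos _).le) (fun _ hf => hf.2 kα.1 kα.2)

/-- The locally convex topology of `ℱ𝒪_{[a,b]}(E)`. -/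
instance : TopologicalSpace (FO p a b) := (FO.seminorms p a b).moduleFilterBasis.topology

theorem FO.withSeminorms : WithSeminorms (FO.seminorms p a b) := ⟨rfl⟩

end FO

/-! ### Pettis contour integrals and the contour around `[a,b]` -/

section Contour

/-- The interval `[a,b]` as a subset of `ℂ`. -/
def interval (a b : ℝ) : Set ℂ := (fun x : ℝ => (x : ℂ)) '' Icc a b

/-- The boundary of `{z | d(z, [a,b]) < c}`, with clockwise orientation, as four consecutive
curves parametrized by `[0,1]`: from `a + ic` to `b + ic` (segment), from `b + ic` through `b + c`
to `b - ic` (half circle), from `b - ic` to `a - ic` (segment), and from `a - ic` through `a - c`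
to `a + ic` (half circle). -/
def contour (a b c : ℝ) : Fin 4 → ℝ → ℂ :=
  ![fun t => (a : ℂ) + t * (b - a) + c * I,
    fun t => (b : ℂ) + c * exp (I * (Real.pi / 2 - Real.pi * t)),
    fun t => (b : ℂ) + t * (a - b) - c * I,
    fun t => (a : ℂ) + c * exp (I * (-(Real.pi / 2) - Real.pi * t))]

/-- `e` is the Pettis integral `∫_γ f(z) dz` along the concatenation `γ` of the curves
`γ j : [0,1] → ℂ`: for each continuous linear functional `φ`, the function `φ ∘ f` is integrable
along `γ` and `φ(e) = ∫_γ φ(f(z)) dz`. -/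
def IsPettisIntegralAlong {E : Type*} [AddCommGroup E] [Module ℂ E] [TopologicalSpace E]
    {m : ℕ} (γ : Fin m → ℝ → ℂ) (f : ℂ → E) (e : E) : Prop :=
  ∀ φ : E →L[ℂ] ℂ,
    (∀ j, IntervalIntegrable (fun t => φ (f (γ j t)) * deriv (γ j) t) MeasureTheory.volume 0 1) ∧
    φ e = ∑ j, ∫ t in (0 : ℝ)..1, φ (f (γ j t)) * deriv (γ j) t

end Contour

end FourierHyp

end

/-!
The inverse of the Fourier transform is, up to the factor `2π`, the Borel transform: for an entire
function `f` with `|f(ζ)| ≤ C exp (ε|ζ| + H(Im ζ))` for every `ε > 0` and for `z ∉ [a,b]`,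
`(B f)(z) = ∫ f(ζ) exp (iζz) dζ`, the integral being taken along a ray from `0` to infinity whose
direction is one of `1`, `-1`, `i`, `-i`. In each direction the integral converges in an open half
plane; the four half planes cover `ℂ ∖ [a,b]`, and a rotation of the ray shows that the integrals
agree on the overlaps (`IsExpType.borel_eq`). At distance at least `r` from `[a,b]` some direction
gives an exponential decay of rate `r/2`, which yields the bounds and the continuity of `B`.

For scalar functions two facts are needed. Cauchy's integral formula between a small and a large
contour around `[a,b]` shows that near `[a,b]` the function `F - (2π)⁻¹ B(ℱF)` is a Cauchy integral
over the large contour, because by Fubini's theorem `B(ℱF)` is, up to a constant, the one over the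
small contour (`rayLaplace_contourFourier`, `sub_borel_contourFourier`). Hence this function
extends to an entire one (`entireExtension_of_notMem`, `differentiable_entireExtension`).
Conversely `ℱ(B f) = 2π f` (`IsExpType.contourFourier_borel`): the difference `h` of `f` and
`(2π)⁻¹ ℱ(B f)` has a Borel transform which extends to an entire function and tends to `0` at
infinity, so it vanishes, and by the injectivity of the Laplace transform so does `h`.

Vector-valued functions are reduced to scalar ones by composing with continuous linear functionals.
By Hahn–Banach a continuous seminorm `q` is the supremum of `|φ|` over the functionals `φ` dominated
by `q` (`seminorm_le_of_forall_dual`), so that all estimates pass to `E`. Local completeness enters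
only through `LocallyComplete.exists_of_dual_rate`: a sequence whose images under functionals
converge at a rate uniform over the functionals dominated by each `q` has a weak limit in `E`.
This provides the values of the Fourier integral (Riemann sums), the values of the Borel transform
(truncated Laplace integrals) and the derivatives of weakly holomorphic functions
(`WeakHol.differentiableOn`). The continuity estimates are `continuous_fourierLinear` (the contour
at distance `1/k` controls the seminorm of index `k`) and `continuous_borelLinear`.
-/

namespace FourierHyp

/-! ### Continuous functionals and local completeness -/

section LocallyConvex

open scoped Pointwise

variable {E : Type*} [AddCommGroup E] [Module ℂ E] [TopologicalSpace E]

theorem exists_dual_le_seminorm [PolynormableSpace ℂ E] {q : Seminorm ℂ E} (hq : Continuous q)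
    (x : E) : ∃ φ : E →L[ℂ] ℂ, (∀ y, ‖φ y‖ ≤ q y) ∧ ‖φ x‖ = q x := by
  by_cases hx : q x = 0
  · exact ⟨0, fun y => by simp, by simp [hx]⟩
  have hx0 : x ≠ 0 := fun h => hx (by simp [h])
  let e := LinearEquiv.toSpanNonzeroSingleton ℂ E x hx0
  let f : Module.Dual ℂ (Submodule.span ℂ {x}) := (q x : ℂ) • e.symm.toLinearMap
  have hf : ∀ y, ‖f y‖ = q y := by
    intro y
    obtain ⟨c, rfl⟩ := e.surjective y
    have : ((e c : Submodule.span ℂ {x}) : E) = c • x := rfl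
    rw [this, map_smul_eq_mul]
    simp [f, mul_comm]
  obtain ⟨g, hg, hle⟩ :=
    Module.Dual.exists_continuous_extension_of_le_seminorm _ f hq (fun y => (hf y).le)
  refine ⟨g, hle, ?_⟩
  have h1 := hg ⟨x, Submodule.mem_span_singleton_self x⟩
  rw [show g x = _ from h1, hf]

theorem seminorm_le_of_forall_dual [PolynormableSpace ℂ E] {q : Seminorm ℂ E} (hq : Continuous q)
    {x : E} {r : ℝ} (h : ∀ φ : E →L[ℂ] ℂ, (∀ y, ‖φ y‖ ≤ q y) → ‖φ x‖ ≤ r) : q x ≤ r := by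
  obtain ⟨φ, h1, h2⟩ := exists_dual_le_seminorm hq x
  exact h2 ▸ h φ h1

theorem eq_of_forall_dual_eq [PolynormableSpace ℂ E] [IsTopologicalAddGroup E]
    [ContinuousSMul ℂ E] [T2Space E] {x y : E}
    (h : ∀ φ : E →L[ℂ] ℂ, φ x = φ y) : x = y := by
  by_contra hne
  obtain ⟨q, hq⟩ :=
    (PolynormableSpace.withSeminorms ℂ E).separating_of_T1 (x - y) (sub_ne_zero.2 hne)
  refine hq (le_antisymm (seminorm_le_of_forall_dual q.2 fun φ _ => ?_) (apply_nonneg _ _))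
  simp [h φ]

/-- The continuous seminorm `x ↦ ‖φ x‖`. -/
noncomputable def dualSeminorm (φ : E →L[ℂ] ℂ) : Seminorm ℂ E :=
  (normSeminorm ℂ ℂ).comp φ.toLinearMap

theorem dualSeminorm_apply (φ : E →L[ℂ] ℂ) (x : E) : dualSeminorm φ x = ‖φ x‖ := rfl

theorem continuous_dualSeminorm (φ : E →L[ℂ] ℂ) : Continuous (dualSeminorm φ) :=
  φ.continuous.norm

/-- In a locally complete space a sequence converges as soon as it is Cauchy at a rate which, up to
a constant, is the same for all continuous seminorms: the set `D` of all `x` with `q x ≤ C q` for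
all `q` is a closed bounded disk, and the sequence is Cauchy in the span of `D`. -/
theorem LocallyComplete.exists_tendsto [PolynormableSpace ℂ E] (hE : LocallyComplete E)
    {x : ℕ → E} {ε : ℕ → ℝ} (hε : Tendsto ε atTop (𝓝 0)) {C : Seminorm ℂ E → ℝ}
    (h : ∀ q : Seminorm ℂ E, Continuous q → ∀ m n, q (x m - x n) ≤ C q * (ε m + ε n)) :
    ∃ y, ∀ q : Seminorm ℂ E, Continuous q → Tendsto (fun n => q (x n - y)) atTop (𝓝 0) := by
  -- Enlarging `C` and `ε` makes them nonnegative.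
  set A : Seminorm ℂ E → ℝ := fun q => |C q| with hA
  have hA0 : ∀ q, 0 ≤ A q := fun q => abs_nonneg _
  have h' : ∀ q : Seminorm ℂ E, Continuous q → ∀ m n, q (x m - x n) ≤ A q * (|ε m| + |ε n|) := by
    intro q hq m n
    calc q (x m - x n) ≤ |C q * (ε m + ε n)| := (h q hq m n).trans (le_abs_self _)
      _ = A q * |ε m + ε n| := abs_mul _ _
      _ ≤ _ := mul_le_mul_of_nonneg_left (abs_add_le _ _) (hA0 q)
  have hε' : Tendsto (fun n => |ε n|) atTop (𝓝 0) := by simpa using hε.abs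
  let D : Set E := {x | ∀ q : Seminorm ℂ E, Continuous q → q x ≤ A q}
  have hsm : ∀ {r : ℝ} (_ : 0 < r) {v : E},
      v ∈ r • D ↔ ∀ q : Seminorm ℂ E, Continuous q → q v ≤ r * A q := by
    intro r hr v
    rw [mem_smul_set_iff_inv_smul_mem₀ hr.ne']
    refine forall₂_congr fun q _ => ?_
    have : q (r⁻¹ • v) = r⁻¹ * q v := by
      rw [← Complex.coe_smul, map_smul_eq_mul]
      simp [abs_of_pos hr]
    rw [this, inv_mul_le_iff₀ hr]
  have hcl : IsClosed D := by
    have : D = ⋂ (q : Seminorm ℂ E) (_ : Continuous q), {x | q x ≤ A q} := by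
      ext; simp [D]
    rw [this]
    exact isClosed_iInter fun q => isClosed_iInter fun hq => isClosed_le hq continuous_const
  have hbal : Balanced ℂ D := by
    rw [balanced_iff_smul_mem]
    intro a ha v hv q hq
    rw [map_smul_eq_mul]
    exact (mul_le_of_le_one_left (apply_nonneg _ _) ha).trans (hv q hq)
  have hconv : Convex ℝ D := by
    intro u hu v hv s t hs ht hst q hq
    have h1 : q (s • u + t • v) ≤ s * q u + t * q v := by
      refine (map_add_le_add _ _ _).trans (le_of_eq ?_)
      rw [← Complex.coe_smul, ← Complex.coe_smul t, map_smul_eq_mul, map_smul_eq_mul]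
      simp [abs_of_nonneg hs, abs_of_nonneg ht]
    calc _ ≤ s * A q + t * A q :=
          h1.trans (add_le_add (mul_le_mul_of_nonneg_left (hu q hq) hs)
            (mul_le_mul_of_nonneg_left (hv q hq) ht))
      _ = A q := by rw [← add_mul, hst, one_mul]
  have hbdd : Bornology.IsVonNBounded ℂ D := by
    rw [(PolynormableSpace.withSeminorms ℂ E).isVonNBounded_iff_seminorm_bounded]
    intro q
    exact ⟨A q.1 + 1, by linarith [hA0 q.1], fun v hv => by linarith [hv q.1 q.2]⟩
  obtain ⟨-, -, -, hcomp⟩ := hE D hcl hbal hconv hbdd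
  have hspan : ∀ v ∈ Submodule.span ℂ D, ∃ r : ℝ, 0 < r ∧ v ∈ r • D := by
    intro v hv
    induction hv using Submodule.span_induction with
    | mem v hv => exact ⟨1, one_pos, by simpa using hv⟩
    | zero => exact ⟨1, one_pos, (hsm one_pos).2 fun q _ => by simp [hA0]⟩
    | add u v _ _ hu hv =>
      obtain ⟨r, hr, hu⟩ := hu
      obtain ⟨s, hs, hv⟩ := hv
      refine ⟨r + s, by positivity, (hsm (by positivity)).2 fun q hq => ?_⟩
      have h1 := (hsm hr).1 hu q hq
      have h2 := (hsm hs).1 hv q hq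
      have h3 := map_add_le_add q u v
      linarith
    | smul c v _ hv =>
      obtain ⟨r, hr, hv⟩ := hv
      refine ⟨(‖c‖ + 1) * r, by positivity, (hsm (by positivity)).2 fun q hq => ?_⟩
      have h1 := (hsm hr).1 hv q hq
      rw [map_smul_eq_mul, mul_assoc]
      exact mul_le_mul (by linarith) h1 (apply_nonneg _ _) (by positivity)
  have hmem : ∀ {r : ℝ} (_ : 0 < r) {v : E}, v ∈ r • D → v ∈ Submodule.span ℂ D := by
    rintro r hr _ ⟨v, hv, rfl⟩
    have := (Submodule.span ℂ D).smul_mem (r : ℂ) (Submodule.subset_span hv)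
    simpa using this
  have hdiff : ∀ m n (s : ℝ), 0 < s → |ε m| + |ε n| ≤ s → x m - x n ∈ s • D := by
    intro m n s hs hle
    refine (hsm hs).2 fun q hq => (h' q hq m n).trans ?_
    rw [mul_comm]
    exact mul_le_mul_of_nonneg_right hle (hA0 q)
  -- Subtracting the first term puts the sequence into the span of `D`.
  obtain ⟨y, hy, hlim⟩ := hcomp (fun n => x n - x 0)
    (fun n => hmem (r := |ε n| + |ε 0| + 1) (by positivity)
      (hdiff n 0 _ (by positivity) (by linarith)))
    (by
      intro δ hδ
      obtain ⟨N, hN⟩ := (Metric.tendsto_atTop.1 hε' (δ / 4) (by positivity))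
      refine ⟨N, fun m hm n hn => ?_⟩
      have h1 := hN m hm
      have h2 := hN n hn
      simp only [Real.dist_eq, sub_zero, abs_abs] at h1 h2
      rw [sub_sub_sub_cancel_right]
      exact (gauge_le_of_mem (by positivity)
        (hdiff m n (δ / 2) (by positivity) (by linarith))).trans_lt (by linarith))
  refine ⟨x 0 + y, fun q hq => ?_⟩
  have hxs : ∀ n, x n - (x 0 + y) ∈ Submodule.span ℂ D := fun n => by
    rw [← sub_sub]
    exact Submodule.sub_mem _ (hmem (r := |ε n| + |ε 0| + 1) (by positivity)
      (hdiff n 0 _ (by positivity) (by linarith))) hy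
  rw [Metric.tendsto_atTop]
  intro δ hδ
  obtain ⟨N, hN⟩ := Metric.tendsto_atTop.1 hlim (δ / (A q + 1)) (by have := hA0 q; positivity)
  refine ⟨N, fun n hn => ?_⟩
  have h1 := hN n hn
  simp only [Real.dist_eq, sub_zero] at h1
  have h2 := lt_of_abs_lt h1
  rw [sub_sub, gauge_def] at h2
  obtain ⟨r, ⟨hr0, hr⟩, hr1⟩ := exists_lt_of_csInf_lt (hspan _ (hxs n)) h2
  have h3 := (hsm hr0).1 hr q hq
  rw [Real.dist_eq, sub_zero, abs_of_nonneg (apply_nonneg _ _)]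
  have hA1 : 0 < A q + 1 := by have := hA0 q; linarith
  calc _ ≤ r * A q := h3
    _ ≤ r * (A q + 1) := by nlinarith
    _ < δ / (A q + 1) * (A q + 1) := mul_lt_mul_of_pos_right hr1 hA1
    _ = δ := by field_simp

/-- If the values `φ (x n)` converge to `ℓ φ` for every `φ`, at a rate which is uniform on every
equicontinuous set of functionals, then `ℓ` is the evaluation at a point of the space. -/
theorem LocallyComplete.exists_of_dual_rate [PolynormableSpace ℂ E] (hE : LocallyComplete E)
    {x : ℕ → E} {ε : ℕ → ℝ} (hε : Tendsto ε atTop (𝓝 0)) {ℓ : (E →L[ℂ] ℂ) → ℂ}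
    (h : ∀ q : Seminorm ℂ E, Continuous q → ∃ C : ℝ, ∀ φ : E →L[ℂ] ℂ, (∀ y, ‖φ y‖ ≤ q y) →
      ∀ n, ‖φ (x n) - ℓ φ‖ ≤ C * ε n) :
    ∃ y, ∀ φ, φ y = ℓ φ := by
  have h2 : ∀ q : Seminorm ℂ E, ∃ C : ℝ, Continuous q → ∀ φ : E →L[ℂ] ℂ, (∀ y, ‖φ y‖ ≤ q y) →
      ∀ n, ‖φ (x n) - ℓ φ‖ ≤ C * ε n := by
    intro q
    by_cases hq : Continuous q
    · obtain ⟨C, hC⟩ := h q hq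
      exact ⟨C, fun _ => hC⟩
    · exact ⟨0, fun h => absurd h hq⟩
  choose C hC using h2
  obtain ⟨y, hy⟩ := hE.exists_tendsto hε (x := x) (C := C) (by
    intro q hq m n
    refine seminorm_le_of_forall_dual hq fun φ hφ => ?_
    have h1 := hC q hq φ hφ m
    have h2 := hC q hq φ hφ n
    rw [map_sub, ← sub_sub_sub_cancel_right _ _ (ℓ φ)]
    refine (norm_sub_le _ _).trans ?_
    linarith)
  refine ⟨y, fun φ => ?_⟩
  have h1 : Tendsto (fun n => φ (x n)) atTop (𝓝 (ℓ φ)) := by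
    rw [tendsto_iff_norm_sub_tendsto_zero]
    refine squeeze_zero (fun _ => norm_nonneg _)
      (hC _ (continuous_dualSeminorm φ) φ fun y => le_rfl) ?_
    simpa using hε.const_mul (C (dualSeminorm φ))
  have h2 : Tendsto (fun n => φ (x n)) atTop (𝓝 (φ y)) := by
    rw [tendsto_iff_norm_sub_tendsto_zero]
    refine (hy _ (continuous_dualSeminorm φ)).congr fun n => ?_
    rw [dualSeminorm_apply, map_sub]
  exact tendsto_nhds_unique h2 h1

end LocallyConvex

/-! ### Weakly holomorphic functions -/

theorem norm_deriv_le_of_closedBall_subset {h : ℂ → ℂ} {U : Set ℂ} {z : ℂ} {r M : ℝ} (hr : 0 < r)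
    (hd : DifferentiableOn ℂ h U) (hU : Metric.closedBall z r ⊆ U)
    (hM : ∀ w ∈ Metric.closedBall z r, ‖h w‖ ≤ M) : ‖deriv h z‖ ≤ M / r :=
  Complex.norm_deriv_le_of_forall_mem_sphere_norm_le hr (hd.diffContOnCl_ball hU)
    fun w hw => hM w (Metric.sphere_subset_closedBall hw)

/-- The remainder of the first order Taylor expansion of a holomorphic function, bounded by the
values of the function alone. -/
theorem norm_sub_sub_deriv_mul_le {h : ℂ → ℂ} {U : Set ℂ} (hU : IsOpen U) {z w : ℂ} {r M : ℝ}
    (hr : 0 < r) (hd : DifferentiableOn ℂ h U) (hsub : Metric.closedBall z (3 * r) ⊆ U)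
    (hM : ∀ w ∈ Metric.closedBall z (3 * r), ‖h w‖ ≤ M) (hw : w ∈ Metric.closedBall z r) :
    ‖h w - h z - deriv h z * (w - z)‖ ≤ M / r / r * ‖w - z‖ * ‖w - z‖ := by
  have hb : ∀ {x y : ℂ} {s t : ℝ}, x ∈ Metric.closedBall z s → y ∈ Metric.closedBall x t →
      y ∈ Metric.closedBall z (s + t) := fun hx hy =>
    Metric.closedBall_subset_closedBall' (by
      rw [Metric.mem_closedBall] at hx; linarith) hy
  have h1 : ∀ x ∈ Metric.closedBall z (2 * r), ‖deriv h x‖ ≤ M / r := fun x hx => by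
    have hs : Metric.closedBall x r ⊆ Metric.closedBall z (3 * r) := fun y hy => by
      have := hb hx hy
      rwa [show 2 * r + r = 3 * r by ring] at this
    exact norm_deriv_le_of_closedBall_subset hr hd (hs.trans hsub) fun y hy => hM y (hs hy)
  have h2 : ∀ x ∈ Metric.closedBall z r, ‖deriv (deriv h) x‖ ≤ M / r / r := fun x hx => by
    have hs : Metric.closedBall x r ⊆ Metric.closedBall z (2 * r) := fun y hy => by
      have := hb hx hy
      rwa [show r + r = 2 * r by ring] at this
    exact norm_deriv_le_of_closedBall_subset hr (hd.deriv hU)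
      (hs.trans ((Metric.closedBall_subset_closedBall (by linarith)).trans hsub))
      fun y hy => h1 y (hs hy)
  have hin : ∀ x ∈ Metric.closedBall z r, x ∈ U := fun x hx =>
    hsub (Metric.closedBall_subset_closedBall (by linarith) hx)
  have hM0 : 0 ≤ M / r / r := (norm_nonneg _).trans (h2 w hw)
  have h3 : ∀ x ∈ Metric.closedBall z r, ‖deriv h x - deriv h z‖ ≤ M / r / r * ‖x - z‖ :=
    fun x hx => (convex_closedBall z r).norm_image_sub_le_of_norm_deriv_le
      (fun y hy => ((hd.deriv hU).differentiableAt (hU.mem_nhds (hin y hy)))) h2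
      (Metric.mem_closedBall_self hr.le) hx
  have hsub' : Metric.closedBall z ‖w - z‖ ⊆ Metric.closedBall z r :=
    Metric.closedBall_subset_closedBall (by rwa [← dist_eq_norm])
  have h4 : ∀ x ∈ Metric.closedBall z ‖w - z‖,
      HasDerivWithinAt (fun x => h x - deriv h z * x) (deriv h x - deriv h z)
        (Metric.closedBall z ‖w - z‖) x := fun x hx => by
    have := (hd.differentiableAt (hU.mem_nhds (hin x (hsub' hx)))).hasDerivAt
    simpa using (this.fun_sub ((hasDerivAt_id' x).const_mul (deriv h z))).hasDerivWithinAt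
  have h5 := (convex_closedBall z ‖w - z‖).norm_image_sub_le_of_norm_hasDerivWithin_le
    (C := M / r / r * ‖w - z‖) h4
    (fun x hx => (h3 x (hsub' hx)).trans (mul_le_mul_of_nonneg_left (by
      simpa [dist_eq_norm] using hx) hM0))
    (Metric.mem_closedBall_self (norm_nonneg _)) (y := w) (by simp [dist_eq_norm])
  refine le_trans (le_of_eq ?_) h5
  congr 1
  ring

section WeakHol

variable {E : Type*} [AddCommGroup E] [Module ℂ E] [TopologicalSpace E]

/-- `g` is weakly holomorphic on `Ω`, and every continuous seminorm is locally bounded along `g`.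
On open sets, this is holomorphy if the space is locally complete. -/
structure WeakHol (g : ℂ → E) (Ω : Set ℂ) : Prop where
  holo : ∀ φ : E →L[ℂ] ℂ, DifferentiableOn ℂ (fun z => φ (g z)) Ω
  bdd : ∀ q : Seminorm ℂ E, Continuous q → ∀ z ∈ Ω, ∃ C, ∀ᶠ w in 𝓝[Ω] z, q (g w) ≤ C

theorem WeakHol.exists_bound {g : ℂ → E} {Ω K : Set ℂ} (hg : WeakHol g Ω) (hK : IsCompact K)
    (hKΩ : K ⊆ Ω) {q : Seminorm ℂ E} (hq : Continuous q) : ∃ C, ∀ w ∈ K, q (g w) ≤ C := by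
  refine hK.induction_on (p := fun s => ∃ C, ∀ w ∈ s, q (g w) ≤ C) ⟨0, by simp⟩ ?_ ?_ ?_
  · rintro s t hst ⟨C, hC⟩
    exact ⟨C, fun w hw => hC w (hst hw)⟩
  · rintro s t ⟨C, hC⟩ ⟨D, hD⟩
    refine ⟨max C D, fun w hw => ?_⟩
    rcases hw with hw | hw
    · exact (hC w hw).trans (le_max_left _ _)
    · exact (hD w hw).trans (le_max_right _ _)
  · intro z hz
    obtain ⟨C, hC⟩ := hg.bdd q hq z (hKΩ hz)
    exact ⟨_, nhdsWithin_mono z hKΩ hC, C, fun w hw => hw⟩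

theorem WeakHol.smul {g : ℂ → E} {Ω : Set ℂ} (hg : WeakHol g Ω) {m : ℂ → ℂ}
    (hm : DifferentiableOn ℂ m Ω) : WeakHol (fun z => m z • g z) Ω where
  holo φ := by simpa using hm.fun_mul (hg.holo φ)
  bdd q hq z hz := by
    obtain ⟨C, hC⟩ := hg.bdd q hq z hz
    have h1 : ∀ᶠ w in 𝓝[Ω] z, ‖m w‖ ≤ ‖m z‖ + 1 :=
      ((hm z hz).continuousWithinAt.norm.eventually_lt_const (lt_add_one _)).mono
        fun w hw => hw.le
    refine ⟨(‖m z‖ + 1) * C, ?_⟩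
    filter_upwards [hC, h1] with w h2 h3
    rw [map_smul_eq_mul]
    exact mul_le_mul h3 h2 (apply_nonneg _ _) (by positivity)

theorem WeakHol.mono {g : ℂ → E} {Ω Ω' : Set ℂ} (hg : WeakHol g Ω) (h : Ω' ⊆ Ω) :
    WeakHol g Ω' where
  holo φ := (hg.holo φ).mono h
  bdd q hq z hz := by
    obtain ⟨C, hC⟩ := hg.bdd q hq z (h hz)
    exact ⟨C, nhdsWithin_mono z h hC⟩

theorem WeakHol.of_differentiableOn [IsTopologicalAddGroup E] [ContinuousSMul ℂ E] {g : ℂ → E}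
    {Ω : Set ℂ} (hg : DifferentiableOn ℂ g Ω) : WeakHol g Ω where
  holo φ z hz := by
    obtain ⟨g', hg'⟩ := hg z hz
    refine ⟨φ.comp g', ?_⟩
    rw [hasFDerivWithinAt_iff_isLittleOTVS] at *
    refine ((φ.isBigOTVS_comp (l := 𝓝[Ω] z)
      (f := fun w => g w - g z - g' (w - z))).trans_isLittleOTVS hg').congr_left fun w => ?_
    simp
  bdd q hq z hz := by
    have h1 : ContinuousWithinAt (fun w => q (g w)) Ω z :=
      hq.continuousAt.comp_continuousWithinAt (hg z hz).continuousWithinAt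
    exact ⟨q (g z) + 1, (h1.eventually_lt_const (lt_add_one _)).mono fun w hw => hw.le⟩

theorem WeakHol.hasDerivAt_dual {g : ℂ → E} {Ω : Set ℂ} (hΩ : IsOpen Ω) (hg : WeakHol g Ω)
    (φ : E →L[ℂ] ℂ) {z : ℂ} (hz : z ∈ Ω) :
    HasDerivAt (fun z => φ (g z)) (deriv (fun z => φ (g z)) z) z :=
  ((hg.holo φ).differentiableAt (hΩ.mem_nhds hz)).hasDerivAt

variable [PolynormableSpace ℂ E]

/-- In a locally complete space weakly holomorphic functions are holomorphic: the difference
quotients converge at a uniform rate. -/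
theorem WeakHol.differentiableOn [IsTopologicalAddGroup E] [ContinuousSMul ℂ E]
    (hE : LocallyComplete E) {g : ℂ → E} {Ω : Set ℂ} (hΩ : IsOpen Ω) (hg : WeakHol g Ω) :
    DifferentiableOn ℂ g Ω := by
  intro z hz
  obtain ⟨R, hR, hball⟩ := Metric.isOpen_iff.1 hΩ z hz
  obtain ⟨r, hr, hr3⟩ : ∃ r, 0 < r ∧ 3 * r < R := ⟨R / 4, by positivity, by linarith⟩
  have hsub : Metric.closedBall z (3 * r) ⊆ Ω :=
    (Metric.closedBall_subset_ball hr3).trans hball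
  have key : ∀ q : Seminorm ℂ E, Continuous q → ∃ C : ℝ, ∀ φ : E →L[ℂ] ℂ, (∀ y, ‖φ y‖ ≤ q y) →
      ∀ w ∈ Metric.closedBall z r, ‖φ (g w) - φ (g z) - deriv (fun z => φ (g z)) z * (w - z)‖
        ≤ C * ‖w - z‖ * ‖w - z‖ := by
    intro q hq
    obtain ⟨M, hM⟩ := hg.exists_bound (isCompact_closedBall z (3 * r)) hsub hq
    exact ⟨M / r / r, fun φ hφ w hw => norm_sub_sub_deriv_mul_le hΩ hr (hg.holo φ) hsub
      (fun y hy => (hφ _).trans (hM y hy)) hw⟩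
  obtain ⟨e, he⟩ := hE.exists_of_dual_rate
    (x := fun n : ℕ => ((r * (1 / ((n : ℝ) + 1)) : ℝ) : ℂ)⁻¹ •
      (g (z + (r * (1 / ((n : ℝ) + 1)) : ℝ)) - g z))
    (ε := fun n : ℕ => r * (1 / ((n : ℝ) + 1))) (ℓ := fun φ => deriv (fun z => φ (g z)) z)
    (by simpa using tendsto_one_div_add_atTop_nhds_zero_nat.const_mul r)
    (by
      intro q hq
      obtain ⟨C, hC⟩ := key q hq
      refine ⟨C, fun φ hφ n => ?_⟩
      set s : ℝ := r * (1 / ((n : ℝ) + 1)) with hs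
      have hs0 : 0 < s := by positivity
      have hsr : s ≤ r := mul_le_of_le_one_right hr.le (by
        rw [div_le_one (by positivity)]; linarith [(Nat.cast_nonneg n : (0 : ℝ) ≤ n)])
      have h1 := hC φ hφ (z + (s : ℂ)) (by simpa [abs_of_pos hs0] using hsr)
      rw [add_sub_cancel_left, Complex.norm_real, Real.norm_of_nonneg hs0.le] at h1
      have h2 : φ ((s : ℂ)⁻¹ • (g (z + s) - g z)) - deriv (fun z => φ (g z)) z
          = (s : ℂ)⁻¹ * (φ (g (z + s)) - φ (g z) - deriv (fun z => φ (g z)) z * s) := by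
        have : (s : ℂ) ≠ 0 := by exact_mod_cast hs0.ne'
        rw [map_smul, map_sub, smul_eq_mul]
        field_simp
      rw [h2, norm_mul, norm_inv, Complex.norm_real, Real.norm_of_nonneg hs0.le,
        inv_mul_le_iff₀ hs0]
      linarith)
  refine ⟨ContinuousLinearMap.toSpanSingleton ℂ e, ?_⟩
  rw [hasFDerivWithinAt_iff_isLittleOTVS]
  have hR0 : Tendsto (fun w => (w - z)⁻¹ • (g w - g z - (w - z) • e)) (𝓝[Ω] z) (𝓝 0) := by
    rw [(PolynormableSpace.withSeminorms ℂ E).tendsto_nhds _ _]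
    rintro ⟨q, hq⟩
    intro ε hε
    obtain ⟨C, hC⟩ := key q hq
    have h1 : Tendsto (fun w => C * ‖w - z‖) (𝓝[Ω] z) (𝓝 0) := by
      have : Continuous fun w => C * ‖w - z‖ := by fun_prop
      simpa using (this.tendsto z).mono_left nhdsWithin_le_nhds
    filter_upwards [h1.eventually_lt_const hε,
      nhdsWithin_le_nhds (Metric.closedBall_mem_nhds z hr)] with w hw hwr
    rw [sub_zero]
    by_cases hzw : w = z
    · simpa [hzw] using hε
    have hpos : 0 < ‖w - z‖ := norm_pos_iff.2 (sub_ne_zero.2 hzw)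
    have h2 : q (g w - g z - (w - z) • e) ≤ C * ‖w - z‖ * ‖w - z‖ :=
      seminorm_le_of_forall_dual hq fun φ hφ => by
        have := hC φ hφ w hwr
        simpa [he, mul_comm] using this
    refine lt_of_le_of_lt ?_ hw
    rw [map_smul_eq_mul, norm_inv, inv_mul_le_iff₀ hpos]
    linarith
  have h3 := ((Asymptotics.isLittleOTVS_one (𝕜 := ℂ)).2 hR0).smul_left (fun w => w - z)
  refine (h3.congr_left fun w => ?_).congr_right fun w => by simp
  by_cases hzw : w = z
  · simp [hzw]
  · rw [smul_inv_smul₀ (sub_ne_zero.2 hzw)]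
    simp

end WeakHol

/-! ### Pettis integrals of holomorphic functions along smooth curves -/

theorem norm_riemannSum_sub_integral_le {k : ℝ → ℂ} {L : ℝ}
    (hk : ∀ s ∈ Icc (0 : ℝ) 1, ∀ t ∈ Icc (0 : ℝ) 1, ‖k t - k s‖ ≤ L * |t - s|) (n : ℕ) :
    ‖(n + 1 : ℂ)⁻¹ * ∑ i ∈ Finset.range (n + 1), k (i / (n + 1 : ℝ)) - ∫ t in (0 : ℝ)..1, k t‖
      ≤ L * (1 / ((n : ℝ) + 1)) := by
  have hn : (0 : ℝ) < n + 1 := by positivity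
  have hL : 0 ≤ L := by
    have := (norm_nonneg _).trans (hk 0 (by simp) 1 (by simp))
    simpa using this
  have hcont : ContinuousOn k (Icc 0 1) := by
    have : LipschitzOnWith ⟨L, hL⟩ k (Icc 0 1) := LipschitzOnWith.of_dist_le_mul fun x hx y hy => by
      rw [dist_eq_norm, Real.dist_eq]; exact hk y hy x hx
    exact this.continuousOn
  set a : ℕ → ℝ := fun i => i / (n + 1 : ℝ) with ha
  have hmem : ∀ i ≤ n + 1, a i ∈ Icc (0 : ℝ) 1 := fun i hi =>
    ⟨by positivity, by rw [ha, div_le_one hn]; exact_mod_cast hi⟩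
  have hsub : ∀ i < n + 1, uIcc (a i) (a (i + 1)) ⊆ Icc 0 1 := fun i hi => by
    have h1 := hmem i hi.le
    have h2 := hmem (i + 1) hi
    exact uIcc_subset_Icc h1 h2
  have hint : ∀ i < n + 1, IntervalIntegrable k MeasureTheory.volume (a i) (a (i + 1)) :=
    fun i hi => (hcont.mono (hsub i hi)).intervalIntegrable
  have hstep : ∀ i, a (i + 1) - a i = (n + 1 : ℝ)⁻¹ := fun i => by
    simp only [ha]; push_cast; field_simp; ring
  have hsum := intervalIntegral.sum_integral_adjacent_intervals hint
  have ha0 : a 0 = 0 := by simp [ha]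
  have ha1 : a (n + 1) = 1 := by simp only [ha]; push_cast; field_simp
  rw [ha0, ha1] at hsum
  rw [← hsum, Finset.mul_sum, ← Finset.sum_sub_distrib]
  refine (norm_sum_le _ _).trans ?_
  have hterm : ∀ i ∈ Finset.range (n + 1),
      ‖(n + 1 : ℂ)⁻¹ * k (a i) - ∫ t in a i..a (i + 1), k t‖
        ≤ L * (n + 1 : ℝ)⁻¹ * (n + 1 : ℝ)⁻¹ := by
    intro i hi
    rw [Finset.mem_range] at hi
    have h1 : (n + 1 : ℂ)⁻¹ * k (a i) = ∫ t in a i..a (i + 1), k (a i) := by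
      rw [intervalIntegral.integral_const, hstep]
      simp
    rw [h1, ← intervalIntegral.integral_sub (by simp) (hint i hi)]
    have hle : a i ≤ a (i + 1) := by
      have := hstep i
      have : (0 : ℝ) < (n + 1 : ℝ)⁻¹ := by positivity
      linarith
    have h2 := intervalIntegral.norm_integral_le_of_norm_le_const (a := a i) (b := a (i + 1))
      (C := L * (n + 1 : ℝ)⁻¹) (f := fun t => k (a i) - k t) (by
        intro t ht
        rw [uIoc_of_le hle] at ht
        have ht1 : t ∈ Icc (0 : ℝ) 1 := hsub i hi (by
          rw [uIcc_of_le hle]; exact Ioc_subset_Icc_self ht)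
        refine (hk t ht1 _ (hmem i hi.le)).trans (mul_le_mul_of_nonneg_left ?_ hL)
        rw [abs_sub_comm, abs_of_pos (sub_pos.2 ht.1), ← hstep i]
        linarith [ht.2])
    rwa [hstep, abs_of_pos (by positivity)] at h2
  refine (Finset.sum_le_sum hterm).trans (le_of_eq ?_)
  rw [Finset.sum_const, Finset.card_range, nsmul_eq_mul]
  push_cast
  field_simp

/-- A holomorphic function has a Pettis integral along a smooth curve: the Riemann sums converge at
a uniform rate. -/
theorem WeakHol.exists_curve_integral {E : Type*} [AddCommGroup E] [Module ℂ E]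
    [TopologicalSpace E] [PolynormableSpace ℂ E] (hE : LocallyComplete E) {g : ℂ → E} {Ω : Set ℂ}
    (hΩ : IsOpen Ω) (hg : WeakHol g Ω) {γ : ℝ → ℂ} (hγ : ContDiff ℝ 2 γ)
    (hγΩ : ∀ t ∈ Icc (0 : ℝ) 1, γ t ∈ Ω) :
    ∃ e : E, ∀ φ : E →L[ℂ] ℂ, φ e = ∫ t in (0 : ℝ)..1, φ (g (γ t)) * deriv γ t := by
  have hγ1 : ∀ t, HasDerivAt γ (deriv γ t) t := fun t =>
    (hγ.differentiable (by norm_num) t).hasDerivAt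
  have hγ' : ContDiff ℝ 1 (deriv γ) := hγ.deriv'
  have hγ2 : ∀ t, HasDerivAt (deriv γ) (deriv (deriv γ) t) t := fun t =>
    (hγ'.differentiable (by norm_num) t).hasDerivAt
  have hγ'' : Continuous (deriv (deriv γ)) := hγ'.continuous_deriv (by norm_num)
  have hK : IsCompact (γ '' Icc 0 1) := isCompact_Icc.image hγ.continuous
  have hKΩ : γ '' Icc 0 1 ⊆ Ω := image_subset_iff.2 hγΩ
  obtain ⟨δ, hδ, hδΩ⟩ := hK.exists_cthickening_subset_open hΩ hKΩ
  obtain ⟨A, hA⟩ := isCompact_Icc.exists_bound_of_continuousOn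
    (hγ'.continuous.continuousOn (s := Icc (0 : ℝ) 1))
  obtain ⟨B, hB⟩ := isCompact_Icc.exists_bound_of_continuousOn
    (hγ''.continuousOn (s := Icc (0 : ℝ) 1))
  refine hE.exists_of_dual_rate
    (x := fun n : ℕ => (n + 1 : ℂ)⁻¹ • ∑ i ∈ Finset.range (n + 1),
      deriv γ (i / (n + 1 : ℝ)) • g (γ (i / (n + 1 : ℝ))))
    tendsto_one_div_add_atTop_nhds_zero_nat (fun q hq => ?_)
  obtain ⟨M, hM⟩ := hg.exists_bound hK.cthickening hδΩ hq
  refine ⟨M / δ * A * A + M * B, fun φ hφ n => ?_⟩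
  have hlip : ∀ s ∈ Icc (0 : ℝ) 1, ∀ t ∈ Icc (0 : ℝ) 1,
      ‖φ (g (γ t)) * deriv γ t - φ (g (γ s)) * deriv γ s‖
        ≤ (M / δ * A * A + M * B) * |t - s| := by
    intro s hs t ht
    refine (convex_Icc (0 : ℝ) 1).norm_image_sub_le_of_norm_hasDerivWithin_le
      (f := fun t => φ (g (γ t)) * deriv γ t)
      (f' := fun t => deriv (fun z => φ (g z)) (γ t) * deriv γ t * deriv γ t +
        φ (g (γ t)) * deriv (deriv γ) t) (fun x hx => ?_) (fun x hx => ?_) hs ht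
    · exact (((hg.hasDerivAt_dual hΩ φ (hγΩ x hx)).comp x (hγ1 x)).mul (hγ2 x)).hasDerivWithinAt
    · have hx' : γ x ∈ γ '' Icc 0 1 := mem_image_of_mem γ hx
      have hb : Metric.closedBall (γ x) δ ⊆ Metric.cthickening δ (γ '' Icc 0 1) :=
        Metric.closedBall_subset_cthickening hx' δ
      have h1 : ‖deriv (fun z => φ (g z)) (γ x)‖ ≤ M / δ :=
        norm_deriv_le_of_closedBall_subset hδ (hg.holo φ) (hb.trans hδΩ)
          fun w hw => (hφ _).trans (hM w (hb hw))
      have h2 : ‖φ (g (γ x))‖ ≤ M :=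
        (hφ _).trans (hM _ (hb (Metric.mem_closedBall_self hδ.le)))
      have hM0 := (norm_nonneg _).trans h2
      have hA0 := (norm_nonneg _).trans (hA x hx)
      refine (norm_add_le _ _).trans (add_le_add ?_ ?_)
      · rw [norm_mul, norm_mul]
        have := hA x hx
        gcongr
      · rw [norm_mul]
        have := hB x hx
        gcongr
  have h := norm_riemannSum_sub_integral_le (k := fun t => φ (g (γ t)) * deriv γ t) hlip n
  refine le_trans (le_of_eq ?_) h
  congr 2
  rw [map_smul, map_sum, smul_eq_mul]
  congr 1
  exact Finset.sum_congr rfl fun i _ => by rw [map_smul, smul_eq_mul, mul_comm]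

/-! ### Holomorphic parameter integrals -/

theorem differentiableOn_integral {α : Type*} [MeasurableSpace α] {μ : MeasureTheory.Measure α}
    {k : ℂ → α → ℂ} {U : Set ℂ} (hU : IsOpen U)
    (hmeas : ∀ z ∈ U, MeasureTheory.AEStronglyMeasurable (k z) μ)
    (hd : ∀ᵐ t ∂μ, DifferentiableOn ℂ (fun z => k z t) U)
    (hb : ∀ z ∈ U, ∃ r > 0, ∃ bound : α → ℝ, MeasureTheory.Integrable bound μ ∧
      ∀ᵐ t ∂μ, ∀ w ∈ Metric.closedBall z r, ‖k w t‖ ≤ bound t) :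
    DifferentiableOn ℂ (fun z => ∫ t, k z t ∂μ) U := by
  intro z hz
  obtain ⟨r₁, hr₁, bound, hbi, hbd⟩ := hb z hz
  obtain ⟨R, hR, hRU⟩ := Metric.isOpen_iff.1 hU z hz
  obtain ⟨r, hr, hrr₁, hrR⟩ : ∃ r, 0 < r ∧ 2 * r ≤ r₁ ∧ 2 * r < R :=
    ⟨min r₁ (R / 2) / 2, by positivity, by linarith [min_le_left r₁ (R / 2)],
      by linarith [min_le_right r₁ (R / 2)]⟩
  have hsub : Metric.closedBall z (2 * r) ⊆ U := (Metric.closedBall_subset_ball hrR).trans hRU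
  have hin : ∀ w ∈ Metric.ball z r, Metric.closedBall w r ⊆ Metric.closedBall z (2 * r) :=
    fun w hw => Metric.closedBall_subset_closedBall' (by
      rw [Metric.mem_ball] at hw; linarith)
  have hder : ∀ᵐ t ∂μ, ∀ w ∈ Metric.ball z r,
      HasDerivAt (fun z => k z t) (deriv (fun z => k z t) w) w := by
    filter_upwards [hd] with t ht w hw
    exact (ht.differentiableAt (hU.mem_nhds (hsub (hin w hw
      (Metric.mem_closedBall_self hr.le))))).hasDerivAt
  refine (hasDerivAt_integral_of_dominated_loc_of_deriv_le (F := k) (bound := fun t => bound t / r)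
    (F' := fun w t => deriv (fun z => k z t) w)
    (Metric.ball_mem_nhds z hr) ?_ ?_ ?_ ?_ (hbi.div_const r)
    hder).2.differentiableAt.differentiableWithinAt
  · filter_upwards [hU.mem_nhds hz] with w hw using hmeas w hw
  · refine hbi.mono' (hmeas z hz) ?_
    filter_upwards [hbd] with t ht using ht z (Metric.mem_closedBall_self hr₁.le)
  · -- The derivative is measurable as a limit of difference quotients.
    have hs : ∀ n : ℕ, z + (r * (1 / ((n : ℝ) + 1)) : ℝ) ∈ U := fun n => hsub (by
      have h1 : 1 / ((n : ℝ) + 1) ≤ 1 := by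
        rw [div_le_one (by positivity)]; linarith [(Nat.cast_nonneg n : (0 : ℝ) ≤ n)]
      have h2 : 0 ≤ r * (1 / ((n : ℝ) + 1)) := by positivity
      rw [Metric.mem_closedBall, dist_self_add_left, Complex.norm_real, Real.norm_of_nonneg h2]
      nlinarith)
    refine aestronglyMeasurable_of_tendsto_ae atTop
      (f := fun (n : ℕ) t => ((r * (1 / ((n : ℝ) + 1)) : ℝ) : ℂ)⁻¹ *
        (k (z + (r * (1 / ((n : ℝ) + 1)) : ℝ)) t - k z t))
      (fun n => ((hmeas _ (hs n)).sub (hmeas z hz)).const_mul _) ?_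
    filter_upwards [hder] with t ht
    have h1 := (ht z (Metric.mem_ball_self hr)).tendsto_slope_zero
    have h2 : Tendsto (fun n : ℕ => ((r * (1 / ((n : ℝ) + 1)) : ℝ) : ℂ)) atTop (𝓝[≠] 0) := by
      rw [tendsto_nhdsWithin_iff]
      refine ⟨?_, Eventually.of_forall fun n => ?_⟩
      · have := (Complex.continuous_ofReal.tendsto _).comp
          ((tendsto_one_div_add_atTop_nhds_zero_nat (𝕜 := ℝ)).const_mul r)
        simpa [Function.comp_def] using this
      · have : r * (1 / ((n : ℝ) + 1)) ≠ 0 := by positivity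
        exact Complex.ofReal_ne_zero.2 this
    simpa [Function.comp_def] using h1.comp h2
  · filter_upwards [hbd, hd] with t ht htd w hw
    exact norm_deriv_le_of_closedBall_subset hr htd ((hin w hw).trans hsub) fun y hy =>
      ht y (Metric.closedBall_subset_closedBall hrr₁ (hin w hw hy))

/-! ### The contour around `[a,b]` -/

section Contour

variable {a b c : ℝ}

theorem contDiff_contour (a b c : ℝ) (j : Fin 4) {n : WithTop ℕ∞} :
    ContDiff ℝ n (contour a b c j) := by
  have h : ContDiff ℝ n (fun t : ℝ => (t : ℂ)) := Complex.ofRealCLM.contDiff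
  fin_cases j
  · exact (contDiff_const.add (h.mul contDiff_const)).add contDiff_const
  · exact contDiff_const.add (contDiff_const.mul
      (contDiff_const.mul (contDiff_const.sub (contDiff_const.mul h))).cexp)
  · exact (contDiff_const.add (h.mul contDiff_const)).sub contDiff_const
  · exact contDiff_const.add (contDiff_const.mul
      (contDiff_const.mul (contDiff_const.sub (contDiff_const.mul h))).cexp)

theorem hasDerivAt_contour (a b c : ℝ) (j : Fin 4) (t : ℝ) :
    HasDerivAt (contour a b c j) (deriv (contour a b c j) t) t :=
  ((contDiff_contour a b c j (n := 1)).differentiable (by norm_num) t).hasDerivAt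

theorem continuous_contour (a b c : ℝ) (j : Fin 4) : Continuous (contour a b c j) :=
  (contDiff_contour a b c j (n := 0)).continuous

theorem continuous_deriv_contour (a b c : ℝ) (j : Fin 4) :
    Continuous (deriv (contour a b c j)) :=
  (contDiff_contour a b c j (n := 1)).continuous_deriv (by norm_num)

theorem deriv_contour_zero (a b c t : ℝ) : deriv (contour a b c 0) t = b - a := by
  have h : HasDerivAt (fun t : ℝ => (t : ℂ)) 1 t := Complex.ofRealCLM.hasDerivAt
  have := (((h.mul_const ((b : ℂ) - a)).const_add (a : ℂ)).add_const (c * I)).deriv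
  simpa [contour] using this

theorem deriv_contour_two (a b c t : ℝ) : deriv (contour a b c 2) t = a - b := by
  have h : HasDerivAt (fun t : ℝ => (t : ℂ)) 1 t := Complex.ofRealCLM.hasDerivAt
  have := (((h.mul_const ((a : ℂ) - b)).const_add (b : ℂ)).sub_const (c * I)).deriv
  simpa [contour] using this

theorem deriv_contour_one (a b c t : ℝ) : deriv (contour a b c 1) t =
    -(I * Real.pi) * (c * exp (I * (Real.pi / 2 - Real.pi * t))) := by
  have h : HasDerivAt (fun t : ℝ => (t : ℂ)) 1 t := Complex.ofRealCLM.hasDerivAt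
  have := ((((h.const_mul (Real.pi : ℂ)).const_sub (Real.pi / 2 : ℂ)).const_mul
    I).cexp.const_mul (c : ℂ)).const_add (b : ℂ) |>.deriv
  simp only [contour, Matrix.cons_val_one, Matrix.cons_val_zero]
  rw [this]; ring

theorem deriv_contour_three (a b c t : ℝ) : deriv (contour a b c 3) t =
    -(I * Real.pi) * (c * exp (I * (-(Real.pi / 2) - Real.pi * t))) := by
  have h : HasDerivAt (fun t : ℝ => (t : ℂ)) 1 t := Complex.ofRealCLM.hasDerivAt
  have := ((((h.const_mul (Real.pi : ℂ)).const_sub (-(Real.pi / 2) : ℂ)).const_mul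
    I).cexp.const_mul (c : ℂ)).const_add (a : ℂ) |>.deriv
  simp only [contour, Matrix.cons_val]
  rw [this]; ring

theorem exp_I_mul_pi_div_two : exp (I * (Real.pi / 2)) = I := by
  rw [mul_comm, Complex.exp_pi_div_two_mul_I]

theorem exp_neg_I_mul_pi_div_two : exp (-(I * (Real.pi / 2))) = -I := by
  rw [Complex.exp_neg, exp_I_mul_pi_div_two, Complex.inv_I]

theorem norm_deriv_contour_le (hab : a ≤ b) (hc : 0 ≤ c) (j : Fin 4) (t : ℝ) :
    ‖deriv (contour a b c j) t‖ ≤ b - a + Real.pi * c := by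
  have hpi := Real.pi_pos
  have hpc : 0 ≤ Real.pi * c := by positivity
  have h0 : ‖(b : ℂ) - a‖ = b - a := by
    rw [← ofReal_sub, Complex.norm_real, Real.norm_of_nonneg (by linarith)]
  have hexp : ∀ s : ℝ, ‖exp (I * (s : ℂ))‖ = 1 := fun s => by
    rw [mul_comm, Complex.norm_exp_ofReal_mul_I]
  fin_cases j
  · simp only [Fin.zero_eta, deriv_contour_zero]
    rw [h0]; linarith
  · have := hexp (Real.pi / 2 - Real.pi * t)
    push_cast at this
    simp only [Fin.mk_one, deriv_contour_one, norm_mul, norm_neg, this, Complex.norm_real, norm_I,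
      Real.norm_of_nonneg hpi.le, Real.norm_of_nonneg hc]
    linarith
  · simp only [Fin.reduceFinMk, deriv_contour_two]
    rw [norm_sub_rev, h0]; linarith
  · have := hexp (-(Real.pi / 2) - Real.pi * t)
    push_cast at this
    simp only [Fin.reduceFinMk, deriv_contour_three, norm_mul, norm_neg, this, Complex.norm_real,
      norm_I, Real.norm_of_nonneg hpi.le, Real.norm_of_nonneg hc]
    linarith

theorem contour_zero_zero : contour a b c 0 0 = a + c * I := by simp [contour]
theorem contour_zero_one : contour a b c 0 1 = b + c * I := by simp [contour]
theorem contour_one_zero : contour a b c 1 0 = b + c * I := by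
  simp [contour, exp_I_mul_pi_div_two]
theorem contour_one_one : contour a b c 1 1 = b - c * I := by
  simp only [contour, Matrix.cons_val_one, Matrix.cons_val_zero, ofReal_one]
  rw [show I * ((Real.pi : ℂ) / 2 - Real.pi * 1) = -(I * (Real.pi / 2)) by ring,
    exp_neg_I_mul_pi_div_two]
  ring
theorem contour_two_zero : contour a b c 2 0 = b - c * I := by simp [contour]
theorem contour_two_one : contour a b c 2 1 = a - c * I := by simp [contour]
theorem contour_three_zero : contour a b c 3 0 = a - c * I := by
  simp [contour, exp_neg_I_mul_pi_div_two]; ring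
theorem contour_three_one : contour a b c 3 1 = a + c * I := by
  simp only [contour, Matrix.cons_val, ofReal_one]
  rw [show I * (-((Real.pi : ℂ) / 2) - Real.pi * 1) = I * (Real.pi / 2) - 2 * Real.pi * I by ring,
    Complex.exp_sub, exp_I_mul_pi_div_two, Complex.exp_two_pi_mul_I]
  simp

/-- The set of points on the contour. -/
def contourTrace (a b c : ℝ) : Set ℂ := ⋃ j, contour a b c j '' Icc 0 1

theorem contour_mem_trace (a b c : ℝ) (j : Fin 4) {t : ℝ} (ht : t ∈ Icc (0 : ℝ) 1) :
    contour a b c j t ∈ contourTrace a b c :=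
  mem_iUnion.2 ⟨j, mem_image_of_mem _ ht⟩

theorem isCompact_contourTrace (a b c : ℝ) : IsCompact (contourTrace a b c) :=
  isCompact_iUnion fun j => isCompact_Icc.image (continuous_contour a b c j)

/-- A point of the contour is `x + c u` where `x` is a nearest point of `[a,b]` and `u` is an outer
unit normal at `x`. -/
theorem exists_of_mem_contourTrace (hab : a ≤ b) {w : ℂ} (hw : w ∈ contourTrace a b c) :
    ∃ x ∈ Icc a b, ∃ u : ℂ, ‖u‖ = 1 ∧ w = x + c * u ∧ ∀ y ∈ Icc a b, 0 ≤ (x - y) * u.re := by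
  obtain ⟨j, t, ⟨ht0, ht1⟩, rfl⟩ := mem_iUnion.1 hw
  have hsin : 0 ≤ Real.sin (Real.pi * t) := by
    apply Real.sin_nonneg_of_nonneg_of_le_pi
    · have := Real.pi_pos; positivity
    · nlinarith [Real.pi_pos]
  have hexp : ∀ s : ℝ, ‖exp (I * (s : ℂ))‖ = 1 := fun s => by
    rw [mul_comm, Complex.norm_exp_ofReal_mul_I]
  have hre : ∀ s : ℝ, (exp (I * (s : ℂ))).re = Real.cos s := fun s => by
    rw [mul_comm, Complex.exp_ofReal_mul_I_re]
  fin_cases j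
  · exact ⟨a + t * (b - a), ⟨by nlinarith, by nlinarith⟩, I, by simp, by simp [contour],
      fun y _ => by simp⟩
  · have h1 := hexp (Real.pi / 2 - Real.pi * t)
    have h2 := hre (Real.pi / 2 - Real.pi * t)
    rw [Real.cos_pi_div_two_sub] at h2
    push_cast at h1 h2
    refine ⟨b, ⟨hab, le_rfl⟩, _, h1, by simp [contour], fun y hy => ?_⟩
    rw [h2]
    exact mul_nonneg (by linarith [hy.2]) hsin
  · exact ⟨b + t * (a - b), ⟨by nlinarith, by nlinarith⟩, -I, by simp, by simp [contour]; ring,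
      fun y _ => by simp⟩
  · have h1 := hexp (-(Real.pi / 2) - Real.pi * t)
    have h2 := hre (-(Real.pi / 2) - Real.pi * t)
    rw [show -(Real.pi / 2) - Real.pi * t = -(Real.pi * t + Real.pi / 2) by ring, Real.cos_neg,
      Real.cos_add_pi_div_two] at h2
    rw [show -(Real.pi * t + Real.pi / 2) = -(Real.pi / 2) - Real.pi * t by ring] at h2
    push_cast at h1 h2
    refine ⟨a, ⟨le_rfl, hab⟩, _, h1, by simp [contour], fun y hy => ?_⟩
    rw [h2]
    nlinarith [hy.1]

theorem le_dist_of_mem_contourTrace (hab : a ≤ b) (hc : 0 ≤ c) {w : ℂ}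
    (hw : w ∈ contourTrace a b c) {y : ℂ} (hy : y ∈ interval a b) : c ≤ dist w y := by
  obtain ⟨x, hx, u, hu, rfl, hux⟩ := exists_of_mem_contourTrace hab hw
  obtain ⟨y, hy, rfl⟩ := hy
  have h1 := hux y hy
  have h2 : u.re * u.re + u.im * u.im = 1 := by
    rw [← Complex.normSq_apply, Complex.normSq_eq_norm_sq, hu, one_pow]
  rw [dist_eq_norm]
  refine le_of_sq_le_sq ?_ (norm_nonneg _)
  rw [← Complex.normSq_eq_norm_sq, Complex.normSq_apply]
  simp
  have h3 : c ^ 2 * (u.re * u.re + u.im * u.im) = c ^ 2 := by rw [h2, mul_one]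
  nlinarith [mul_nonneg hc h1, sq_nonneg (x - y)]

theorem isCompact_interval (a b : ℝ) : IsCompact (interval a b) :=
  isCompact_Icc.image Complex.continuous_ofReal

theorem isOpen_compl_interval (a b : ℝ) : IsOpen (interval a b)ᶜ :=
  (isCompact_interval a b).isClosed.isOpen_compl

theorem interval_nonempty (hab : a ≤ b) : (interval a b).Nonempty :=
  ⟨a, a, ⟨le_rfl, hab⟩, rfl⟩

theorem convex_interval (a b : ℝ) : Convex ℝ (interval a b) :=
  (convex_Icc a b).linear_image Complex.ofRealCLM.toLinearMap

theorem infDist_of_mem_contourTrace (hab : a ≤ b) (hc : 0 ≤ c) {w : ℂ}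
    (hw : w ∈ contourTrace a b c) : Metric.infDist w (interval a b) = c := by
  refine le_antisymm ?_ ?_
  · obtain ⟨x, hx, u, hu, rfl, -⟩ := exists_of_mem_contourTrace hab hw
    refine (Metric.infDist_le_dist_of_mem (mem_image_of_mem _ hx)).trans ?_
    simp [dist_eq_norm, hu, abs_of_nonneg hc]
  · exact (Metric.le_infDist (interval_nonempty hab)).2 fun y hy =>
      le_dist_of_mem_contourTrace hab hc hw hy

theorem contourTrace_subset_compl (hab : a ≤ b) (hc : 0 < c) :
    contourTrace a b c ⊆ (interval a b)ᶜ := fun w hw hwK => by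
  have := le_dist_of_mem_contourTrace hab hc.le hw hwK
  rw [dist_self] at this
  linarith

/-- The contour integral of a scalar function. -/
noncomputable def contourIntegral (a b c : ℝ) (h : ℂ → ℂ) : ℂ :=
  ∑ j, ∫ t in (0 : ℝ)..1, h (contour a b c j t) * deriv (contour a b c j) t

theorem continuousOn_contour_integrand {h : ℂ → ℂ} (hh : ContinuousOn h (contourTrace a b c))
    (j : Fin 4) :
    ContinuousOn (fun t => h (contour a b c j t) * deriv (contour a b c j) t) (Icc 0 1) :=
  (hh.comp (continuous_contour a b c j).continuousOn fun _ ht =>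
    contour_mem_trace a b c j ht).mul (continuous_deriv_contour a b c j).continuousOn

theorem intervalIntegrable_contour {h : ℂ → ℂ} (hh : ContinuousOn h (contourTrace a b c))
    (j : Fin 4) : IntervalIntegrable
      (fun t => h (contour a b c j t) * deriv (contour a b c j) t) MeasureTheory.volume 0 1 :=
  ContinuousOn.intervalIntegrable (by
    rw [uIcc_of_le zero_le_one]; exact continuousOn_contour_integrand hh j)

theorem contourIntegral_congr {h k : ℂ → ℂ} (hk : EqOn h k (contourTrace a b c)) :
    contourIntegral a b c h = contourIntegral a b c k := by
  refine Finset.sum_congr rfl fun j _ => intervalIntegral.integral_congr fun t ht => ?_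
  rw [uIcc_of_le zero_le_one] at ht
  simp only [hk (contour_mem_trace a b c j ht)]

theorem contourIntegral_sub {h k : ℂ → ℂ} (hh : ContinuousOn h (contourTrace a b c))
    (hk : ContinuousOn k (contourTrace a b c)) :
    contourIntegral a b c (fun w => h w - k w) =
      contourIntegral a b c h - contourIntegral a b c k := by
  simp only [contourIntegral, ← Finset.sum_sub_distrib]
  refine Finset.sum_congr rfl fun j _ => ?_
  rw [← intervalIntegral.integral_sub (intervalIntegrable_contour hh j)
    (intervalIntegrable_contour hk j)]
  simp only [sub_mul]

theorem contourIntegral_add {h k : ℂ → ℂ} (hh : ContinuousOn h (contourTrace a b c))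
    (hk : ContinuousOn k (contourTrace a b c)) :
    contourIntegral a b c (fun w => h w + k w) =
      contourIntegral a b c h + contourIntegral a b c k := by
  simp only [contourIntegral, ← Finset.sum_add_distrib]
  refine Finset.sum_congr rfl fun j _ => ?_
  rw [← intervalIntegral.integral_add (intervalIntegrable_contour hh j)
    (intervalIntegrable_contour hk j)]
  simp only [add_mul]

theorem contourIntegral_const_mul (s : ℂ) (h : ℂ → ℂ) :
    contourIntegral a b c (fun w => s * h w) = s * contourIntegral a b c h := by
  simp only [contourIntegral, Finset.mul_sum, mul_assoc, intervalIntegral.integral_const_mul]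

theorem norm_contourIntegral_le (hab : a ≤ b) (hc : 0 ≤ c) {h : ℂ → ℂ} {M : ℝ}
    (hM : ∀ w ∈ contourTrace a b c, ‖h w‖ ≤ M) :
    ‖contourIntegral a b c h‖ ≤ 4 * (M * (b - a + Real.pi * c)) := by
  have h1 : ∀ j ∈ (Finset.univ : Finset (Fin 4)),
      ‖∫ t in (0 : ℝ)..1, h (contour a b c j t) * deriv (contour a b c j) t‖
        ≤ M * (b - a + Real.pi * c) := by
    intro j _
    have := intervalIntegral.norm_integral_le_of_norm_le_const (a := (0 : ℝ)) (b := 1)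
      (f := fun t => h (contour a b c j t) * deriv (contour a b c j) t)
      (C := M * (b - a + Real.pi * c)) (by
        intro t ht
        rw [uIoc_of_le zero_le_one] at ht
        have h2 := hM _ (contour_mem_trace a b c j (Ioc_subset_Icc_self ht))
        rw [norm_mul]
        exact mul_le_mul h2 (norm_deriv_contour_le hab hc j t) (norm_nonneg _)
          ((norm_nonneg _).trans h2))
    simpa using this
  refine (norm_sum_le _ _).trans ((Finset.sum_le_sum h1).trans (le_of_eq ?_))
  simp

theorem integral_comp_contour_eq_sub {h G : ℂ → ℂ} {j : Fin 4}
    (hh : ContinuousOn h (contourTrace a b c))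
    (hG : ∀ t ∈ Icc (0 : ℝ) 1, HasDerivAt G (h (contour a b c j t)) (contour a b c j t)) :
    ∫ t in (0 : ℝ)..1, h (contour a b c j t) * deriv (contour a b c j) t =
      G (contour a b c j 1) - G (contour a b c j 0) :=
  intervalIntegral.integral_eq_sub_of_hasDerivAt (f := fun t => G (contour a b c j t))
    (fun t ht => by
      rw [uIcc_of_le zero_le_one] at ht
      exact (hG t ht).comp t (hasDerivAt_contour a b c j t))
    (intervalIntegrable_contour hh j)

theorem contourIntegral_eq_zero_of_hasDerivAt {h G : ℂ → ℂ}
    (hh : ContinuousOn h (contourTrace a b c))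
    (hG : ∀ w ∈ contourTrace a b c, HasDerivAt G (h w) w) : contourIntegral a b c h = 0 := by
  rw [contourIntegral, Fin.sum_univ_four]
  have := fun j => integral_comp_contour_eq_sub (j := j) hh
    fun t ht => hG _ (contour_mem_trace a b c j ht)
  rw [this, this, this, this, contour_zero_zero, contour_zero_one, contour_one_zero,
    contour_one_one, contour_two_zero, contour_two_one, contour_three_zero, contour_three_one]
  ring

theorem exists_primitive {U : Set ℂ} (hU : IsOpen U) (hUc : Convex ℝ U) {h : ℂ → ℂ}
    (hh : DifferentiableOn ℂ h U) : ∃ G : ℂ → ℂ, ∀ z ∈ U, HasDerivAt G (h z) z := by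
  obtain ⟨G, hG⟩ := hUc.exists_forall_hasDerivWithinAt hh
  exact ⟨G, fun z hz => (hG z hz).hasDerivAt (hU.mem_nhds hz)⟩

theorem contourIntegral_eq_zero_of_convex {U : Set ℂ} (hU : IsOpen U) (hUc : Convex ℝ U)
    {h : ℂ → ℂ} (hh : DifferentiableOn ℂ h U) (hsub : contourTrace a b c ⊆ U) :
    contourIntegral a b c h = 0 := by
  obtain ⟨G, hG⟩ := exists_primitive hU hUc hh
  exact contourIntegral_eq_zero_of_hasDerivAt (hh.continuousOn.mono hsub)
    fun w hw => hG w (hsub hw)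

theorem differentiableOn_contourIntegral {k : ℂ → ℂ → ℂ} {U : Set ℂ} (hU : IsOpen U)
    (hcont : ∀ z ∈ U, ContinuousOn (k z) (contourTrace a b c))
    (hd : ∀ w ∈ contourTrace a b c, DifferentiableOn ℂ (fun z => k z w) U)
    (hb : ∀ z ∈ U, ∃ r > 0, ∃ M, ∀ w ∈ contourTrace a b c, ∀ z' ∈ Metric.closedBall z r,
      ‖k z' w‖ ≤ M) :
    DifferentiableOn ℂ (fun z => contourIntegral a b c (k z)) U := by
  refine DifferentiableOn.fun_sum fun j _ => ?_
  simp only [intervalIntegral.integral_of_le zero_le_one]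
  have hmem : ∀ᵐ t ∂(MeasureTheory.volume.restrict (Ioc (0 : ℝ) 1)), t ∈ Ioc (0 : ℝ) 1 :=
    MeasureTheory.ae_restrict_mem measurableSet_Ioc
  refine differentiableOn_integral hU (fun z hz => ?_) ?_ fun z hz => ?_
  · exact ((continuousOn_contour_integrand (hcont z hz) j).mono
      Ioc_subset_Icc_self).aestronglyMeasurable measurableSet_Ioc
  · filter_upwards [hmem] with t ht
    exact (hd _ (contour_mem_trace a b c j (Ioc_subset_Icc_self ht))).mul_const _
  · obtain ⟨r, hr, M, hM⟩ := hb z hz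
    refine ⟨r, hr, fun t => M * ‖deriv (contour a b c j) t‖, ?_, ?_⟩
    · exact (((continuous_deriv_contour a b c j).norm.const_mul M).continuousOn.integrableOn_Icc
        (a := 0) (b := 1)).mono_set Ioc_subset_Icc_self
    · filter_upwards [hmem] with t ht z' hz'
      rw [norm_mul]
      exact mul_le_mul_of_nonneg_right
        (hM _ (contour_mem_trace a b c j (Ioc_subset_Icc_self ht)) z' hz') (norm_nonneg _)

end Contour

/-! ### Cauchy's theorem and Cauchy's formula for the contour -/

section Cauchy

variable {a b c : ℝ}

theorem eq_ofReal_of_mem_interval {w : ℂ} (hw : w ∈ interval a b) :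
    w.im = 0 ∧ a ≤ w.re ∧ w.re ≤ b := by
  obtain ⟨x, hx, rfl⟩ := hw
  exact ⟨by simp, by simpa using hx.1, by simpa using hx.2⟩

/-- The strip `|Im u| < π`, on which the exponential function avoids the negative real axis. -/
def expStrip : Set ℂ := {u | -Real.pi < u.im} ∩ {u | u.im < Real.pi}

theorem isOpen_expStrip : IsOpen expStrip :=
  (isOpen_lt continuous_const Complex.continuous_im).inter
    (isOpen_lt Complex.continuous_im continuous_const)

theorem convex_expStrip : Convex ℝ expStrip :=
  (convex_halfSpace_im_gt _).inter (convex_halfSpace_im_lt _)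

theorem re_exp_pos_of_im_eq_zero {u : ℂ} (hu : u ∈ expStrip) (h : (exp u).im = 0) :
    0 < (exp u).re := by
  rw [Complex.exp_im, mul_eq_zero] at h
  have h1 : u.im = 0 := (Real.sin_eq_zero_iff_of_lt_of_lt hu.1 hu.2).1
    (h.resolve_left (Real.exp_pos _).ne')
  rw [Complex.exp_re, h1, Real.cos_zero, mul_one]
  exact Real.exp_pos _

theorem exists_primitive_add_exp {m s : ℂ} {h : ℂ → ℂ}
    (hh : DifferentiableOn ℂ h (interval a b)ᶜ)
    (hm : ∀ u ∈ expStrip, m + s * exp u ∈ (interval a b)ᶜ) :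
    ∃ Q : ℂ → ℂ, ∀ u ∈ expStrip, HasDerivAt Q (h (m + s * exp u) * (s * exp u)) u := by
  refine exists_primitive isOpen_expStrip convex_expStrip ?_
  have h1 : DifferentiableOn ℂ (fun u => m + s * exp u) expStrip := by fun_prop
  exact (hh.comp h1 hm).fun_mul (by fun_prop)

/-- The contour integral of a function holomorphic off `[a,b]` does not depend on the radius. The
primitives on the half planes above and below `[a,b]`, and those in logarithmic coordinates around
the end points, express it as a function of `c` whose derivative vanishes. -/
theorem contourIntegral_eq_contourIntegral {h : ℂ → ℂ} (hab : a ≤ b)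
    (hh : DifferentiableOn ℂ h (interval a b)ᶜ) {c₁ c₂ : ℝ} (hc₁ : 0 < c₁) (hc₂ : 0 < c₂) :
    contourIntegral a b c₁ h = contourIntegral a b c₂ h := by
  have hpi := Real.pi_pos
  obtain ⟨P, hP⟩ := exists_primitive (isOpen_lt continuous_const Complex.continuous_im)
    (convex_halfSpace_im_gt 0)
    (hh.mono fun w (hw : 0 < w.im) hwK => hw.ne' (eq_ofReal_of_mem_interval hwK).1)
  obtain ⟨N, hN⟩ := exists_primitive (isOpen_lt Complex.continuous_im continuous_const)
    (convex_halfSpace_im_lt 0)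
    (hh.mono fun w (hw : w.im < 0) hwK => hw.ne (eq_ofReal_of_mem_interval hwK).1)
  obtain ⟨Q, hQ⟩ := exists_primitive_add_exp (m := b) (s := 1) hh (fun u hu hK => by
    obtain ⟨h1, -, h2⟩ := eq_ofReal_of_mem_interval hK
    have := re_exp_pos_of_im_eq_zero hu (by simpa using h1)
    simp only [one_mul, add_re, ofReal_re] at h2
    linarith)
  obtain ⟨R, hR⟩ := exists_primitive_add_exp (m := a) (s := -1) hh (fun u hu hK => by
    obtain ⟨h1, h2, -⟩ := eq_ofReal_of_mem_interval hK
    have := re_exp_pos_of_im_eq_zero hu (by simpa using h1)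
    simp only [neg_mul, one_mul, add_re, ofReal_re, neg_re] at h2
    linarith)
  simp only [one_mul, neg_mul] at hQ hR
  set f : ℝ → ℂ := fun c => (P (b + c * I) - P (a + c * I)) +
    (Q (Real.log c + -(I * (Real.pi / 2))) - Q (Real.log c + I * (Real.pi / 2))) +
    (N (a - c * I) - N (b - c * I)) +
    (R (Real.log c + -(I * (Real.pi / 2))) - R (Real.log c + I * (Real.pi / 2))) with hf
  have hS1 : ∀ c : ℝ, (Real.log c : ℂ) + I * (Real.pi / 2) ∈ expStrip := fun c => by
    constructor <;> simp <;> linarith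
  have hS2 : ∀ c : ℝ, (Real.log c : ℂ) + -(I * (Real.pi / 2)) ∈ expStrip := fun c => by
    constructor <;> simp <;> linarith
  have hE1 : ∀ c : ℝ, 0 < c → exp ((Real.log c : ℂ) + I * (Real.pi / 2)) = c * I := fun c hc => by
    rw [Complex.exp_add, exp_I_mul_pi_div_two, ← Complex.ofReal_exp, Real.exp_log hc]
  have hE2 : ∀ c : ℝ, 0 < c → exp ((Real.log c : ℂ) + -(I * (Real.pi / 2))) = -(c * I) :=
    fun c hc => by
      rw [Complex.exp_add, exp_neg_I_mul_pi_div_two, ← Complex.ofReal_exp, Real.exp_log hc]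
      ring
  -- The function `f` is constant.
  have hderiv : ∀ c : ℝ, 0 < c → HasDerivAt f 0 c := by
    intro c hc
    have hc0 : (c : ℂ) ≠ 0 := Complex.ofReal_ne_zero.2 hc.ne'
    have hid : HasDerivAt (fun t : ℝ => (t : ℂ)) 1 c := Complex.ofRealCLM.hasDerivAt
    have hI : ∀ x : ℝ, HasDerivAt (fun t : ℝ => (x : ℂ) + t * I) I c := fun x => by
      simpa using (hid.mul_const I).const_add (x : ℂ)
    have hI' : ∀ x : ℝ, HasDerivAt (fun t : ℝ => (x : ℂ) - t * I) (-I) c := fun x => by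
      simpa using (hid.mul_const I).const_sub (x : ℂ)
    have hlog : ∀ s : ℂ, HasDerivAt (fun t : ℝ => (Real.log t : ℂ) + s) (c : ℂ)⁻¹ c := fun s => by
      have := (Real.hasDerivAt_log hc.ne').ofReal_comp.add_const s
      simpa using this
    have hPd : ∀ x : ℝ, HasDerivAt (fun t : ℝ => P (x + t * I)) (h (x + c * I) * I) c :=
      fun x => (hP (x + c * I) (by simpa using hc)).comp c (hI x)
    have hNd : ∀ x : ℝ, HasDerivAt (fun t : ℝ => N (x - t * I)) (h (x - c * I) * -I) c :=
      fun x => (hN (x - c * I) (by simpa using hc)).comp c (hI' x)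
    have hQ1 := (hQ _ (hS1 c)).comp c (hlog (I * (Real.pi / 2)))
    have hQ2 := (hQ _ (hS2 c)).comp c (hlog (-(I * (Real.pi / 2))))
    have hR1 := (hR _ (hS1 c)).comp c (hlog (I * (Real.pi / 2)))
    have hR2 := (hR _ (hS2 c)).comp c (hlog (-(I * (Real.pi / 2))))
    rw [hE1 c hc] at hQ1 hR1
    rw [hE2 c hc] at hQ2 hR2
    have := ((((hPd b).sub (hPd a)).add (hQ2.sub hQ1)).add ((hNd a).sub (hNd b))).add
      (hR2.sub hR1)
    refine HasDerivAt.congr_deriv this ?_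
    simp only [neg_neg, ← sub_eq_add_neg]
    field_simp
    ring
  have hconst : f c₁ = f c₂ := by
    refine isOpen_Ioi.is_const_of_deriv_eq_zero (convex_Ioi (0 : ℝ)).isPreconnected
      (fun c hc => (hderiv c hc).differentiableAt.differentiableWithinAt)
      (fun c hc => (hderiv c hc).deriv) hc₁ hc₂
  have hval : ∀ c : ℝ, 0 < c → contourIntegral a b c h = f c := by
    intro c hc
    have hc0 : (c : ℂ) ≠ 0 := Complex.ofReal_ne_zero.2 hc.ne'
    have hcont := hh.continuousOn.mono (contourTrace_subset_compl hab hc)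
    have h0 := integral_comp_contour_eq_sub (j := 0) hcont (G := P) (fun t ht => hP _ (by
      simpa [contour] using hc))
    have h2 := integral_comp_contour_eq_sub (j := 2) hcont (G := N) (fun t ht => hN _ (by
      simpa [contour] using hc))
    have hid : ∀ t, HasDerivAt (fun t : ℝ => (t : ℂ)) 1 t := fun t => Complex.ofRealCLM.hasDerivAt
    -- The half circles are the images of vertical segments in logarithmic coordinates.
    have hseg : ∀ t, HasDerivAt (fun t : ℝ => (Real.log c : ℂ) + I * (Real.pi / 2 - Real.pi * t))
        (-(I * Real.pi)) t := fun t => by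
      simpa using ((((hid t).const_mul (Real.pi : ℂ)).const_sub (Real.pi / 2 : ℂ)).const_mul
        I).const_add (Real.log c : ℂ)
    have hmem : ∀ t ∈ uIcc (0 : ℝ) 1,
        (Real.log c : ℂ) + I * (Real.pi / 2 - Real.pi * t) ∈ expStrip := fun t ht => by
      rw [uIcc_of_le zero_le_one] at ht
      constructor <;> simp <;> nlinarith [ht.1, ht.2]
    have hEc : ∀ t : ℝ, exp ((Real.log c : ℂ) + I * (Real.pi / 2 - Real.pi * t)) =
        c * exp (I * (Real.pi / 2 - Real.pi * t)) := fun t => by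
      rw [Complex.exp_add, ← Complex.ofReal_exp, Real.exp_log hc]
    have hEc' : ∀ t : ℝ, c * exp (I * (-(Real.pi / 2) - Real.pi * t)) =
        -(c * exp (I * (Real.pi / 2 - Real.pi * t))) := fun t => by
      rw [show I * (-((Real.pi : ℂ) / 2) - Real.pi * t) =
        I * (Real.pi / 2 - Real.pi * t) - Real.pi * I by ring, Complex.exp_sub,
        Complex.exp_pi_mul_I]
      ring
    have hend0 : (Real.log c : ℂ) + I * (Real.pi / 2 - Real.pi * (0 : ℝ)) =
        Real.log c + I * (Real.pi / 2) := by simp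
    have hend1 : (Real.log c : ℂ) + I * (Real.pi / 2 - Real.pi * (1 : ℝ)) =
        Real.log c + -(I * (Real.pi / 2)) := by push_cast; ring
    have h1 : ∫ t in (0 : ℝ)..1, h (contour a b c 1 t) * deriv (contour a b c 1) t =
        Q (Real.log c + -(I * (Real.pi / 2))) - Q (Real.log c + I * (Real.pi / 2)) := by
      rw [← hend0, ← hend1]
      refine intervalIntegral.integral_eq_sub_of_hasDerivAt
        (f := fun t : ℝ => Q (Real.log c + I * (Real.pi / 2 - Real.pi * t)))
        (fun t ht => ?_) (intervalIntegrable_contour hcont 1)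
      refine ((hQ _ (hmem t ht)).comp t (hseg t)).congr_deriv ?_
      rw [deriv_contour_one, hEc]
      simp only [contour, Matrix.cons_val_one, Matrix.cons_val_zero]
      ring
    have h3 : ∫ t in (0 : ℝ)..1, h (contour a b c 3 t) * deriv (contour a b c 3) t =
        R (Real.log c + -(I * (Real.pi / 2))) - R (Real.log c + I * (Real.pi / 2)) := by
      rw [← hend0, ← hend1]
      refine intervalIntegral.integral_eq_sub_of_hasDerivAt
        (f := fun t : ℝ => R (Real.log c + I * (Real.pi / 2 - Real.pi * t)))
        (fun t ht => ?_) (intervalIntegrable_contour hcont 3)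
      refine ((hR _ (hmem t ht)).comp t (hseg t)).congr_deriv ?_
      rw [deriv_contour_three, hEc]
      simp only [contour, Matrix.cons_val, hEc']
      ring
    rw [contourIntegral, Fin.sum_univ_four, h0, h1, h2, h3, contour_zero_zero, contour_zero_one,
      contour_two_zero, contour_two_one]
  rw [hval _ hc₁, hval _ hc₂, hconst]

theorem convex_thickening_interval (a b c : ℝ) : Convex ℝ (Metric.thickening c (interval a b)) :=
  (convex_interval a b).thickening c

theorem mem_thickening_interval_iff (hab : a ≤ b) {w : ℂ} :
    w ∈ Metric.thickening c (interval a b) ↔ Metric.infDist w (interval a b) < c :=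
  Metric.mem_thickening_iff_infDist_lt (interval_nonempty hab)

theorem notMem_thickening_of_mem_contourTrace (hab : a ≤ b) (hc : 0 ≤ c) {w : ℂ}
    (hw : w ∈ contourTrace a b c) : w ∉ Metric.thickening c (interval a b) := by
  rw [mem_thickening_interval_iff hab, infDist_of_mem_contourTrace hab hc hw]
  exact lt_irrefl c

theorem contourTrace_subset_thickening (hab : a ≤ b) (hc : 0 ≤ c) {c' : ℝ} (hcc' : c < c') :
    contourTrace a b c ⊆ Metric.thickening c' (interval a b) := fun w hw => by
  rw [mem_thickening_interval_iff hab, infDist_of_mem_contourTrace hab hc hw]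
  exact hcc'

theorem ne_of_mem_thickening_of_mem_contourTrace (hab : a ≤ b) (hc : 0 ≤ c) {z w : ℂ}
    (hz : z ∈ Metric.thickening c (interval a b)) (hw : w ∈ contourTrace a b c) : w - z ≠ 0 :=
  sub_ne_zero.2 fun h => notMem_thickening_of_mem_contourTrace hab hc hw (h ▸ hz)

theorem contourIntegral_inv_sub_left_end (hab : a ≤ b) (hc : 0 < c) :
    contourIntegral a b c (fun w => (w - a)⁻¹) = -(2 * Real.pi * I) := by
  have hpi := Real.pi_pos
  have hc0 : (c : ℂ) ≠ 0 := Complex.ofReal_ne_zero.2 hc.ne'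
  have hne : ∀ w ∈ contourTrace a b c, w - a ≠ 0 := fun w hw =>
    ne_of_mem_thickening_of_mem_contourTrace hab hc.le
      (Metric.self_subset_thickening hc _ ⟨a, ⟨le_rfl, hab⟩, rfl⟩) hw
  have hcont : ContinuousOn (fun w : ℂ => (w - a)⁻¹) (contourTrace a b c) :=
    ContinuousOn.inv₀ (by fun_prop) hne
  have hlog : ∀ w : ℂ, w - a ∈ slitPlane →
      HasDerivAt (fun w : ℂ => Complex.log (w - a)) ((w - a)⁻¹) w := fun w hw => by
    simpa using ((hasDerivAt_id w).sub_const (a : ℂ)).clog hw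
  -- The first three pieces avoid the ray to the left of `a`.
  have h0 := integral_comp_contour_eq_sub (j := 0) hcont (fun t ht => hlog _ (by
    right; simpa [contour] using hc.ne'))
  have h2 := integral_comp_contour_eq_sub (j := 2) hcont (fun t ht => hlog _ (by
    right; simpa [contour] using hc.ne'))
  have h1 := integral_comp_contour_eq_sub (j := 1) hcont (fun t ht => hlog _ (by
    have e1 : contour a b c 1 t - a = ((b - a + c * Real.cos (Real.pi / 2 - Real.pi * t) : ℝ) : ℂ)
        + (c * Real.sin (Real.pi / 2 - Real.pi * t) : ℝ) * I := by
      simp only [contour, Matrix.cons_val_one, Matrix.cons_val_zero]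
      rw [mul_comm I, Complex.exp_mul_I]
      push_cast
      ring
    rw [e1, Complex.mem_slitPlane_iff]
    simp only [add_re, add_im, mul_re, mul_im, ofReal_re, ofReal_im, I_re, I_im, mul_zero, mul_one,
      sub_zero, zero_add, add_zero]
    rw [Real.cos_pi_div_two_sub, Real.sin_pi_div_two_sub]
    by_cases hcos : Real.cos (Real.pi * t) = 0
    · left
      have hs : 0 ≤ Real.sin (Real.pi * t) := Real.sin_nonneg_of_nonneg_of_le_pi
        (by nlinarith [ht.1]) (by nlinarith [ht.2])
      have hs1 : Real.sin (Real.pi * t) ≠ 0 := fun h => by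
        have := Real.sin_sq_add_cos_sq (Real.pi * t)
        rw [h, hcos] at this
        norm_num at this
      have : 0 < c * Real.sin (Real.pi * t) := mul_pos hc (lt_of_le_of_ne hs hs1.symm)
      linarith
    · right
      exact mul_ne_zero hc.ne' hcos))
  have h3 : ∫ t in (0 : ℝ)..1, (contour a b c 3 t - a)⁻¹ * deriv (contour a b c 3) t =
      -(I * Real.pi) := by
    have : ∀ t : ℝ, (contour a b c 3 t - a)⁻¹ * deriv (contour a b c 3) t = -(I * Real.pi) := by
      intro t
      rw [deriv_contour_three]
      simp only [contour, Matrix.cons_val, add_sub_cancel_left]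
      field_simp
    simp [this]
  rw [contourIntegral, Fin.sum_univ_four, h0, h1, h2, h3, contour_zero_zero, contour_zero_one,
    contour_one_zero, contour_one_one, contour_two_zero, contour_two_one]
  have e1 : Complex.log (a + c * I - a) = Real.log c + Real.pi / 2 * I := by
    rw [add_sub_cancel_left, Complex.log_ofReal_mul hc I_ne_zero, Complex.log_I]
  have e2 : Complex.log (a - c * I - a) = Real.log c - Real.pi / 2 * I := by
    rw [show (a : ℂ) - c * I - a = c * (-I) by ring,
      Complex.log_ofReal_mul hc (neg_ne_zero.2 I_ne_zero), Complex.log_neg_I]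
    ring
  rw [e1, e2]
  ring

/-- The contour winds once, clockwise, around each of the points inside. -/
theorem contourIntegral_inv_sub_of_mem (hab : a ≤ b) (hc : 0 < c) {z : ℂ}
    (hz : z ∈ Metric.thickening c (interval a b)) :
    contourIntegral a b c (fun w => (w - z)⁻¹) = -(2 * Real.pi * I) := by
  have ha : (a : ℂ) ∈ Metric.thickening c (interval a b) :=
    Metric.self_subset_thickening hc _ ⟨a, ⟨le_rfl, hab⟩, rfl⟩
  have hne : ∀ y ∈ Metric.thickening c (interval a b), ∀ w ∈ contourTrace a b c, w - y ≠ 0 :=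
    fun y hy w hw => ne_of_mem_thickening_of_mem_contourTrace hab hc.le hy hw
  have hcont : ∀ y ∈ Metric.thickening c (interval a b),
      ContinuousOn (fun w : ℂ => (w - y)⁻¹) (contourTrace a b c) := fun y hy =>
    ContinuousOn.inv₀ (by fun_prop) (hne y hy)
  have h := contourIntegral_eq_zero_of_hasDerivAt (a := a) (b := b) (c := c)
    (h := fun w => (w - z)⁻¹ - (w - a)⁻¹)
    (G := fun w => Complex.log ((w - z) / (w - a))) ((hcont z hz).sub (hcont a ha)) (by
      intro w hw
      have h1 := hne z hz w hw
      have h2 := hne a ha w hw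
      -- On the contour the quotient is never a negative real, as `w` is not between `z` and `a`.
      have hslit : (w - z) / (w - a) ∈ slitPlane := by
        by_contra hns
        rw [Complex.mem_slitPlane_iff, not_or, not_lt, not_not] at hns
        set s : ℝ := -((w - z) / (w - a)).re with hs
        have hs0 : 0 ≤ s := by linarith [hns.1]
        have hq : (w - z) / (w - a) = -(s : ℂ) := by
          apply Complex.ext
          · simp [hs]
          · simp [hns.2]
        rw [div_eq_iff h2] at hq
        have hw' : w = ((1 + s)⁻¹ : ℝ) • z + ((1 + s)⁻¹ * s : ℝ) • (a : ℂ) := by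
          have : (1 + s : ℂ) ≠ 0 := by exact_mod_cast (by positivity : 1 + s ≠ 0)
          simp only [Complex.real_smul]
          push_cast
          field_simp
          linear_combination hq
        refine notMem_thickening_of_mem_contourTrace hab hc.le hw ?_
        rw [hw']
        exact convex_thickening_interval a b c hz ha (by positivity) (by positivity)
          (by field_simp)
      have := (((hasDerivAt_id' w).sub_const z).fun_div ((hasDerivAt_id' w).sub_const (a : ℂ))
        h2).clog hslit
      refine this.congr_deriv ?_
      field_simp)
  rw [contourIntegral_sub (hcont z hz) (hcont a ha), sub_eq_zero] at h
  rw [h, contourIntegral_inv_sub_left_end hab hc]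

theorem contourIntegral_inv_sub_of_lt_infDist (hab : a ≤ b) (hc : 0 ≤ c) {z : ℂ}
    (hz : c < Metric.infDist z (interval a b)) :
    contourIntegral a b c (fun w => (w - z)⁻¹) = 0 := by
  refine contourIntegral_eq_zero_of_convex Metric.isOpen_thickening
    (convex_thickening_interval a b (Metric.infDist z (interval a b))) (fun w hw => ?_)
    (contourTrace_subset_thickening hab hc hz)
  have : w - z ≠ 0 := sub_ne_zero.2 fun h => by
    rw [h, mem_thickening_interval_iff hab] at hw
    exact lt_irrefl _ hw
  have hd : DifferentiableAt ℂ (fun w => w - z) w := by fun_prop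
  exact (hd.fun_inv this).differentiableWithinAt

/-- Cauchy's formula for a function holomorphic off `[a,b]`, at a point between two contours. It
is the independence of the radius, for the difference quotient of the function. -/
theorem contourIntegral_mul_inv_sub (hab : a ≤ b) {h : ℂ → ℂ}
    (hh : DifferentiableOn ℂ h (interval a b)ᶜ) {c₁ c₂ : ℝ} (hc₁ : 0 < c₁) {z : ℂ}
    (hz₁ : c₁ < Metric.infDist z (interval a b)) (hz₂ : Metric.infDist z (interval a b) < c₂) :
    contourIntegral a b c₂ (fun w => h w * (w - z)⁻¹) + 2 * Real.pi * I * h z =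
      contourIntegral a b c₁ (fun w => h w * (w - z)⁻¹) := by
  have hc₂ : 0 < c₂ := hc₁.trans (hz₁.trans hz₂)
  have hzK : z ∈ (interval a b)ᶜ := fun hzK => by
    rw [Metric.infDist_zero_of_mem hzK] at hz₁
    linarith
  have hd : DifferentiableOn ℂ (dslope h z) (interval a b)ᶜ :=
    (Complex.differentiableOn_dslope ((isOpen_compl_interval a b).mem_nhds hzK)).2 hh
  have key : ∀ c : ℝ, 0 < c → Metric.infDist z (interval a b) ≠ c →
      contourIntegral a b c (dslope h z) = contourIntegral a b c (fun w => h w * (w - z)⁻¹) -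
        h z * contourIntegral a b c (fun w => (w - z)⁻¹) := by
    intro c hc hzc
    have hne : ∀ w ∈ contourTrace a b c, w ≠ z := fun w hw h => by
      rw [← h, infDist_of_mem_contourTrace hab hc.le hw] at hzc
      exact hzc rfl
    have hcont : ContinuousOn (fun w : ℂ => (w - z)⁻¹) (contourTrace a b c) :=
      ContinuousOn.inv₀ (by fun_prop) fun w hw => sub_ne_zero.2 (hne w hw)
    rw [← contourIntegral_const_mul, ← contourIntegral_sub
      ((hh.continuousOn.mono (contourTrace_subset_compl hab hc)).fun_mul hcont)
      (continuousOn_const.fun_mul hcont)]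
    refine contourIntegral_congr fun w hw => ?_
    rw [dslope_of_ne _ (hne w hw), slope_def_field]
    ring
  have h1 := key c₁ hc₁ hz₁.ne'
  have h2 := key c₂ hc₂ hz₂.ne
  rw [contourIntegral_inv_sub_of_lt_infDist hab hc₁.le hz₁] at h1
  rw [contourIntegral_inv_sub_of_mem hab hc₂ ((mem_thickening_interval_iff hab).2 hz₂),
    contourIntegral_eq_contourIntegral hab hd hc₂ hc₁, h1] at h2
  linear_combination -h2

end Cauchy

/-! ### The Borel transform of an entire function -/

section Borel

variable {a b : ℝ}

theorem mul_le_supportFun {x : ℝ} (hx : x ∈ Icc a b) (t : ℝ) : x * t ≤ supportFun a b t :=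
  le_csSup (isCompact_Icc.image (by fun_prop)).bddAbove (mem_image_of_mem _ hx)

theorem supportFun_le (hab : a ≤ b) {t M : ℝ} (h : ∀ x ∈ Icc a b, x * t ≤ M) :
    supportFun a b t ≤ M :=
  csSup_le ((nonempty_Icc.2 hab).image _) (by rintro _ ⟨x, hx, rfl⟩; exact h x hx)

theorem supportFun_zero (hab : a ≤ b) : supportFun a b 0 = 0 :=
  le_antisymm (supportFun_le hab fun x _ => by simp)
    (by simpa using mul_le_supportFun (left_mem_Icc.2 hab) 0)

theorem supportFun_one (hab : a ≤ b) : supportFun a b 1 = b :=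
  le_antisymm (supportFun_le hab fun x hx => by simpa using hx.2)
    (by simpa using mul_le_supportFun (right_mem_Icc.2 hab) 1)

theorem supportFun_neg_one (hab : a ≤ b) : supportFun a b (-1) = -a :=
  le_antisymm (supportFun_le hab fun x hx => by simpa using hx.1)
    (by simpa using mul_le_supportFun (left_mem_Icc.2 hab) (-1))

theorem supportFun_combo_le (hab : a ≤ b) {r s : ℝ} (hr : 0 ≤ r) (hs : 0 ≤ s) (t u : ℝ) :
    supportFun a b (r * t + s * u) ≤ r * supportFun a b t + s * supportFun a b u :=
  supportFun_le hab fun x hx => by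
    have h1 := mul_le_mul_of_nonneg_left (mul_le_supportFun hx t) hr
    have h2 := mul_le_mul_of_nonneg_left (mul_le_supportFun hx u) hs
    linarith

/-- The scalar entire functions of exponential type with support function at most `H_{[a,b]}`. -/
structure IsExpType (a b : ℝ) (f : ℂ → ℂ) : Prop where
  diff : Differentiable ℂ f
  bound : ∀ ε > 0, ∃ C, ∀ z, ‖f z‖ ≤ C * Real.exp (ε * ‖z‖ + supportFun a b z.im)

/-- `Im (ω z) - H (Im ω)`, the signed distance of `z` from the half plane that supports `[a,b]` in
the direction corresponding to the unit number `ω`. -/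
noncomputable def margin (a b : ℝ) (ω z : ℂ) : ℝ := (ω * z).im - supportFun a b ω.im

/-- The Laplace integral of `f` along the ray through `ω`; it converges for `z` of positive
margin. -/
noncomputable def rayLaplace (ω : ℂ) (f : ℂ → ℂ) (z : ℂ) : ℂ :=
  ∫ t in Ioi (0 : ℝ), f (ω * t) * exp (I * ω * t * z) * ω

theorem norm_exp_I_mul (w : ℂ) : ‖exp (I * w)‖ = Real.exp (-w.im) := by
  rw [Complex.norm_exp]; simp

theorem norm_exp_ray (ω z : ℂ) (t : ℝ) :
    ‖exp (I * ω * t * z)‖ = Real.exp (-((ω * z).im * t)) := by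
  rw [show I * ω * t * z = I * ((t : ℂ) * (ω * z)) by ring, norm_exp_I_mul, Complex.im_ofReal_mul,
    mul_comm]

theorem bound_const_nonneg {f : ℂ → ℂ} {C ε : ℝ}
    (hC : ∀ z, ‖f z‖ ≤ C * Real.exp (ε * ‖z‖ + supportFun a b z.im)) : 0 ≤ C :=
  nonneg_of_mul_nonneg_left ((norm_nonneg _).trans (hC 0)) (Real.exp_pos _)

theorem norm_ray_integrand_le (hab : a ≤ b) {f : ℂ → ℂ} {C ε : ℝ}
    (hC : ∀ z, ‖f z‖ ≤ C * Real.exp (ε * ‖z‖ + supportFun a b z.im)) {ω : ℂ} (hω : ‖ω‖ = 1)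
    (z : ℂ) {t : ℝ} (ht : 0 ≤ t) :
    ‖f (ω * t) * exp (I * ω * t * z) * ω‖ ≤ C * Real.exp (-(margin a b ω z - ε) * t) := by
  have hC0 := bound_const_nonneg hC
  have h1 : supportFun a b (ω * t).im ≤ t * supportFun a b ω.im := by
    have := supportFun_combo_le hab ht le_rfl ω.im 0
    simpa [mul_comm] using this
  rw [norm_mul, norm_mul, hω, mul_one, norm_exp_ray]
  calc _ ≤ C * Real.exp (ε * ‖ω * t‖ + supportFun a b (ω * t).im) *
        Real.exp (-((ω * z).im * t)) := by gcongr; exact hC _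
    _ ≤ C * Real.exp (ε * t + t * supportFun a b ω.im) * Real.exp (-((ω * z).im * t)) := by
        have : ‖ω * t‖ = t := by
          rw [norm_mul, hω, one_mul, Complex.norm_real, Real.norm_of_nonneg ht]
        rw [this]
        gcongr
    _ = C * Real.exp (-(margin a b ω z - ε) * t) := by
        rw [mul_assoc, ← Real.exp_add, margin]
        congr 2
        ring

theorem continuous_ray_integrand {f : ℂ → ℂ} (hf : Continuous f) (ω z : ℂ) :
    Continuous fun t : ℝ => f (ω * t) * exp (I * ω * t * z) * ω := by
  fun_prop

theorem integrableOn_exp_neg_mul {s : ℝ} (hs : 0 < s) (T : ℝ) :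
    MeasureTheory.IntegrableOn (fun t : ℝ => Real.exp (-s * t)) (Ioi T) :=
  integrableOn_exp_mul_Ioi (neg_neg_of_pos hs) T

theorem integrableOn_ray (hab : a ≤ b) {f : ℂ → ℂ} (hf : Continuous f) {C ε : ℝ}
    (hC : ∀ z, ‖f z‖ ≤ C * Real.exp (ε * ‖z‖ + supportFun a b z.im)) {ω : ℂ} (hω : ‖ω‖ = 1)
    {z : ℂ} (hz : ε < margin a b ω z) :
    MeasureTheory.IntegrableOn (fun t : ℝ => f (ω * t) * exp (I * ω * t * z) * ω) (Ioi 0) := by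
  refine MeasureTheory.Integrable.mono'
    ((integrableOn_exp_neg_mul (sub_pos.2 hz) 0).const_mul C)
    (continuous_ray_integrand hf ω z).aestronglyMeasurable ?_
  filter_upwards [MeasureTheory.ae_restrict_mem measurableSet_Ioi] with t ht
  exact norm_ray_integrand_le hab hC hω z (le_of_lt ht)

theorem IsExpType.integrableOn_ray (hab : a ≤ b) {f : ℂ → ℂ} (hf : IsExpType a b f) {ω : ℂ}
    (hω : ‖ω‖ = 1) {z : ℂ} (hz : 0 < margin a b ω z) :
    MeasureTheory.IntegrableOn (fun t : ℝ => f (ω * t) * exp (I * ω * t * z) * ω) (Ioi 0) := by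
  obtain ⟨C, hC⟩ := hf.bound _ (half_pos hz)
  exact FourierHyp.integrableOn_ray hab hf.diff.continuous hC hω (half_lt_self hz)

/-- The tails of the Laplace integral, bounded by the growth of the function. -/
theorem norm_setIntegral_ray_le (hab : a ≤ b) {f : ℂ → ℂ} {C ε : ℝ}
    (hC : ∀ z, ‖f z‖ ≤ C * Real.exp (ε * ‖z‖ + supportFun a b z.im)) {ω : ℂ} (hω : ‖ω‖ = 1)
    {z : ℂ} (hz : ε < margin a b ω z) {T : ℝ} (hT : 0 ≤ T) :
    ‖∫ t in Ioi T, f (ω * t) * exp (I * ω * t * z) * ω‖ ≤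
      C / (margin a b ω z - ε) * Real.exp (-(margin a b ω z - ε) * T) := by
  have hs : 0 < margin a b ω z - ε := sub_pos.2 hz
  refine (MeasureTheory.norm_integral_le_of_norm_le
    ((integrableOn_exp_neg_mul hs T).const_mul C) ?_).trans (le_of_eq ?_)
  · filter_upwards [MeasureTheory.ae_restrict_mem measurableSet_Ioi] with t ht
    exact norm_ray_integrand_le hab hC hω z (hT.trans (le_of_lt ht))
  · rw [MeasureTheory.integral_const_mul, integral_exp_mul_Ioi (neg_neg_of_pos hs)]
    field_simp

theorem norm_rayLaplace_le (hab : a ≤ b) {f : ℂ → ℂ} {C ε : ℝ}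
    (hC : ∀ z, ‖f z‖ ≤ C * Real.exp (ε * ‖z‖ + supportFun a b z.im)) {ω : ℂ} (hω : ‖ω‖ = 1)
    {z : ℂ} (hz : ε < margin a b ω z) :
    ‖rayLaplace ω f z‖ ≤ C / (margin a b ω z - ε) := by
  simpa [rayLaplace] using norm_setIntegral_ray_le hab hC hω hz le_rfl

theorem continuous_margin (a b : ℝ) (ω : ℂ) : Continuous (margin a b ω) := by
  unfold margin; fun_prop

theorem margin_sub_le {ω : ℂ} (hω : ‖ω‖ = 1) (z z' : ℂ) :
    margin a b ω z - ‖z' - z‖ ≤ margin a b ω z' := by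
  have h1 : |(ω * (z' - z)).im| ≤ ‖z' - z‖ := by
    simpa [hω] using Complex.abs_im_le_norm (ω * (z' - z))
  have h2 : (ω * (z' - z)).im = (ω * z').im - (ω * z).im := by rw [mul_sub, sub_im]
  have := (abs_le.1 h1).1
  unfold margin
  linarith

theorem IsExpType.differentiableOn_rayLaplace (hab : a ≤ b) {f : ℂ → ℂ} (hf : IsExpType a b f)
    {ω : ℂ} (hω : ‖ω‖ = 1) : DifferentiableOn ℂ (rayLaplace ω f) {z | 0 < margin a b ω z} := by
  refine differentiableOn_integral (isOpen_lt continuous_const (continuous_margin a b ω))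
    (fun z _ => (continuous_ray_integrand hf.diff.continuous ω z).aestronglyMeasurable)
    (Eventually.of_forall fun t => ?_) fun z (hz : 0 < margin a b ω z) => ?_
  · fun_prop
  · obtain ⟨C, hC⟩ := hf.bound (margin a b ω z / 4) (by linarith)
    have hC0 := bound_const_nonneg hC
    refine ⟨margin a b ω z / 4, by linarith, fun t => C * Real.exp (-(margin a b ω z / 2) * t),
      (integrableOn_exp_neg_mul (half_pos hz) 0).const_mul C, ?_⟩
    filter_upwards [MeasureTheory.ae_restrict_mem measurableSet_Ioi] with t ht z' hz'
    refine (norm_ray_integrand_le hab hC hω z' (le_of_lt ht)).trans ?_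
    rw [mem_closedBall_iff_norm] at hz'
    have := margin_sub_le (a := a) (b := b) hω z z'
    have ht' : (0 : ℝ) < t := ht
    gcongr
    linarith

/-- Cauchy's theorem for a quadrant: integrals over the two boundary rays agree. -/
theorem integral_Ioi_eq_of_quadrant {g : ℂ → ℂ} (hg : Differentiable ℂ g) {C δ : ℝ} (hδ : 0 < δ)
    (hC : ∀ s t : ℝ, 0 ≤ s → 0 ≤ t → ‖g (s + t * I)‖ ≤ C * Real.exp (-δ * (s + t))) :
    ∫ t in Ioi (0 : ℝ), g t = I * ∫ t in Ioi (0 : ℝ), g (t * I) := by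
  have hC0 : 0 ≤ C :=
    nonneg_of_mul_nonneg_left ((norm_nonneg _).trans (hC 0 0 le_rfl le_rfl)) (Real.exp_pos _)
  have hint : ∀ {k : ℝ → ℂ}, Continuous k → (∀ t, 0 ≤ t → ‖k t‖ ≤ C * Real.exp (-δ * t)) →
      MeasureTheory.IntegrableOn k (Ioi 0) := fun hk hb => by
    refine MeasureTheory.Integrable.mono' ((integrableOn_exp_neg_mul hδ 0).const_mul C)
      hk.aestronglyMeasurable ?_
    filter_upwards [MeasureTheory.ae_restrict_mem measurableSet_Ioi] with t ht
    exact hb t (le_of_lt ht)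
  have hgc := hg.continuous
  have h1 := MeasureTheory.intervalIntegral_tendsto_integral_Ioi 0
    (hint (k := fun t => g t) (by fun_prop) fun t ht => by simpa using hC t 0 ht le_rfl) tendsto_id
  have h2 := MeasureTheory.intervalIntegral_tendsto_integral_Ioi 0
    (hint (k := fun t => g (t * I)) (by fun_prop) fun t ht => by simpa using hC 0 t le_rfl ht)
    tendsto_id
  -- The integrals over the two sides of a large square off the axes tend to zero.
  have hdecay : Tendsto (fun R : ℝ => C * Real.exp (-δ * R) * |R - 0|) atTop (𝓝 0) := by
    have := (Real.tendsto_pow_mul_exp_neg_atTop_nhds_zero 1).comp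
      (tendsto_id.const_mul_atTop hδ)
    have h3 := this.const_mul (C / δ)
    rw [mul_zero] at h3
    refine h3.congr' ?_
    filter_upwards [eventually_ge_atTop 0] with R hR
    simp only [Function.comp_apply, pow_one, sub_zero, abs_of_nonneg hR, id_eq]
    field_simp
  have h3 : Tendsto (fun R : ℝ => ∫ x in (0 : ℝ)..R, g (x + R * I)) atTop (𝓝 0) := by
    refine squeeze_zero_norm' ?_ hdecay
    filter_upwards [eventually_ge_atTop 0] with R hR
    refine intervalIntegral.norm_integral_le_of_norm_le_const fun x hx => ?_
    rw [uIoc_of_le hR] at hx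
    refine (hC x R hx.1.le hR).trans (mul_le_mul_of_nonneg_left (Real.exp_le_exp.2 ?_) hC0)
    nlinarith [hx.1]
  have h4 : Tendsto (fun R : ℝ => ∫ y in (0 : ℝ)..R, g (R + y * I)) atTop (𝓝 0) := by
    refine squeeze_zero_norm' ?_ hdecay
    filter_upwards [eventually_ge_atTop 0] with R hR
    refine intervalIntegral.norm_integral_le_of_norm_le_const fun x hx => ?_
    rw [uIoc_of_le hR] at hx
    refine (hC R x hR hx.1.le).trans (mul_le_mul_of_nonneg_left (Real.exp_le_exp.2 ?_) hC0)
    nlinarith [hx.1]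
  have hrect : ∀ R : ℝ, (∫ x in (0 : ℝ)..R, g x) - (∫ x in (0 : ℝ)..R, g (x + R * I)) +
      I * (∫ y in (0 : ℝ)..R, g (R + y * I)) - I * (∫ y in (0 : ℝ)..R, g (y * I)) = 0 := by
    intro R
    have := Complex.integral_boundary_rect_eq_zero_of_differentiableOn g 0 (R + R * I)
      hg.differentiableOn
    simpa using this
  have h5 := ((h1.sub h3).add (h4.const_mul I)).sub (h2.const_mul I)
  simp only [id_eq, hrect] at h5
  have := tendsto_nhds_unique h5 tendsto_const_nhds
  linear_combination this

/-- The Laplace integrals along two perpendicular rays agree where both converge. -/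
theorem IsExpType.rayLaplace_eq (hab : a ≤ b) {f : ℂ → ℂ} (hf : IsExpType a b f) {ω z : ℂ}
    (hω : ‖ω‖ = 1) (h1 : 0 < margin a b ω z) (h2 : 0 < margin a b (I * ω) z) :
    rayLaplace ω f z = rayLaplace (I * ω) f z := by
  obtain ⟨δ, hδ, hδ1, hδ2⟩ : ∃ δ, 0 < δ ∧ 2 * δ ≤ margin a b ω z ∧ 2 * δ ≤ margin a b (I * ω) z :=
    ⟨min (margin a b ω z) (margin a b (I * ω) z) / 2, by positivity,
      by linarith [min_le_left (margin a b ω z) (margin a b (I * ω) z)],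
      by linarith [min_le_right (margin a b ω z) (margin a b (I * ω) z)]⟩
  obtain ⟨C, hC⟩ := hf.bound δ hδ
  have hC0 := bound_const_nonneg hC
  have hfd := hf.diff
  have h := integral_Ioi_eq_of_quadrant (g := fun ζ => f (ω * ζ) * exp (I * ω * ζ * z) * ω)
    (by fun_prop) hδ (C := C) (by
      intro s t hs ht
      have e1 : (ω * (s + t * I)).im = s * ω.im + t * (I * ω).im := by simp; ring
      have e2 : ‖exp (I * ω * (s + t * I) * z)‖ =
          Real.exp (-(s * (ω * z).im + t * (I * ω * z).im)) := by
        rw [show I * ω * (s + t * I) * z = I * ((s : ℂ) * (ω * z) + (t : ℂ) * (I * ω * z)) by ring,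
          norm_exp_I_mul, add_im, Complex.im_ofReal_mul, Complex.im_ofReal_mul]
      have e3 : ‖ω * (s + t * I)‖ ≤ s + t := by
        rw [norm_mul, hω, one_mul]
        refine (norm_add_le _ _).trans (le_of_eq ?_)
        simp [abs_of_nonneg hs, abs_of_nonneg ht]
      rw [norm_mul, norm_mul, hω, mul_one, e2]
      calc _ ≤ C * Real.exp (δ * ‖ω * (s + t * I)‖ + supportFun a b (ω * (s + t * I)).im) *
            Real.exp (-(s * (ω * z).im + t * (I * ω * z).im)) := by gcongr; exact hC _
        _ ≤ C * Real.exp (δ * (s + t) +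
              (s * supportFun a b ω.im + t * supportFun a b (I * ω).im)) *
            Real.exp (-(s * (ω * z).im + t * (I * ω * z).im)) := by
            rw [e1]
            have := supportFun_combo_le hab hs ht ω.im (I * ω).im
            gcongr
        _ ≤ C * Real.exp (-δ * (s + t)) := by
            rw [mul_assoc, ← Real.exp_add]
            unfold margin at hδ1 hδ2
            gcongr
            nlinarith)
  rw [rayLaplace, rayLaplace, h, ← MeasureTheory.integral_const_mul]
  congr 1
  funext t
  rw [show ω * ((t : ℂ) * I) = I * ω * t by ring,
    show I * ω * ((t : ℂ) * I) * z = I * (I * ω) * t * z by ring]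
  ring

/-- The four directions `±1`, `±i`. -/
def directions : Set ℂ := {1, I, -1, -I}

theorem norm_of_mem_directions {ω : ℂ} (h : ω ∈ directions) : ‖ω‖ = 1 := by
  rcases h with rfl | rfl | rfl | rfl <;> simp

theorem margin_one (hab : a ≤ b) (z : ℂ) : margin a b 1 z = z.im := by
  simp [margin, supportFun_zero hab]

theorem margin_neg_one (hab : a ≤ b) (z : ℂ) : margin a b (-1) z = -z.im := by
  simp [margin, supportFun_zero hab]

theorem margin_I (hab : a ≤ b) (z : ℂ) : margin a b I z = z.re - b := by
  simp [margin, supportFun_one hab]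

theorem margin_neg_I (hab : a ≤ b) (z : ℂ) : margin a b (-I) z = a - z.re := by
  simp [margin, supportFun_neg_one hab]; ring

/-- The four half planes cover the complement of `[a,b]`, and even so with a definite margin. -/
theorem exists_direction (hab : a ≤ b) {z : ℂ} {r : ℝ} (hr : r ≤ Metric.infDist z (interval a b)) :
    ∃ ω ∈ directions, r / 2 ≤ margin a b ω z := by
  by_contra hcon
  push Not at hcon
  have h1 := hcon 1 (by simp [directions])
  have h2 := hcon I (by simp [directions])
  have h3 := hcon (-1) (by simp [directions])
  have h4 := hcon (-I) (by simp [directions])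
  rw [margin_one hab] at h1
  rw [margin_I hab] at h2
  rw [margin_neg_one hab] at h3
  rw [margin_neg_I hab] at h4
  have hx : max a (min z.re b) ∈ Icc a b := ⟨le_max_left _ _, max_le hab (min_le_right _ _)⟩
  have h5 := hr.trans (Metric.infDist_le_dist_of_mem (mem_image_of_mem (fun x : ℝ => (x : ℂ)) hx))
  have h6 : dist z ((max a (min z.re b) : ℝ) : ℂ) ≤ |z.re - max a (min z.re b)| + |z.im| := by
    rw [dist_eq_norm]
    refine (Complex.norm_le_abs_re_add_abs_im _).trans (le_of_eq ?_)
    simp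
  have h7 : |z.im| < r / 2 := abs_lt.2 ⟨by linarith, h1⟩
  have h8 : |z.re - max a (min z.re b)| < r / 2 := by
    have h0 : 0 < r / 2 := lt_of_le_of_lt (abs_nonneg _) h7
    rw [abs_lt]
    rcases le_total z.re b with h | h
    · rw [min_eq_left h]
      rcases le_total a z.re with h' | h'
      · rw [max_eq_right h']; constructor <;> linarith
      · rw [max_eq_left h']; constructor <;> linarith
    · rw [min_eq_right h, max_eq_right hab]; constructor <;> linarith
  linarith

theorem infDist_pos_of_notMem (hab : a ≤ b) {z : ℂ} (hz : z ∈ (interval a b)ᶜ) :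
    0 < Metric.infDist z (interval a b) :=
  ((isCompact_interval a b).isClosed.notMem_iff_infDist_pos (interval_nonempty hab)).1 hz

theorem exists_direction_pos (hab : a ≤ b) {z : ℂ} (hz : z ∈ (interval a b)ᶜ) :
    ∃ ω ∈ directions, 0 < margin a b ω z := by
  obtain ⟨ω, hω, h⟩ := exists_direction hab (le_refl (Metric.infDist z (interval a b)))
  exact ⟨ω, hω, (half_pos (infDist_pos_of_notMem hab hz)).trans_le h⟩

open Classical in
/-- The Borel transform, a function on the complement of `[a,b]`: on each of four half planes it is
the Laplace integral along one of the rays `±ℝ₊`, `±iℝ₊`. -/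
noncomputable def borel (a b : ℝ) (f : ℂ → ℂ) (z : ℂ) : ℂ :=
  if 0 < margin a b 1 z then rayLaplace 1 f z
  else if 0 < margin a b (-1) z then rayLaplace (-1) f z
  else if 0 < margin a b I z then rayLaplace I f z
  else rayLaplace (-I) f z

theorem IsExpType.borel_eq (hab : a ≤ b) {f : ℂ → ℂ} (hf : IsExpType a b f) {ω z : ℂ}
    (hω : ω ∈ directions) (hz : 0 < margin a b ω z) : borel a b f z = rayLaplace ω f z := by
  have h12 := hf.rayLaplace_eq hab (ω := 1) (z := z) (by simp)
  have h23 := hf.rayLaplace_eq hab (ω := I) (z := z) (by simp)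
  have h34 := hf.rayLaplace_eq hab (ω := -1) (z := z) (by simp)
  have h41 := hf.rayLaplace_eq hab (ω := -I) (z := z) (by simp)
  rw [mul_one] at h12
  rw [I_mul_I] at h23
  rw [mul_neg_one] at h34
  rw [mul_neg, I_mul_I, neg_neg] at h41
  have m13 : 0 < margin a b 1 z → ¬ 0 < margin a b (-1) z := by
    rw [margin_one hab, margin_neg_one hab]; intros; linarith
  have m24 : 0 < margin a b I z → ¬ 0 < margin a b (-I) z := by
    rw [margin_I hab, margin_neg_I hab]; intros; linarith
  unfold borel
  rcases hω with rfl | rfl | rfl | rfl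
  · rw [if_pos hz]
  · split_ifs with h1 h3
    · exact h12 h1 hz
    · exact (h23 hz h3).symm
    · rfl
  · rw [if_neg fun h => m13 h hz, if_pos hz]
  · rw [if_neg fun h => m24 h hz]
    split_ifs with h1 h3
    · exact (h41 hz h1).symm
    · exact h34 h3 hz
    · rfl

theorem IsExpType.differentiableOn_borel (hab : a ≤ b) {f : ℂ → ℂ} (hf : IsExpType a b f) :
    DifferentiableOn ℂ (borel a b f) (interval a b)ᶜ := by
  intro z hz
  obtain ⟨ω, hω, hm⟩ := exists_direction_pos hab hz
  have hopen : {z | 0 < margin a b ω z} ∈ 𝓝 z :=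
    (isOpen_lt continuous_const (continuous_margin a b ω)).mem_nhds hm
  have h1 := (hf.differentiableOn_rayLaplace hab (norm_of_mem_directions hω)).differentiableAt hopen
  refine (h1.congr_of_eventuallyEq ?_).differentiableWithinAt
  filter_upwards [hopen] with w hw using hf.borel_eq hab hω hw

theorem IsExpType.norm_borel_le (hab : a ≤ b) {f : ℂ → ℂ} (hf : IsExpType a b f) {C ε r : ℝ}
    (hC : ∀ z, ‖f z‖ ≤ C * Real.exp (ε * ‖z‖ + supportFun a b z.im)) (hε : 0 ≤ ε) (hεr : ε < r / 2)
    {z : ℂ} (hz : r ≤ Metric.infDist z (interval a b)) :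
    ‖borel a b f z‖ ≤ C / (r / 2 - ε) := by
  obtain ⟨ω, hω, hm⟩ := exists_direction hab hz
  have hC0 := bound_const_nonneg hC
  rw [hf.borel_eq hab hω (by linarith)]
  refine (norm_rayLaplace_le hab hC (norm_of_mem_directions hω) (by linarith)).trans ?_
  have : 0 < r / 2 - ε := by linarith
  gcongr

theorem IsExpType.sub {f g : ℂ → ℂ} (hf : IsExpType a b f) (hg : IsExpType a b g) :
    IsExpType a b (fun z => f z - g z) where
  diff := hf.diff.fun_sub hg.diff
  bound ε hε := by
    obtain ⟨C, hC⟩ := hf.bound ε hε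
    obtain ⟨D, hD⟩ := hg.bound ε hε
    refine ⟨C + D, fun z => (norm_sub_le _ _).trans ?_⟩
    rw [add_mul]
    exact add_le_add (hC z) (hD z)

theorem IsExpType.const_mul {f : ℂ → ℂ} (hf : IsExpType a b f) (s : ℂ) :
    IsExpType a b (fun z => s * f z) where
  diff := hf.diff.const_mul s
  bound ε hε := by
    obtain ⟨C, hC⟩ := hf.bound ε hε
    refine ⟨‖s‖ * C, fun z => ?_⟩
    rw [norm_mul, mul_assoc]
    exact mul_le_mul_of_nonneg_left (hC z) (norm_nonneg _)

theorem IsExpType.borel_sub (hab : a ≤ b) {f g : ℂ → ℂ} (hf : IsExpType a b f)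
    (hg : IsExpType a b g) {z : ℂ} (hz : z ∈ (interval a b)ᶜ) :
    borel a b (fun z => f z - g z) z = borel a b f z - borel a b g z := by
  obtain ⟨ω, hω, hm⟩ := exists_direction_pos hab hz
  rw [hf.borel_eq hab hω hm, hg.borel_eq hab hω hm, (hf.sub hg).borel_eq hab hω hm, rayLaplace,
    rayLaplace, rayLaplace, ← MeasureTheory.integral_sub
      (hf.integrableOn_ray hab (norm_of_mem_directions hω) hm)
      (hg.integrableOn_ray hab (norm_of_mem_directions hω) hm)]
  simp only [sub_mul]

theorem borel_const_mul (a b : ℝ) (f : ℂ → ℂ) (s z : ℂ) :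
    borel a b (fun z => s * f z) z = s * borel a b f z := by
  have : ∀ ω, rayLaplace ω (fun z => s * f z) z = s * rayLaplace ω f z := fun ω => by
    rw [rayLaplace, rayLaplace, ← MeasureTheory.integral_const_mul]
    simp only [mul_assoc]
  simp only [borel, this]
  split_ifs <;> rfl

end Borel

/-! ### The scalar Fourier transform and its inversion -/

section ScalarFourier

variable {a b c : ℝ}

/-- The Fourier transform of a scalar function by integration along the contour of radius `c`. -/
noncomputable def contourFourier (a b c : ℝ) (F : ℂ → ℂ) (ζ : ℂ) : ℂ :=
  contourIntegral a b c fun w => exp (-I * w * ζ) * F w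

theorem im_mul_le_of_mem_contourTrace (hab : a ≤ b) (hc : 0 ≤ c) {w : ℂ}
    (hw : w ∈ contourTrace a b c) (ζ : ℂ) : (w * ζ).im ≤ c * ‖ζ‖ + supportFun a b ζ.im := by
  obtain ⟨x, hx, u, hu, rfl, -⟩ := exists_of_mem_contourTrace hab hw
  have h1 : (u * ζ).im ≤ ‖ζ‖ := by
    refine (le_abs_self _).trans ((Complex.abs_im_le_norm _).trans ?_)
    rw [norm_mul, hu, one_mul]
  have h2 := mul_le_supportFun hx ζ.im
  have h3 := mul_le_mul_of_nonneg_left h1 hc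
  rw [add_mul, mul_assoc, add_im, Complex.im_ofReal_mul, Complex.im_ofReal_mul]
  linarith

theorem norm_exp_kernel (w ζ : ℂ) : ‖exp (-I * w * ζ)‖ = Real.exp (w * ζ).im := by
  rw [show -I * w * ζ = I * (-(w * ζ)) by ring, norm_exp_I_mul, neg_im, neg_neg]

theorem norm_exp_kernel_le (hab : a ≤ b) (hc : 0 ≤ c) {w : ℂ}
    (hw : w ∈ contourTrace a b c) (ζ : ℂ) :
    ‖exp (-I * w * ζ)‖ ≤ Real.exp (c * ‖ζ‖ + supportFun a b ζ.im) := by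
  rw [norm_exp_kernel]
  exact Real.exp_le_exp.2 (im_mul_le_of_mem_contourTrace hab hc hw ζ)

theorem norm_contourFourier_le (hab : a ≤ b) (hc : 0 ≤ c) {F : ℂ → ℂ} {M : ℝ}
    (hM : ∀ w ∈ contourTrace a b c, ‖F w‖ ≤ M) (ζ : ℂ) :
    ‖contourFourier a b c F ζ‖ ≤
      4 * (M * (b - a + Real.pi * c)) * Real.exp (c * ‖ζ‖ + supportFun a b ζ.im) := by
  refine (norm_contourIntegral_le hab hc
    (M := Real.exp (c * ‖ζ‖ + supportFun a b ζ.im) * M) fun w hw => ?_).trans (le_of_eq (by ring))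
  rw [norm_mul]
  exact mul_le_mul (norm_exp_kernel_le hab hc hw ζ) (hM w hw) (norm_nonneg _) (Real.exp_pos _).le

theorem contourFourier_eq_contourFourier (hab : a ≤ b) {F : ℂ → ℂ}
    (hF : DifferentiableOn ℂ F (interval a b)ᶜ) {c₁ c₂ : ℝ} (hc₁ : 0 < c₁) (hc₂ : 0 < c₂) :
    contourFourier a b c₁ F = contourFourier a b c₂ F :=
  funext fun ζ => contourIntegral_eq_contourIntegral hab
    (DifferentiableOn.fun_mul (by fun_prop) hF) hc₁ hc₂

theorem exists_bound_contourTrace {F : ℂ → ℂ} (hF : ContinuousOn F (contourTrace a b c)) :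
    ∃ M, ∀ w ∈ contourTrace a b c, ‖F w‖ ≤ M :=
  (isCompact_contourTrace a b c).exists_bound_of_continuousOn hF

theorem isExpType_contourFourier (hab : a ≤ b) (hc : 0 < c) {F : ℂ → ℂ}
    (hF : DifferentiableOn ℂ F (interval a b)ᶜ) : IsExpType a b (contourFourier a b c F) where
  diff := by
    have hcont := hF.continuousOn.mono (contourTrace_subset_compl hab hc)
    obtain ⟨M, hM⟩ := exists_bound_contourTrace hcont
    rw [← differentiableOn_univ]
    refine differentiableOn_contourIntegral isOpen_univ
      (fun ζ _ => ContinuousOn.mul (by fun_prop) hcont) (fun w _ => by fun_prop) fun ζ _ => ?_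
    obtain ⟨N, hN⟩ := ((isCompact_contourTrace a b c).prod
      (isCompact_closedBall ζ 1)).exists_bound_of_continuousOn
      (f := fun x : ℂ × ℂ => exp (-I * x.1 * x.2)) (by fun_prop)
    refine ⟨1, one_pos, N * M, fun w hw ζ' hζ' => ?_⟩
    have h1 := hN (w, ζ') ⟨hw, hζ'⟩
    rw [norm_mul]
    exact mul_le_mul h1 (hM w hw) (norm_nonneg _) ((norm_nonneg _).trans h1)
  bound ε hε := by
    rw [contourFourier_eq_contourFourier hab hF hc hε]
    obtain ⟨M, hM⟩ := exists_bound_contourTrace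
      (hF.continuousOn.mono (contourTrace_subset_compl hab hε))
    exact ⟨_, norm_contourFourier_le hab hε.le hM⟩

/-- The Laplace integral of the exponential kernel is the Cauchy kernel, whence by Fubini's theorem
the Laplace integral of a Fourier transform is a Cauchy integral. -/
theorem rayLaplace_contourFourier (hab : a ≤ b) (hc : 0 ≤ c) {F : ℂ → ℂ}
    (hF : ContinuousOn F (contourTrace a b c)) {ω z : ℂ} (hω : ‖ω‖ = 1)
    (hz : c < margin a b ω z) :
    rayLaplace ω (contourFourier a b c F) z =
      I * contourIntegral a b c fun w => F w * (z - w)⁻¹ := by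
  obtain ⟨M, hM⟩ := exists_bound_contourTrace hF
  have hω0 : ω ≠ 0 := fun h => by simp [h] at hω
  have hs : 0 < margin a b ω z - c := sub_pos.2 hz
  have him : ∀ w ∈ contourTrace a b c, margin a b ω z - c ≤ (ω * (z - w)).im := fun w hw => by
    have := im_mul_le_of_mem_contourTrace hab hc hw ω
    rw [hω, mul_one, mul_comm] at this
    rw [mul_sub, sub_im, margin]
    linarith
  -- The integrand on the product of the ray and a piece of the contour.
  let k : Fin 4 → ℝ → ℝ → ℂ := fun j s t => F (contour a b c j s) * deriv (contour a b c j) s * ω *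
    exp (I * (ω * (z - contour a b c j s)) * t)
  have hk : ∀ j, MeasureTheory.Integrable (Function.uncurry (k j))
      ((MeasureTheory.volume.restrict (uIoc 0 1)).prod
        (MeasureTheory.volume.restrict (Ioi (0 : ℝ)))) := by
    intro j
    rw [uIoc_of_le zero_le_one]
    have hdom := (MeasureTheory.integrable_const (μ := MeasureTheory.volume.restrict
      (Ioc (0 : ℝ) 1)) (M * (b - a + Real.pi * c))).mul_prod (integrableOn_exp_neg_mul hs 0)
    refine hdom.mono' ?_ ?_
    · rw [MeasureTheory.Measure.prod_restrict]
      refine ContinuousOn.aestronglyMeasurable ?_ (measurableSet_Ioc.prod measurableSet_Ioi)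
      have h1 : ContinuousOn (fun x : ℝ × ℝ => F (contour a b c j x.1) *
          deriv (contour a b c j) x.1) (Ioc 0 1 ×ˢ Ioi 0) :=
        (continuousOn_contour_integrand hF j).comp continuousOn_fst
          fun x hx => Ioc_subset_Icc_self hx.1
      have h2 := continuous_contour a b c j
      exact (h1.mul continuousOn_const).mul (by fun_prop)
    · rw [MeasureTheory.Measure.prod_restrict]
      filter_upwards [MeasureTheory.ae_restrict_mem (measurableSet_Ioc.prod measurableSet_Ioi)]
        with x hx
      have hw := contour_mem_trace a b c j (Ioc_subset_Icc_self hx.1)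
      have hx2 : (0 : ℝ) < x.2 := hx.2
      have hM0 := (norm_nonneg _).trans (hM _ hw)
      have h1 : ‖exp (I * (ω * (z - contour a b c j x.1)) * x.2)‖ ≤
          Real.exp (-(margin a b ω z - c) * x.2) := by
        rw [mul_assoc, norm_exp_I_mul, Complex.im_mul_ofReal]
        have := him _ hw
        apply Real.exp_le_exp.2
        nlinarith
      simp only [Function.uncurry, k, norm_mul, hω, mul_one]
      exact mul_le_mul (mul_le_mul (hM _ hw) (norm_deriv_contour_le hab hc j _) (norm_nonneg _) hM0)
        h1 (norm_nonneg _) (by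
          have := Real.pi_pos
          exact mul_nonneg hM0 (add_nonneg (by linarith) (by positivity)))
  have h1 : ∀ t : ℝ, contourFourier a b c F (ω * t) * exp (I * ω * t * z) * ω =
      ∑ j, ∫ s in (0 : ℝ)..1, k j s t := by
    intro t
    rw [contourFourier, contourIntegral, Finset.sum_mul, Finset.sum_mul]
    refine Finset.sum_congr rfl fun j _ => ?_
    rw [← intervalIntegral.integral_mul_const, ← intervalIntegral.integral_mul_const]
    congr 1
    funext s
    have : exp (I * (ω * (z - contour a b c j s)) * t) =
        exp (-I * contour a b c j s * (ω * t)) * exp (I * ω * t * z) := by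
      rw [← Complex.exp_add]; congr 1; ring
    simp only [k, this]
    ring
  simp only [rayLaplace, h1]
  rw [MeasureTheory.integral_finsetSum _ fun j _ => by
    have := (hk j).integral_prod_right
    simpa only [intervalIntegral.integral_of_le zero_le_one, uIoc_of_le (zero_le_one (α := ℝ)),
      Function.uncurry] using this]
  rw [contourIntegral, Finset.mul_sum]
  refine Finset.sum_congr rfl fun j _ => ?_
  rw [← MeasureTheory.intervalIntegral_integral_swap (hk j), ← intervalIntegral.integral_const_mul]
  refine intervalIntegral.integral_congr fun s hs' => ?_
  rw [uIcc_of_le zero_le_one] at hs'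
  have hw := contour_mem_trace a b c j hs'
  have hne : z - contour a b c j s ≠ 0 := fun h => by
    have := him _ hw
    rw [h, mul_zero, zero_im] at this
    linarith
  have hre : (I * (ω * (z - contour a b c j s))).re < 0 := by
    have := him _ hw
    rw [Complex.I_mul_re]
    linarith
  simp only [k]
  rw [MeasureTheory.integral_const_mul, integral_exp_mul_complex_Ioi hre]
  simp only [ofReal_zero, mul_zero, Complex.exp_zero]
  field_simp
  linear_combination (-(F (contour a b c j s) * deriv (contour a b c j) s)) * I_sq

theorem differentiableOn_cauchyIntegral (hab : a ≤ b) (hc : 0 < c) {F : ℂ → ℂ}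
    (hF : ContinuousOn F (contourTrace a b c)) :
    DifferentiableOn ℂ (fun z => contourIntegral a b c fun w => F w * (w - z)⁻¹)
      (Metric.thickening c (interval a b)) := by
  obtain ⟨M, hM⟩ := exists_bound_contourTrace hF
  have hne : ∀ z ∈ Metric.thickening c (interval a b), ∀ w ∈ contourTrace a b c, w - z ≠ 0 :=
    fun z hz w hw => ne_of_mem_thickening_of_mem_contourTrace hab hc.le hz hw
  refine differentiableOn_contourIntegral Metric.isOpen_thickening (fun z hz => hF.mul
    (ContinuousOn.inv₀ (by fun_prop) (hne z hz))) (fun w hw => ?_) fun z hz => ?_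
  · exact (DifferentiableOn.fun_inv (by fun_prop) fun z hz => hne z hz w hw).const_mul _
  · obtain ⟨r, hr, hsub⟩ := Metric.nhds_basis_closedBall.mem_iff.1
      (Metric.isOpen_thickening.mem_nhds hz)
    obtain ⟨N, hN⟩ := ((isCompact_contourTrace a b c).prod
      (isCompact_closedBall z r)).exists_bound_of_continuousOn
      (f := fun x : ℂ × ℂ => (x.1 - x.2)⁻¹) (ContinuousOn.inv₀ (by fun_prop)
        fun x hx => hne _ (hsub hx.2) _ hx.1)
    refine ⟨r, hr, M * N, fun w hw z' hz' => ?_⟩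
    have h1 := hN (w, z') ⟨hw, hz'⟩
    rw [norm_mul]
    exact mul_le_mul (hM w hw) h1 (norm_nonneg _) ((norm_nonneg _).trans (hM w hw))

/-- Up to a Cauchy integral over a large contour, a function holomorphic off `[a,b]` is the Borel
transform of its Fourier transform. -/
theorem sub_borel_contourFourier (hab : a ≤ b) {F : ℂ → ℂ}
    (hF : DifferentiableOn ℂ F (interval a b)ᶜ) {z : ℂ} (hz : z ∈ (interval a b)ᶜ)
    (hzc : z ∈ Metric.thickening c (interval a b)) :
    F z - (2 * Real.pi : ℂ)⁻¹ * borel a b (contourFourier a b 1 F) z =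
      -(2 * Real.pi * I)⁻¹ * contourIntegral a b c fun w => F w * (w - z)⁻¹ := by
  have hpi : (Real.pi : ℂ) ≠ 0 := Complex.ofReal_ne_zero.2 Real.pi_ne_zero
  have hd := infDist_pos_of_notMem hab hz
  obtain ⟨ω, hω, hm⟩ := exists_direction hab (le_refl (Metric.infDist z (interval a b)))
  obtain ⟨c₁, hc₁, hc₁d⟩ : ∃ c₁, 0 < c₁ ∧ 2 * c₁ < Metric.infDist z (interval a b) :=
    ⟨Metric.infDist z (interval a b) / 4, by linarith, by linarith⟩
  have h1 := (isExpType_contourFourier hab one_pos hF).borel_eq hab hω (z := z) (by linarith)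
  rw [contourFourier_eq_contourFourier hab hF one_pos hc₁, rayLaplace_contourFourier hab hc₁.le
    (hF.continuousOn.mono (contourTrace_subset_compl hab hc₁)) (norm_of_mem_directions hω)
    (by linarith)] at h1
  have h2 := contourIntegral_mul_inv_sub hab hF hc₁ (by linarith)
    ((mem_thickening_interval_iff hab).1 hzc)
  have h3 : contourIntegral a b c₁ (fun w => F w * (w - z)⁻¹) =
      -contourIntegral a b c₁ (fun w => F w * (z - w)⁻¹) := by
    rw [neg_eq_neg_one_mul, ← contourIntegral_const_mul]
    refine contourIntegral_congr fun w _ => ?_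
    rw [← neg_sub z w, inv_neg]
    ring
  rw [h3] at h2
  rw [contourFourier_eq_contourFourier hab hF one_pos hc₁, h1]
  generalize contourIntegral a b c₁ (fun w => F w * (z - w)⁻¹) = X at *
  generalize contourIntegral a b c (fun w => F w * (w - z)⁻¹) = J at *
  field_simp
  linear_combination h2 - X * I_sq

open Classical in
/-- The entire function that extends the difference of `F` and `(2π)⁻¹` times the Borel transform
of its Fourier transform. -/
noncomputable def entireExtension (a b : ℝ) (F : ℂ → ℂ) (z : ℂ) : ℂ :=
  if z ∈ Metric.thickening 1 (interval a b) then
    -(2 * Real.pi * I)⁻¹ * contourIntegral a b 1 fun w => F w * (w - z)⁻¹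
  else F z - (2 * Real.pi : ℂ)⁻¹ * borel a b (contourFourier a b 1 F) z

theorem entireExtension_of_notMem (hab : a ≤ b) {F : ℂ → ℂ}
    (hF : DifferentiableOn ℂ F (interval a b)ᶜ) {z : ℂ} (hz : z ∈ (interval a b)ᶜ) :
    entireExtension a b F z = F z - (2 * Real.pi : ℂ)⁻¹ * borel a b (contourFourier a b 1 F) z := by
  unfold entireExtension
  split_ifs with h
  · exact (sub_borel_contourFourier hab hF hz h).symm
  · rfl

theorem differentiable_entireExtension (hab : a ≤ b) {F : ℂ → ℂ}
    (hF : DifferentiableOn ℂ F (interval a b)ᶜ) : Differentiable ℂ (entireExtension a b F) := by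
  intro z
  by_cases hz : z ∈ interval a b
  · have hnhds : Metric.thickening 1 (interval a b) ∈ 𝓝 z :=
      Metric.isOpen_thickening.mem_nhds (Metric.self_subset_thickening one_pos _ hz)
    have h1 := ((differentiableOn_cauchyIntegral hab one_pos (hF.continuousOn.mono
      (contourTrace_subset_compl hab one_pos))).const_mul (-(2 * Real.pi * I)⁻¹)).differentiableAt
      hnhds
    refine h1.congr_of_eventuallyEq ?_
    filter_upwards [hnhds] with w hw using if_pos hw
  · have hnhds : (interval a b)ᶜ ∈ 𝓝 z := (isOpen_compl_interval a b).mem_nhds hz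
    have h1 := (hF.fun_sub (((isExpType_contourFourier hab one_pos hF).differentiableOn_borel
      hab).const_mul (2 * Real.pi : ℂ)⁻¹)).differentiableAt hnhds
    refine h1.congr_of_eventuallyEq ?_
    filter_upwards [hnhds] with w hw using entireExtension_of_notMem hab hF hw

theorem IsExpType.eq_zero_of_rayLaplace_eq_zero (hab : a ≤ b) {f : ℂ → ℂ} (hf : IsExpType a b f)
    (h : ∀ z : ℂ, 0 < z.im → rayLaplace 1 f z = 0) (ζ : ℂ) : f ζ = 0 := by
  -- The Laplace integral on a horizontal line is the Fourier transform of `k`.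
  set k : ℝ → ℂ := (Ioi (0 : ℝ)).indicator fun t => f t * exp (-(t : ℂ)) with hk
  have hkint : MeasureTheory.Integrable k := by
    rw [hk, MeasureTheory.integrable_indicator_iff measurableSet_Ioi]
    have := hf.integrableOn_ray hab (ω := 1) (z := I) (by simp) (by simp [margin_one hab])
    refine this.congr (Eventually.of_forall fun t => ?_)
    simp only [one_mul, mul_one]
    rw [show I * (t : ℂ) * I = -t by linear_combination (t : ℂ) * I_sq]
  have hF : FourierTransform.fourier k = 0 := by
    funext w
    rw [Real.fourier_real_eq_integral_exp_smul, Pi.zero_apply, ← h (I - 2 * Real.pi * w) (by simp),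
      rayLaplace, ← MeasureTheory.integral_indicator measurableSet_Ioi]
    congr 1
    funext t
    rw [hk]
    by_cases ht : t ∈ Ioi (0 : ℝ)
    · rw [indicator_of_mem ht, indicator_of_mem ht, smul_eq_mul, one_mul, mul_one, mul_one,
        show I * (t : ℂ) * (I - 2 * Real.pi * w) = ((-2 * Real.pi * t * w : ℝ) : ℂ) * I + -t by
          push_cast; linear_combination (t : ℂ) * I_sq, Complex.exp_add]
      ring
    · rw [indicator_of_notMem ht, indicator_of_notMem ht, smul_zero]
  have hpos : ∀ t : ℝ, 0 < t → f t = 0 := by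
    intro t ht
    have hev : k =ᶠ[𝓝 t] fun t : ℝ => f t * exp (-(t : ℂ)) := by
      filter_upwards [Ioi_mem_nhds ht] with s hs using indicator_of_mem hs _
    have hfc := hf.diff.continuous
    have hcont : ContinuousAt k t :=
      (Continuous.continuousAt (by fun_prop)).congr hev.symm
    have hinv := hkint.fourierInv_fourier_eq (by rw [hF]; exact MeasureTheory.integrable_zero _ _ _)
      hcont
    rw [hF, hev.eq_of_nhds, Real.fourierInv_eq'] at hinv
    simpa using hinv.symm
  have han : AnalyticOnNhd ℂ f univ := fun z _ => hf.diff.analyticAt z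
  have hfreq : ∃ᶠ z in 𝓝[≠] (1 : ℂ), f z = (0 : ℂ → ℂ) z := by
    have h2 : Tendsto (fun n : ℕ => (1 : ℂ) + ((1 / ((n : ℝ) + 1) : ℝ) : ℂ)) atTop (𝓝[≠] 1) := by
      rw [tendsto_nhdsWithin_iff]
      refine ⟨?_, Eventually.of_forall fun n => ?_⟩
      · have := ((Complex.continuous_ofReal.tendsto _).comp
          (tendsto_one_div_add_atTop_nhds_zero_nat (𝕜 := ℝ))).const_add (1 : ℂ)
        simpa [Function.comp_def] using this
      · have : 1 / ((n : ℝ) + 1) ≠ 0 := by positivity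
        simpa using Complex.ofReal_ne_zero.2 this
    refine h2.frequently (Eventually.of_forall fun n => ?_).frequently
    have := hpos (1 + 1 / ((n : ℝ) + 1)) (by positivity)
    push_cast at this ⊢
    exact this
  exact congrFun (han.eq_of_frequently_eq (g := 0) (fun z _ => analyticAt_const) hfreq) ζ

/-- The Fourier transform inverts the Borel transform up to the factor `2π`: the Borel transform of
the difference is the restriction of a bounded entire function, which vanishes at infinity. -/
theorem IsExpType.contourFourier_borel (hab : a ≤ b) {f : ℂ → ℂ} (hf : IsExpType a b f)
    (hc : 0 < c) (ζ : ℂ) : contourFourier a b c (borel a b f) ζ = 2 * Real.pi * f ζ := by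
  have hpi : (Real.pi : ℂ) ≠ 0 := Complex.ofReal_ne_zero.2 Real.pi_ne_zero
  have hF := hf.differentiableOn_borel hab
  have hg := isExpType_contourFourier hab one_pos hF
  set h : ℂ → ℂ := fun z => f z - (2 * Real.pi : ℂ)⁻¹ * contourFourier a b 1 (borel a b f) z
    with hh
  have hE : IsExpType a b h := hf.sub (hg.const_mul _)
  set G := entireExtension a b (borel a b f) with hG
  have hGd : Differentiable ℂ G := differentiable_entireExtension hab hF
  have hGB : ∀ z ∈ (interval a b)ᶜ, G z = borel a b h z := fun z hz => by
    rw [hG, entireExtension_of_notMem hab hF hz, hf.borel_sub hab (hg.const_mul _) hz,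
      borel_const_mul]
  have hbdd : Bornology.IsBounded (range G) := by
    obtain ⟨M, hM⟩ := (IsCompact.cthickening (r := 1)
      (isCompact_interval a b)).exists_bound_of_continuousOn hGd.continuous.continuousOn
    obtain ⟨C, hC⟩ := hE.bound (1 / 4) (by norm_num)
    refine isBounded_iff_forall_norm_le.2 ⟨max M (C / (1 / 2 - 1 / 4)), ?_⟩
    rintro _ ⟨z, rfl⟩
    by_cases hz : z ∈ Metric.cthickening 1 (interval a b)
    · exact (hM z hz).trans (le_max_left _ _)
    · have hd : 1 ≤ Metric.infDist z (interval a b) := by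
        by_contra hlt
        exact hz (Metric.thickening_subset_cthickening _ _
          ((mem_thickening_interval_iff hab).2 (not_le.1 hlt)))
      have hzK : z ∈ (interval a b)ᶜ := fun hzK => hz (Metric.self_subset_cthickening _ hzK)
      rw [hGB z hzK]
      exact (hE.norm_borel_le hab hC (by norm_num) (by norm_num) hd).trans (le_max_right _ _)
  have hconst : ∀ z, G z = G 0 := fun z => hGd.apply_eq_apply_of_bounded hbdd z 0
  have hup : ∀ z : ℂ, 0 < z.im → z ∈ (interval a b)ᶜ := fun z hz hzK =>
    hz.ne' (eq_ofReal_of_mem_interval hzK).1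
  have hray : ∀ z : ℂ, 0 < z.im → G z = rayLaplace 1 h z := fun z hz => by
    rw [hGB z (hup z hz), hE.borel_eq hab (ω := 1) (by simp [directions])
      (by rwa [margin_one hab])]
  have hG0 : G 0 = 0 := by
    obtain ⟨C, hC⟩ := hE.bound 1 one_pos
    have h1 : ∀ᶠ y : ℝ in atTop, ‖G 0‖ ≤ C / (y - 1) := by
      filter_upwards [eventually_gt_atTop 1] with y hy
      have him : ((y : ℂ) * I).im = y := by simp
      rw [← hconst (y * I), hray _ (by rw [him]; linarith)]
      have := norm_rayLaplace_le hab hC (ω := 1) (z := y * I) (by simp)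
        (by rw [margin_one hab, him]; exact hy)
      rwa [margin_one hab, him] at this
    have h2 : Tendsto (fun y : ℝ => C / (y - 1)) atTop (𝓝 0) :=
      (tendsto_atTop_add_const_right atTop (-1 : ℝ) tendsto_id).const_div_atTop C
    exact norm_le_zero_iff.1 (ge_of_tendsto h2 h1)
  have h0 := hE.eq_zero_of_rayLaplace_eq_zero hab
    (fun z hz => by rw [← hray z hz, hconst, hG0]) ζ
  rw [contourFourier_eq_contourFourier hab hF hc one_pos]
  simp only [hh] at h0
  field_simp at h0
  linear_combination -h0

end ScalarFourier

/-! ### Estimates by the seminorms of the function spaces -/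

section Seminorms

theorem wBdd_iff {E : Type*} [AddCommGroup E] [Module ℂ E] {X : Type*} {q : Seminorm ℂ E}
    {S : Set X} {w : X → ℝ} {f : X → E} :
    WBdd q S w f ↔ ∃ C, ∀ x ∈ S, q (f x) * w x ≤ C := by
  constructor
  · rintro ⟨C, hC⟩
    exact ⟨C, fun x hx => hC ⟨⟨x, hx⟩, rfl⟩⟩
  · rintro ⟨C, hC⟩
    exact ⟨C, by rintro _ ⟨x, rfl⟩; exact hC x x.2⟩

variable {E : Type*} [AddCommGroup E] [Module ℂ E] {X : Type*}
  {q : Seminorm ℂ E} {S : Set X} {w : X → ℝ}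

theorem le_supSeminorm {V : Submodule ℂ (X → E)} (hw : ∀ x, 0 ≤ w x)
    (hV : ∀ f ∈ V, WBdd q S w f) (f : V) {x : X} (hx : x ∈ S) :
    q (f.1 x) * w x ≤ supSeminorm V q S w hw hV f :=
  le_ciSup (hV f.1 f.2) (⟨x, hx⟩ : S)

theorem supSeminorm_le {V : Submodule ℂ (X → E)} (hw : ∀ x, 0 ≤ w x)
    (hV : ∀ f ∈ V, WBdd q S w f) (f : V) {M : ℝ} (hM : 0 ≤ M)
    (h : ∀ x ∈ S, q (f.1 x) * w x ≤ M) : supSeminorm V q S w hw hV f ≤ M :=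
  Real.iSup_le (fun x => h x x.2) hM

/-- A weighted bound for each seminorm of a generating family gives one for every continuous
seminorm. -/
theorem WBdd.of_continuous [TopologicalSpace E] {ι : Type*} {p : SeminormFamily ℂ E ι}
    (hp : WithSeminorms p) (hw : ∀ x, 0 ≤ w x) {f : X → E} (h : ∀ α, WBdd (p α) S w f)
    (hq : Continuous q) : WBdd q S w f := by
  obtain ⟨s, C, -, hC⟩ := Seminorm.bound_of_continuous hp q hq
  choose D hD using fun α => wBdd_iff.1 (h α)
  refine wBdd_iff.2 ⟨C * ∑ α ∈ s, D α, fun x hx => ?_⟩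
  have h1 : q (f x) ≤ C * ∑ α ∈ s, p α (f x) := by
    refine (hC (f x)).trans ?_
    rw [_root_.smul_apply, NNReal.smul_def, smul_eq_mul]
    refine mul_le_mul_of_nonneg_left ?_ C.2
    refine (Seminorm.finset_sup_le_sum p s (f x)).trans (le_of_eq ?_)
    rw [← FunLike.coeAddMonoidHom_apply, map_sum, Finset.sum_apply]
    rfl
  calc q (f x) * w x ≤ C * (∑ α ∈ s, p α (f x)) * w x :=
        mul_le_mul_of_nonneg_right h1 (hw x)
    _ = C * ∑ α ∈ s, p α (f x) * w x := by rw [mul_assoc, Finset.sum_mul]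
    _ ≤ _ := mul_le_mul_of_nonneg_left (Finset.sum_le_sum fun α _ => hD α x hx) C.2

end Seminorms

section Spaces

theorem zeroExt_of_mem {K : Set ℂ} {E : Type*} [AddCommGroup E] (F : ↥(Kᶜ) → E) {z : ℂ}
    (hz : z ∈ Kᶜ) : zeroExt F z = F ⟨z, hz⟩ := dif_pos hz

theorem zeroExt_restrict {K : Set ℂ} {E : Type*} [AddCommGroup E] (g : ℂ → E) {z : ℂ}
    (hz : z ∈ Kᶜ) : zeroExt (fun z : ↥(Kᶜ) => g z) z = g z := dif_pos hz

variable {E : Type*} {ι : Type*} [AddCommGroup E] [Module ℂ E] [TopologicalSpace E]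
  [IsTopologicalAddGroup E] [ContinuousSMul ℂ E] {p : SeminormFamily ℂ E ι} {a b : ℝ}

theorem exp_mul_foWeight (k : ℕ+) (z : ℂ) :
    Real.exp (1 / (k : ℝ) * ‖z‖ + supportFun a b z.im) * foWeight a b k z = 1 := by
  rw [foWeight, ← Real.exp_add]
  simp

theorem exp_mul_expWeight (n : ℕ+) (z : ℂ) :
    Real.exp (1 / (n : ℝ) * |z.re|) * expWeight n z = 1 := by
  rw [expWeight, ← Real.exp_add]
  simp

theorem mul_foWeight_le_iff {k : ℕ+} {z : ℂ} {x M : ℝ} :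
    x * foWeight a b k z ≤ M ↔ x ≤ M * Real.exp (1 / (k : ℝ) * ‖z‖ + supportFun a b z.im) := by
  have h1 := exp_mul_foWeight (a := a) (b := b) k z
  have h2 : 0 < foWeight a b k z := Real.exp_pos _
  conv_rhs => rw [← mul_le_mul_iff_left₀ h2, mul_assoc M, h1, mul_one]

theorem mul_expWeight_le_iff {n : ℕ+} {z : ℂ} {x M : ℝ} :
    x * expWeight n z ≤ M ↔ x ≤ M * Real.exp (1 / (n : ℝ) * |z.re|) := by
  have h1 := exp_mul_expWeight n z
  have h2 : 0 < expWeight n z := Real.exp_pos _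
  conv_rhs => rw [← mul_le_mul_iff_left₀ h2, mul_assoc M, h1, mul_one]

theorem FO.le_seminorms (f : FO p a b) (k : ℕ+) (α : ι) (z : ℂ) :
    p α (f.toFun z) ≤
      FO.seminorms p a b (k, α) f * Real.exp (1 / (k : ℝ) * ‖z‖ + supportFun a b z.im) :=
  mul_foWeight_le_iff.1 (le_supSeminorm (V := foSubmodule p a b) _ _ f (mem_univ z))

theorem FO.seminorms_le (f : FO p a b) {k : ℕ+} {α : ι} {M : ℝ} (hM : 0 ≤ M)
    (h : ∀ z, p α (f.toFun z) ≤ M * Real.exp (1 / (k : ℝ) * ‖z‖ + supportFun a b z.im)) :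
    FO.seminorms p a b (k, α) f ≤ M :=
  supSeminorm_le (V := foSubmodule p a b) _ _ f hM fun z _ => mul_foWeight_le_iff.2 (h z)

theorem ExpHol.le_seminorms {K : Set ℂ} (F : ExpHol p K) {n : ℕ+} (α : ι) {z : ↥(Kᶜ)}
    (hz : (z : ℂ) ∈ S K n) : p α (F.toFun z) ≤
      ExpHol.seminorms p K (n, α) F * Real.exp (1 / (n : ℝ) * |(z : ℂ).re|) :=
  mul_expWeight_le_iff.1 (le_supSeminorm (V := expHolSubmodule p K) (q := p α)
    (w := fun z : ↥(Kᶜ) => expWeight n z) _ _ F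
    (S := {z : ↥(Kᶜ) | (z : ℂ) ∈ FourierHyp.S K n}) (x := z) hz)

theorem ExpHol.seminorms_le {K : Set ℂ} (F : ExpHol p K) {n : ℕ+} {α : ι} {M : ℝ} (hM : 0 ≤ M)
    (h : ∀ z : ↥(Kᶜ), (z : ℂ) ∈ S K n → p α (F.toFun z) * expWeight n z ≤ M) :
    ExpHol.seminorms p K (n, α) F ≤ M :=
  supSeminorm_le (V := expHolSubmodule p K) _ _ F hM h

theorem mem_S_of_lt_infDist {K : Set ℂ} (hK : K.Nonempty) {n : ℕ+} {z : ℂ}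
    (h : 1 / (n : ℝ) < Metric.infDist z K) (him : |z.im| < n) : z ∈ S K n := by
  refine ⟨fun hz => ?_, him⟩
  have h1 := Metric.closure_thickening_subset_cthickening _ _ hz
  rw [Metric.cthickening_eq_iInter_thickening (by positivity)] at h1
  have h2 := mem_iInter₂.1 h1 _ h
  rw [Metric.mem_thickening_iff_infDist_lt hK] at h2
  exact lt_irrefl _ h2

theorem le_infDist_of_mem_S {K : Set ℂ} (hK : K.Nonempty) {n : ℕ+} {z : ℂ} (hz : z ∈ S K n) :
    1 / (n : ℝ) ≤ Metric.infDist z K := by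
  by_contra h
  exact hz.1 (subset_closure ((Metric.mem_thickening_iff_infDist_lt hK).2 (not_le.1 h)))

theorem ExpHol.weakHol {K : Set ℂ} (F : ExpHol p K) : WeakHol (zeroExt F.toFun) Kᶜ :=
  WeakHol.of_differentiableOn (Subtype.prop F : F.toFun ∈ expHolSubmodule p K).1

theorem FO.weakHol (f : FO p a b) : WeakHol f.toFun univ :=
  WeakHol.of_differentiableOn (Subtype.prop f : f.toFun ∈ foSubmodule p a b).1

theorem FO.exists_bound (hp : WithSeminorms p) (f : FO p a b) {q : Seminorm ℂ E}
    (hq : Continuous q) {ε : ℝ} (hε : 0 < ε) :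
    ∃ C, ∀ z, q (f.toFun z) ≤ C * Real.exp (ε * ‖z‖ + supportFun a b z.im) := by
  obtain ⟨k, hk⟩ := exists_nat_one_div_lt hε
  have h1 := WBdd.of_continuous hp (fun z => (Real.exp_pos _).le)
    (fun α => (Subtype.prop f : f.toFun ∈ foSubmodule p a b).2 k.succPNat α) hq
  obtain ⟨C, hC⟩ := wBdd_iff.1 h1
  refine ⟨C, fun z => ?_⟩
  have h2 := mul_foWeight_le_iff.1 (hC z (mem_univ z))
  have hC0 : 0 ≤ C := nonneg_of_mul_nonneg_left ((apply_nonneg _ _).trans h2) (Real.exp_pos _)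
  refine h2.trans (mul_le_mul_of_nonneg_left (Real.exp_le_exp.2 ?_) hC0)
  have : 1 / ((k.succPNat : ℕ+) : ℝ) ≤ ε := by simpa using hk.le
  gcongr

theorem FO.isExpType (hp : WithSeminorms p) (f : FO p a b) (φ : E →L[ℂ] ℂ) :
    IsExpType a b fun z => φ (f.toFun z) where
  diff := differentiableOn_univ.1 (f.weakHol.holo φ)
  bound _ hε := f.exists_bound hp (continuous_dualSeminorm φ) hε

end Spaces

/-! ### The vector-valued Fourier transform -/

section VectorFourier

variable {E : Type*} {ι : Type*} [AddCommGroup E] [Module ℂ E] [TopologicalSpace E]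
  [PolynormableSpace ℂ E]

/-- Contour integrals of holomorphic functions exist as Pettis integrals. -/
theorem WeakHol.exists_contourIntegral (hE : LocallyComplete E) {g : ℂ → E} {Ω : Set ℂ}
    (hΩ : IsOpen Ω) (hg : WeakHol g Ω) {a b c : ℝ} (hsub : contourTrace a b c ⊆ Ω) :
    ∃ e : E, ∀ φ : E →L[ℂ] ℂ, φ e = contourIntegral a b c fun w => φ (g w) := by
  choose e he using fun j => hg.exists_curve_integral hE hΩ (contDiff_contour a b c j)
    fun t ht => hsub (contour_mem_trace a b c j ht)
  exact ⟨∑ j, e j, fun φ => by rw [map_sum, contourIntegral]; simp only [he]⟩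

variable [IsTopologicalAddGroup E] [ContinuousSMul ℂ E] {p : SeminormFamily ℂ E ι} {a b : ℝ}

theorem exists_fourier (hE : LocallyComplete E) (hab : a ≤ b) (F : ExpHol p (interval a b))
    (ζ : ℂ) : ∃ e : E, ∀ φ : E →L[ℂ] ℂ,
      φ e = contourFourier a b 1 (fun w => φ (zeroExt F.toFun w)) ζ := by
  obtain ⟨e, he⟩ := (F.weakHol.smul (m := fun w => exp (-I * w * ζ))
    (by fun_prop)).exists_contourIntegral hE (isOpen_compl_interval a b)
      (contourTrace_subset_compl hab one_pos)
  refine ⟨e, fun φ => ?_⟩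
  rw [he]
  simp [contourFourier]

/-- The Fourier transform of `F`, as a function; the Pettis integral along the contour. -/
noncomputable def fourierFun (hE : LocallyComplete E) (hab : a ≤ b)
    (F : ExpHol p (interval a b)) (ζ : ℂ) : E :=
  (exists_fourier hE hab F ζ).choose

theorem dual_fourierFun (hE : LocallyComplete E) (hab : a ≤ b) (F : ExpHol p (interval a b))
    {c : ℝ} (hc : 0 < c) (φ : E →L[ℂ] ℂ) (ζ : ℂ) :
    φ (fourierFun hE hab F ζ) = contourFourier a b c (fun w => φ (zeroExt F.toFun w)) ζ := by
  rw [contourFourier_eq_contourFourier hab (F.weakHol.holo φ) hc one_pos]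
  exact (exists_fourier hE hab F ζ).choose_spec φ

theorem seminorm_fourierFun_le (hE : LocallyComplete E) (hab : a ≤ b)
    (F : ExpHol p (interval a b)) {q : Seminorm ℂ E} (hq : Continuous q) {c M : ℝ} (hc : 0 < c)
    (hM : ∀ w ∈ contourTrace a b c, q (zeroExt F.toFun w) ≤ M) (ζ : ℂ) :
    q (fourierFun hE hab F ζ) ≤
      4 * (M * (b - a + Real.pi * c)) * Real.exp (c * ‖ζ‖ + supportFun a b ζ.im) :=
  seminorm_le_of_forall_dual hq fun φ hφ => by
    rw [dual_fourierFun hE hab F hc]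
    exact norm_contourFourier_le hab hc.le (fun w hw => (hφ _).trans (hM w hw)) ζ

theorem exists_bound_fourierFun (hE : LocallyComplete E) (hab : a ≤ b)
    (F : ExpHol p (interval a b)) {q : Seminorm ℂ E} (hq : Continuous q) {c : ℝ} (hc : 0 < c) :
    ∃ C, ∀ ζ, q (fourierFun hE hab F ζ) ≤ C * Real.exp (c * ‖ζ‖ + supportFun a b ζ.im) := by
  obtain ⟨M, hM⟩ := F.weakHol.exists_bound (isCompact_contourTrace a b c)
    (contourTrace_subset_compl hab hc) hq
  exact ⟨_, seminorm_fourierFun_le hE hab F hq hc hM⟩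

theorem supportFun_eq_max (hab : a ≤ b) (t : ℝ) : supportFun a b t = max (a * t) (b * t) := by
  refine le_antisymm (supportFun_le hab fun x hx => ?_)
    (max_le (mul_le_supportFun (left_mem_Icc.2 hab) t) (mul_le_supportFun (right_mem_Icc.2 hab) t))
  rcases le_total 0 t with ht | ht
  · exact le_max_of_le_right (mul_le_mul_of_nonneg_right hx.2 ht)
  · exact le_max_of_le_left (mul_le_mul_of_nonpos_right hx.1 ht)

theorem continuous_supportFun (hab : a ≤ b) : Continuous (supportFun a b) := by
  rw [funext (supportFun_eq_max hab)]
  fun_prop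

theorem fourierFun_mem (hp : WithSeminorms p) (hE : LocallyComplete E) (hab : a ≤ b)
    (F : ExpHol p (interval a b)) : fourierFun hE hab F ∈ foSubmodule p a b := by
  have hw : WeakHol (fourierFun hE hab F) univ :=
    { holo := fun φ => by
        simp only [dual_fourierFun hE hab F one_pos φ]
        exact (isExpType_contourFourier hab one_pos (F.weakHol.holo φ)).diff.differentiableOn
      bdd := fun q hq z _ => by
        obtain ⟨C, hC⟩ := exists_bound_fourierFun hE hab F hq one_pos
        have hcont : Continuous fun ζ : ℂ =>
            C * Real.exp (1 * ‖ζ‖ + supportFun a b ζ.im) := by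
          have := continuous_supportFun hab
          fun_prop
        refine ⟨_, ((hcont.tendsto z).eventually_lt_const (lt_add_one _)).filter_mono
          nhdsWithin_le_nhds |>.mono fun w hw => (hC w).trans hw.le⟩ }
  refine ⟨hw.differentiableOn hE isOpen_univ, fun k α => wBdd_iff.2 ?_⟩
  obtain ⟨C, hC⟩ := exists_bound_fourierFun hE hab F (hp.continuous_seminorm α)
    (c := 1 / (k : ℝ)) (by positivity)
  exact ⟨C, fun z _ => mul_foWeight_le_iff.2 (hC z)⟩

/-- The Fourier transform as a linear map. -/
noncomputable def fourierLinear [T2Space E] (hp : WithSeminorms p) (hE : LocallyComplete E)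
    (hab : a ≤ b) : ExpHol p (interval a b) →ₗ[ℂ] FO p a b where
  toFun F := ⟨fourierFun hE hab F, fourierFun_mem hp hE hab F⟩
  map_add' F G := Subtype.ext <| funext fun ζ => eq_of_forall_dual_eq fun φ => by
    have hc : ∀ F : ExpHol p (interval a b), ContinuousOn
        (fun w => exp (-I * w * ζ) * φ (zeroExt F.toFun w)) (contourTrace a b 1) := fun F =>
      ContinuousOn.mul (by fun_prop)
        ((F.weakHol.holo φ).continuousOn.mono (contourTrace_subset_compl hab one_pos))
    change φ (fourierFun hE hab (F + G) ζ) =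
      φ (fourierFun hE hab F ζ + fourierFun hE hab G ζ)
    rw [map_add, dual_fourierFun hE hab _ one_pos, dual_fourierFun hE hab _ one_pos,
      dual_fourierFun hE hab _ one_pos, contourFourier, contourFourier, contourFourier,
      ← contourIntegral_add (hc F) (hc G)]
    refine contourIntegral_congr fun w hw => ?_
    have hw' := contourTrace_subset_compl hab one_pos hw
    simp only [zeroExt_of_mem _ hw', ← mul_add, ← map_add]
    rfl
  map_smul' s F := Subtype.ext <| funext fun ζ => eq_of_forall_dual_eq fun φ => by
    change φ (fourierFun hE hab (s • F) ζ) = φ (s • fourierFun hE hab F ζ)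
    rw [map_smul, smul_eq_mul, dual_fourierFun hE hab _ one_pos, dual_fourierFun hE hab _ one_pos,
      contourFourier, contourFourier, ← contourIntegral_const_mul]
    refine contourIntegral_congr fun w hw => ?_
    have hw' := contourTrace_subset_compl hab one_pos hw
    simp only [zeroExt_of_mem _ hw']
    rw [mul_left_comm, ← smul_eq_mul s, ← map_smul]
    rfl

theorem fourierLinear_toFun [T2Space E] (hp : WithSeminorms p) (hE : LocallyComplete E)
    (hab : a ≤ b) (F : ExpHol p (interval a b)) :
    (fourierLinear hp hE hab F).toFun = fourierFun hE hab F := rfl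

/-- The Fourier transform is continuous: the contour of radius `1/k` controls the seminorm of
index `k`. -/
theorem continuous_fourierLinear [T2Space E] (hp : WithSeminorms p) (hE : LocallyComplete E)
    (hab : a ≤ b) : Continuous (fourierLinear hp hE hab (a := a) (b := b) (p := p)) := by
  refine WithSeminorms.continuous_of_isBounded (ExpHol.withSeminorms p _) (FO.withSeminorms p a b)
    _ ?_
  rintro ⟨k, α⟩
  have hk0 : (0 : ℝ) < k := by exact_mod_cast k.pos
  have hk1 : (1 : ℝ) ≤ k := by exact_mod_cast k.pos
  have hc : (0 : ℝ) < 1 / (k : ℝ) := by positivity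
  obtain ⟨R, hR⟩ := (isCompact_contourTrace a b (1 / (k : ℝ))).exists_bound_of_continuousOn
    (f := fun w => w) continuousOn_id
  have hpi := Real.pi_pos
  set A : ℝ := 4 * (Real.exp R * (b - a + Real.pi * (1 / (k : ℝ)))) with hA
  have hA0 : 0 ≤ A := by
    have : 0 ≤ b - a := sub_nonneg.2 hab
    positivity
  refine ⟨{(2 * k, α)}, A.toNNReal, fun F => ?_⟩
  rw [Seminorm.comp_apply, _root_.smul_apply, Finset.sup_singleton, NNReal.smul_def, smul_eq_mul,
    Real.coe_toNNReal A hA0]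
  set N := ExpHol.seminorms p (interval a b) (2 * k, α) F with hN
  have hN0 : 0 ≤ N := apply_nonneg _ _
  refine FO.seminorms_le _ (by positivity) fun ζ => ?_
  refine (seminorm_fourierFun_le hE hab F (hp.continuous_seminorm α) hc
    (M := N * Real.exp R) (fun w hw => ?_) ζ).trans (le_of_eq (by rw [hA]; ring))
  have hwK := contourTrace_subset_compl hab hc hw
  have hcast : ((2 * k : ℕ+) : ℝ) = 2 * k := by push_cast; ring
  have hS : w ∈ S (interval a b) (2 * k) := by
    refine mem_S_of_lt_infDist (interval_nonempty hab) ?_ ?_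
    · rw [infDist_of_mem_contourTrace hab hc.le hw, hcast]
      exact one_div_lt_one_div_of_lt hk0 (by linarith)
    · obtain ⟨x, hx, u, hu, rfl, -⟩ := exists_of_mem_contourTrace hab hw
      rw [hcast, add_im, ofReal_im, zero_add, Complex.im_ofReal_mul, abs_mul, abs_of_pos hc]
      have h1 : |u.im| ≤ 1 := hu ▸ Complex.abs_im_le_norm u
      have h2 : 1 / (k : ℝ) ≤ 1 := by rw [div_le_one hk0]; exact hk1
      nlinarith [abs_nonneg u.im]
  rw [zeroExt_of_mem _ hwK]
  refine (ExpHol.le_seminorms F α (z := ⟨w, hwK⟩) hS).trans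
    (mul_le_mul_of_nonneg_left (Real.exp_le_exp.2 ?_) hN0)
  have h1 : |w.re| ≤ R := (Complex.abs_re_le_norm w).trans (hR w hw)
  have h2 : 1 / ((2 * k : ℕ+) : ℝ) ≤ 1 := by
    rw [hcast, div_le_one (by positivity)]; linarith
  nlinarith [abs_nonneg w.re]

theorem entirePart_le_ker_fourierLinear [T2Space E] (hp : WithSeminorms p)
    (hE : LocallyComplete E) (hab : a ≤ b) :
    entirePart p (interval a b) ≤ LinearMap.ker (fourierLinear hp hE hab) := by
  rintro F ⟨G, hG⟩
  refine LinearMap.mem_ker.2 (Subtype.ext <| funext fun ζ => eq_of_forall_dual_eq fun φ => ?_)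
  change φ (fourierFun hE hab F ζ) = φ 0
  have hGφ : DifferentiableOn ℂ (fun w => φ (zeroExt G.toFun w)) univ := by
    simpa using G.weakHol.holo φ
  rw [map_zero, dual_fourierFun hE hab F one_pos]
  refine (contourIntegral_congr fun w hw => ?_).trans
    (contourIntegral_eq_zero_of_convex isOpen_univ convex_univ
      (h := fun w => exp (-I * w * ζ) * φ (zeroExt G.toFun w))
      (DifferentiableOn.fun_mul (by fun_prop) hGφ) (subset_univ _))
  have hw' := contourTrace_subset_compl hab one_pos hw
  simp only [zeroExt_of_mem F.toFun hw', zeroExt_of_mem G.toFun (z := w) (fun h => h)]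
  rw [hG ⟨w, hw'⟩]

end VectorFourier

/-! ### The vector-valued Borel transform -/

section VectorBorel

variable {E : Type*} {ι : Type*} [AddCommGroup E] [Module ℂ E] [TopologicalSpace E]
  [PolynormableSpace ℂ E] [IsTopologicalAddGroup E] [ContinuousSMul ℂ E]
  {p : SeminormFamily ℂ E ι} {a b : ℝ}

/-- The Laplace integral along a ray exists as the limit of the integrals over `[0, n]`. -/
theorem exists_borel (hp : WithSeminorms p) (hE : LocallyComplete E) (hab : a ≤ b)
    (f : FO p a b) (z : ↥((interval a b)ᶜ)) :
    ∃ e : E, ∀ φ : E →L[ℂ] ℂ, φ e = borel a b (fun w => φ (f.toFun w)) z := by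
  obtain ⟨ω, hω, hm⟩ := exists_direction_pos hab z.2
  have hω1 := norm_of_mem_directions hω
  set δ := margin a b ω z with hδ
  choose x hx using fun n : ℕ => (f.weakHol.smul (m := fun ζ => exp (I * ζ * z))
    (by fun_prop)).exists_curve_integral hE isOpen_univ
    (γ := fun t : ℝ => (ω * n : ℂ) * t) (contDiff_const.mul Complex.ofRealCLM.contDiff)
    (fun t _ => mem_univ _)
  have hlim : Tendsto (fun n : ℕ => Real.exp (-(δ / 2) * n)) atTop (𝓝 0) := by
    refine Real.tendsto_exp_atBot.comp ?_
    exact tendsto_natCast_atTop_atTop.const_mul_atTop_of_neg (by linarith)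
  obtain ⟨e, he⟩ := hE.exists_of_dual_rate (x := x) hlim
    (ℓ := fun φ => rayLaplace ω (fun w => φ (f.toFun w)) z) (by
      intro q hq
      obtain ⟨C, hC⟩ := f.exists_bound hp hq (half_pos hm)
      refine ⟨C / (δ / 2), fun φ hφ n => ?_⟩
      have hCφ := fun w => (hφ _).trans (hC w)
      have h1 : φ (x n) = ∫ t in (0 : ℝ)..n,
          φ (f.toFun (ω * t)) * exp (I * ω * t * z) * ω := by
        have hsub := intervalIntegral.smul_integral_comp_mul_left (a := 0) (b := 1)
          (fun t : ℝ => φ (f.toFun (ω * t)) * exp (I * ω * t * z) * ω) (n : ℝ)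
        rw [mul_zero, mul_one] at hsub
        rw [← hsub, hx, ← intervalIntegral.integral_smul]
        refine intervalIntegral.integral_congr fun t _ => ?_
        have hd : deriv (fun t : ℝ => (ω * n : ℂ) * t) t = ω * n := by
          have h0 : HasDerivAt (fun t : ℝ => (t : ℂ)) 1 t := Complex.ofRealCLM.hasDerivAt
          simpa using (h0.const_mul (ω * n : ℂ)).deriv
        simp only [hd, map_smul, smul_eq_mul, Complex.real_smul]
        push_cast
        rw [show I * ((ω * n : ℂ) * t) * z = I * ω * (n * t) * z by ring,
          show (ω * n : ℂ) * t = ω * (n * t) by ring]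
        ring
      have h2 := intervalIntegral.integral_Ioi_sub_Ioi
        ((f.isExpType hp φ).integrableOn_ray hab hω1 hm) (Nat.cast_nonneg n)
      rw [h1, ← h2]
      simp only [rayLaplace, sub_sub_cancel_left, norm_neg]
      have h3 := norm_setIntegral_ray_le hab hCφ hω1 (half_lt_self hm) (Nat.cast_nonneg n)
      rw [← hδ, sub_half] at h3
      exact h3)
  exact ⟨e, fun φ => by rw [he, (f.isExpType hp φ).borel_eq hab hω hm]⟩

/-- The Borel transform of `f`, as a function on the complement of `[a,b]`. -/
noncomputable def borelFun (hp : WithSeminorms p) (hE : LocallyComplete E) (hab : a ≤ b)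
    (f : FO p a b) (z : ↥((interval a b)ᶜ)) : E :=
  (exists_borel hp hE hab f z).choose

theorem dual_borelFun (hp : WithSeminorms p) (hE : LocallyComplete E) (hab : a ≤ b)
    (f : FO p a b) (φ : E →L[ℂ] ℂ) (z : ↥((interval a b)ᶜ)) :
    φ (borelFun hp hE hab f z) = borel a b (fun w => φ (f.toFun w)) z :=
  (exists_borel hp hE hab f z).choose_spec φ

theorem seminorm_borelFun_le (hp : WithSeminorms p) (hE : LocallyComplete E) (hab : a ≤ b)
    (f : FO p a b) {q : Seminorm ℂ E} (hq : Continuous q) {C ε r : ℝ}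
    (hC : ∀ z, q (f.toFun z) ≤ C * Real.exp (ε * ‖z‖ + supportFun a b z.im)) (hε : 0 ≤ ε)
    (hεr : ε < r / 2) {z : ↥((interval a b)ᶜ)}
    (hz : r ≤ Metric.infDist (z : ℂ) (interval a b)) :
    q (borelFun hp hE hab f z) ≤ C / (r / 2 - ε) :=
  seminorm_le_of_forall_dual hq fun φ hφ => by
    rw [dual_borelFun]
    exact (f.isExpType hp φ).norm_borel_le hab (fun w => (hφ _).trans (hC w)) hε hεr hz

theorem seminorm_borelFun_le_seminorms (hp : WithSeminorms p) (hE : LocallyComplete E)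
    (hab : a ≤ b) (f : FO p a b) (n : ℕ+) (α : ι) {z : ↥((interval a b)ᶜ)}
    (hz : (z : ℂ) ∈ S (interval a b) n) :
    p α (borelFun hp hE hab f z) * expWeight n z ≤
      4 * n * FO.seminorms p a b (4 * n, α) f := by
  have hn : (0 : ℝ) < n := by exact_mod_cast n.pos
  have hcast : ((4 * n : ℕ+) : ℝ) = 4 * n := by push_cast; ring
  have h1 := seminorm_borelFun_le hp hE hab f (hp.continuous_seminorm α)
    (f.le_seminorms (4 * n) α) (r := 1 / (n : ℝ)) (by positivity)
    (by rw [hcast]; field_simp; norm_num) (le_infDist_of_mem_S (interval_nonempty hab) hz)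
  have h2 : expWeight n z ≤ 1 := Real.exp_le_one_iff.2 (by
    rw [neg_mul, neg_nonpos]; positivity)
  refine (mul_le_of_le_one_right (apply_nonneg _ _) h2).trans (h1.trans (le_of_eq ?_))
  rw [hcast]
  field_simp
  ring

theorem weakHol_borelFun (hp : WithSeminorms p) (hE : LocallyComplete E) (hab : a ≤ b)
    (f : FO p a b) : WeakHol (zeroExt (borelFun hp hE hab f)) (interval a b)ᶜ where
  holo φ := ((f.isExpType hp φ).differentiableOn_borel hab).congr fun z hz => by
    rw [zeroExt_of_mem _ hz, dual_borelFun]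
  bdd q hq z hz := by
    have hd := infDist_pos_of_notMem hab hz
    set d := Metric.infDist z (interval a b) with hd'
    obtain ⟨C, hC⟩ := f.exists_bound hp hq (ε := d / 8) (by positivity)
    have h1 : ∀ᶠ w in 𝓝[(interval a b)ᶜ] z, d / 2 < Metric.infDist w (interval a b) :=
      (((Metric.continuous_infDist_pt _).tendsto z).eventually_const_lt
        (half_lt_self hd)).filter_mono nhdsWithin_le_nhds
    refine ⟨C / (d / 2 / 2 - d / 8), ?_⟩
    filter_upwards [h1, self_mem_nhdsWithin] with w hw hwK
    rw [zeroExt_of_mem _ hwK]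
    exact seminorm_borelFun_le hp hE hab f hq hC (by positivity) (by linarith) hw.le

theorem borelFun_mem (hp : WithSeminorms p) (hE : LocallyComplete E) (hab : a ≤ b)
    (f : FO p a b) : borelFun hp hE hab f ∈ expHolSubmodule p (interval a b) :=
  ⟨(weakHol_borelFun hp hE hab f).differentiableOn hE (isOpen_compl_interval a b), fun n α =>
    wBdd_iff.2 ⟨_, fun _ hz => seminorm_borelFun_le_seminorms hp hE hab f n α hz⟩⟩

/-- The Borel transform as a linear map. -/
noncomputable def borelLinear [T2Space E] (hp : WithSeminorms p) (hE : LocallyComplete E)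
    (hab : a ≤ b) : FO p a b →ₗ[ℂ] ExpHol p (interval a b) where
  toFun f := ⟨borelFun hp hE hab f, borelFun_mem hp hE hab f⟩
  map_add' f g := Subtype.ext <| funext fun z => eq_of_forall_dual_eq fun φ => by
    change φ (borelFun hp hE hab (f + g) z) =
      φ (borelFun hp hE hab f z + borelFun hp hE hab g z)
    have h1 := ((f + g).isExpType hp φ).borel_sub hab (g.isExpType hp φ) z.2
    have h2 : (fun w => φ ((f + g).toFun w) - φ (g.toFun w)) = fun w => φ (f.toFun w) := by
      funext w
      rw [show (f + g).toFun w = f.toFun w + g.toFun w from rfl, map_add, add_sub_cancel_right]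
    rw [h2] at h1
    rw [map_add, dual_borelFun, dual_borelFun, dual_borelFun, h1, sub_add_cancel]
  map_smul' s f := Subtype.ext <| funext fun z => eq_of_forall_dual_eq fun φ => by
    change φ (borelFun hp hE hab (s • f) z) = φ (s • borelFun hp hE hab f z)
    rw [map_smul, smul_eq_mul, dual_borelFun, dual_borelFun, ← borel_const_mul]
    congr 1
    funext w
    rw [show (s • f).toFun w = s • f.toFun w from rfl, map_smul, smul_eq_mul]

theorem borelLinear_toFun [T2Space E] (hp : WithSeminorms p) (hE : LocallyComplete E)
    (hab : a ≤ b) (f : FO p a b) :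
    (borelLinear hp hE hab f).toFun = borelFun hp hE hab f := rfl

theorem continuous_borelLinear [T2Space E] (hp : WithSeminorms p) (hE : LocallyComplete E)
    (hab : a ≤ b) : Continuous (borelLinear hp hE hab (a := a) (b := b) (p := p)) := by
  refine WithSeminorms.continuous_of_isBounded (FO.withSeminorms p a b) (ExpHol.withSeminorms p _)
    _ ?_
  rintro ⟨n, α⟩
  refine ⟨{(4 * n, α)}, 4 * n, fun f => ?_⟩
  rw [Seminorm.comp_apply, _root_.smul_apply, Finset.sup_singleton, NNReal.smul_def, smul_eq_mul]
  exact ExpHol.seminorms_le _ (by positivity) fun z hz =>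
    seminorm_borelFun_le_seminorms hp hE hab f n α hz

end VectorBorel

/-! ### The Fourier and the Borel transform are inverse to each other -/

section Inversion

variable {E : Type*} {ι : Type*} [AddCommGroup E] [Module ℂ E] [TopologicalSpace E]
  [PolynormableSpace ℂ E] [IsTopologicalAddGroup E] [ContinuousSMul ℂ E] [T2Space E]
  {p : SeminormFamily ℂ E ι} {a b : ℝ}

theorem fourierLinear_borelLinear (hp : WithSeminorms p) (hE : LocallyComplete E) (hab : a ≤ b)
    (f : FO p a b) :
    fourierLinear hp hE hab (borelLinear hp hE hab f) = (2 * Real.pi : ℂ) • f :=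
  Subtype.ext <| funext fun ζ => eq_of_forall_dual_eq fun φ => by
    change φ (fourierFun hE hab (borelLinear hp hE hab f) ζ) = φ ((2 * Real.pi : ℂ) • f.toFun ζ)
    rw [map_smul, smul_eq_mul, dual_fourierFun hE hab _ one_pos,
      ← (f.isExpType hp φ).contourFourier_borel hab one_pos ζ]
    refine contourIntegral_congr fun w hw => ?_
    have hw' := contourTrace_subset_compl hab one_pos hw
    simp only [zeroExt_of_mem _ hw', borelLinear_toFun, dual_borelFun]

/-- The difference of `F` and the normalized Borel transform of its Fourier transform. It extends
to an entire function. -/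
noncomputable def borelDefect (hp : WithSeminorms p) (hE : LocallyComplete E) (hab : a ≤ b)
    (F : ExpHol p (interval a b)) : ExpHol p (interval a b) :=
  F - (2 * Real.pi : ℂ)⁻¹ • borelLinear hp hE hab (fourierLinear hp hE hab F)

theorem dual_borelDefect (hp : WithSeminorms p) (hE : LocallyComplete E) (hab : a ≤ b)
    (F : ExpHol p (interval a b)) (φ : E →L[ℂ] ℂ) {z : ℂ} (hz : z ∈ (interval a b)ᶜ) :
    φ (zeroExt (borelDefect hp hE hab F).toFun z) =
      entireExtension a b (fun w => φ (zeroExt F.toFun w)) z := by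
  rw [entireExtension_of_notMem hab (F.weakHol.holo φ) hz, zeroExt_of_mem _ hz,
    zeroExt_of_mem _ hz]
  change φ (F.toFun ⟨z, hz⟩ - (2 * Real.pi : ℂ)⁻¹ •
    borelFun hp hE hab (fourierLinear hp hE hab F) ⟨z, hz⟩) = _
  rw [map_sub, map_smul, dual_borelFun, smul_eq_mul]
  simp only [fourierLinear_toFun, dual_fourierFun hE hab F one_pos]

theorem exists_entireExtension (hp : WithSeminorms p) (hE : LocallyComplete E) (hab : a ≤ b)
    (F : ExpHol p (interval a b)) (z : ℂ) : ∃ e : E, ∀ φ : E →L[ℂ] ℂ,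
      φ e = entireExtension a b (fun w => φ (zeroExt F.toFun w)) z := by
  by_cases hz : z ∈ Metric.thickening 1 (interval a b)
  · have hne : ∀ w ∈ contourTrace a b 1, w - z ≠ 0 := fun w hw =>
      ne_of_mem_thickening_of_mem_contourTrace hab zero_le_one hz hw
    obtain ⟨e, he⟩ := ((F.weakHol.mono (inter_subset_left (t := {z}ᶜ))).smul
      (m := fun w => (w - z)⁻¹) (DifferentiableOn.inv (by fun_prop)
        fun w hw => sub_ne_zero.2 hw.2)).exists_contourIntegral hE
      ((isOpen_compl_interval a b).inter isOpen_compl_singleton)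
      (fun w hw => ⟨contourTrace_subset_compl hab one_pos hw, sub_ne_zero.1 (hne w hw)⟩)
    refine ⟨(-(2 * Real.pi * I)⁻¹ : ℂ) • e, fun φ => ?_⟩
    rw [entireExtension, if_pos hz, map_smul, he, smul_eq_mul]
    simp only [map_smul, smul_eq_mul, mul_comm]
  · exact ⟨_, fun φ => dual_borelDefect hp hE hab F φ
      fun h => hz (Metric.self_subset_thickening one_pos _ h)⟩

/-- The extension of `borelDefect` to `ℂ`; near `[a,b]` it is given by a Cauchy integral. -/
theorem exists_weakHol_extension (hp : WithSeminorms p) (hE : LocallyComplete E) (hab : a ≤ b)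
    (F : ExpHol p (interval a b)) : ∃ G : ℂ → E, WeakHol G univ ∧
      ∀ z ∈ (interval a b)ᶜ, G z = zeroExt (borelDefect hp hE hab F).toFun z := by
  choose G hG using exists_entireExtension hp hE hab F
  have hGK : ∀ z ∈ (interval a b)ᶜ, G z = zeroExt (borelDefect hp hE hab F).toFun z :=
    fun z hz => eq_of_forall_dual_eq fun φ => by rw [hG, dual_borelDefect hp hE hab F φ hz]
  refine ⟨G, ⟨fun φ => ?_, fun q hq z _ => ?_⟩, hGK⟩
  · simp only [hG _ φ]
    exact (differentiable_entireExtension hab (F.weakHol.holo φ)).differentiableOn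
  rw [nhdsWithin_univ]
  by_cases hz : z ∈ interval a b
  · obtain ⟨M, hM⟩ := F.weakHol.exists_bound (isCompact_contourTrace a b 1)
      (contourTrace_subset_compl hab one_pos) hq
    refine ⟨‖(-(2 * Real.pi * I)⁻¹ : ℂ)‖ * (4 * (M * 2 * (b - a + Real.pi * 1))), ?_⟩
    have hnhds : Metric.thickening (1 / 2) (interval a b) ∈ 𝓝 z :=
      Metric.isOpen_thickening.mem_nhds (Metric.self_subset_thickening (by norm_num) _ hz)
    filter_upwards [hnhds] with v hv
    refine seminorm_le_of_forall_dual hq fun φ hφ => ?_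
    rw [hG, entireExtension, if_pos (Metric.thickening_mono (by norm_num) _ hv), norm_mul]
    refine mul_le_mul_of_nonneg_left (norm_contourIntegral_le hab zero_le_one fun w hw => ?_)
      (norm_nonneg _)
    have h1 : ‖φ (zeroExt F.toFun w)‖ ≤ M := (hφ _).trans (hM w hw)
    have h2 : (1 / 2 : ℝ) ≤ ‖w - v‖ := by
      have h3 := (mem_thickening_interval_iff hab).1 hv
      have h4 := Metric.infDist_le_infDist_add_dist (s := interval a b) (x := w) (y := v)
      rw [infDist_of_mem_contourTrace hab zero_le_one hw, dist_eq_norm] at h4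
      linarith
    rw [norm_mul, norm_inv]
    refine mul_le_mul h1 ?_ (by positivity) ((norm_nonneg _).trans h1)
    rw [inv_le_comm₀ (by linarith) (by norm_num)]
    linarith
  · obtain ⟨C, hC⟩ := (borelDefect hp hE hab F).weakHol.bdd q hq z hz
    have hKz : (interval a b)ᶜ ∈ 𝓝 z := (isOpen_compl_interval a b).mem_nhds hz
    rw [nhdsWithin_eq_nhds.2 hKz] at hC
    refine ⟨C, ?_⟩
    filter_upwards [hC, hKz] with w hw hwK
    rwa [hGK w hwK]

theorem borelDefect_mem_entirePart (hp : WithSeminorms p) (hE : LocallyComplete E) (hab : a ≤ b)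
    (F : ExpHol p (interval a b)) : borelDefect hp hE hab F ∈ entirePart p (interval a b) := by
  obtain ⟨G, hG, hGK⟩ := exists_weakHol_extension hp hE hab F
  set D := borelDefect hp hE hab F
  have hGext : zeroExt (fun z : ↥((∅ : Set ℂ)ᶜ) => G z) = G :=
    funext fun z => zeroExt_restrict G (fun h => h)
  refine ⟨⟨fun z => G z, ?_, fun n α => ?_⟩, fun z => ?_⟩
  · rw [hGext, compl_empty]
    exact hG.differentiableOn hE isOpen_univ
  · -- Points of the strip at distance more than `1` from `[a,b]` lie in `S_n`, where `D` is
    -- bounded; the remaining points lie in a compact set.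
    have hn1 : (1 : ℝ) ≤ n := by exact_mod_cast n.pos
    obtain ⟨C, hC⟩ := hG.exists_bound ((isCompact_interval a b).cthickening (r := 1))
      (subset_univ _) (hp.continuous_seminorm α)
    refine wBdd_iff.2 ⟨max C (ExpHol.seminorms p (interval a b) (n, α) D), fun z hz => ?_⟩
    rw [mul_expWeight_le_iff]
    have hN : 0 ≤ ExpHol.seminorms p (interval a b) (n, α) D := apply_nonneg _ _
    by_cases hzK : (z : ℂ) ∈ Metric.cthickening 1 (interval a b)
    · exact ((hC z hzK).trans (le_max_left _ _)).trans
        (le_mul_of_one_le_right (hN.trans (le_max_right _ _)) (Real.one_le_exp (by positivity)))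
    have hdist : 1 < Metric.infDist (z : ℂ) (interval a b) := by
      by_contra h
      refine hzK ?_
      rw [(isCompact_interval a b).cthickening_eq_biUnion_closedBall zero_le_one]
      obtain ⟨y, hy, hyz⟩ := (isCompact_interval a b).exists_infDist_eq_dist
        (interval_nonempty hab) (z : ℂ)
      exact mem_iUnion₂.2 ⟨y, hy, Metric.mem_closedBall.2 (hyz ▸ not_lt.1 h)⟩
    have hzc : (z : ℂ) ∈ (interval a b)ᶜ := fun h => hzK (Metric.self_subset_cthickening _ h)
    have hzS : (z : ℂ) ∈ S (interval a b) n :=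
      mem_S_of_lt_infDist (interval_nonempty hab)
        (lt_of_le_of_lt (by rw [div_le_one (by linarith)]; exact hn1) hdist) hz.2
    change p α (G z) ≤ _
    rw [hGK z hzc, zeroExt_of_mem _ hzc]
    exact (ExpHol.le_seminorms D α (z := ⟨z, hzc⟩) hzS).trans
      (mul_le_mul_of_nonneg_right (le_max_right _ _) (Real.exp_pos _).le)
  · rw [← zeroExt_of_mem D.toFun z.2, ← hGK z z.2]
    rfl

/-- The Fourier transform on the quotient. Its inverse is the class of the normalized Borel
transform. -/
noncomputable def fourierEquiv (hp : WithSeminorms p) (hE : LocallyComplete E) (hab : a ≤ b) :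
    BV p (interval a b) ≃L[ℂ] FO p a b :=
  have hpi : (2 * Real.pi : ℂ) ≠ 0 := by exact_mod_cast Real.two_pi_pos.ne'
  haveI : ContinuousConstSMul ℂ (FO p a b) :=
    haveI := (FO.withSeminorms p a b).continuousSMul
    inferInstance
  { toFun := (entirePart p (interval a b)).liftQ (fourierLinear hp hE hab)
      (entirePart_le_ker_fourierLinear hp hE hab)
    map_add' := map_add _
    map_smul' := map_smul _
    invFun := fun f => Submodule.Quotient.mk (borelLinear hp hE hab ((2 * Real.pi : ℂ)⁻¹ • f))
    left_inv := fun x => by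
      obtain ⟨F, rfl⟩ := Submodule.Quotient.mk_surjective _ x
      refine ((Submodule.Quotient.eq _).2 ?_).symm
      rw [Submodule.liftQ_apply, map_smul]
      exact borelDefect_mem_entirePart hp hE hab F
    right_inv := fun f => by
      rw [Submodule.liftQ_apply, fourierLinear_borelLinear, smul_inv_smul₀ hpi]
    continuous_toFun := (continuous_fourierLinear hp hE hab).quotient_lift _
    continuous_invFun := continuous_quot_mk.comp
      ((continuous_borelLinear hp hE hab).comp (continuous_const_smul _)) }

end Inversion

end FourierHyp

theorem mainTheorem4 {E : Type*} {ι : Type*} [AddCommGroup E] [Module ℂ E] [TopologicalSpace E]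
    [IsTopologicalAddGroup E] [ContinuousSMul ℂ E] [T2Space E]
    (p : SeminormFamily ℂ E ι) (hp : WithSeminorms p) (hE : FourierHyp.LocallyComplete E)
    (a b : ℝ) (hab : a ≤ b) :
    ∃ Φ : FourierHyp.BV p (FourierHyp.interval a b) ≃L[ℂ] FourierHyp.FO p a b,
      ∀ (F : FourierHyp.ExpHol p (FourierHyp.interval a b)) (c : ℝ), 0 < c → ∀ ζ : ℂ,
        FourierHyp.IsPettisIntegralAlong (FourierHyp.contour a b c)
          (fun z => Complex.exp (-Complex.I * z * ζ) • FourierHyp.zeroExt F.toFun z)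
          ((Φ (Submodule.Quotient.mk F)).toFun ζ) := by
  have := hp.toPolynormableSpace
  refine ⟨FourierHyp.fourierEquiv hp hE hab, fun F c hc ζ φ => ?_⟩
  simp only [map_smul, smul_eq_mul]
  refine ⟨FourierHyp.intervalIntegrable_contour
    (h := fun w => exp (-I * w * ζ) * φ (FourierHyp.zeroExt F.toFun w))
    (ContinuousOn.mul (by fun_prop) ((F.weakHol.holo φ).continuousOn.mono
      (FourierHyp.contourTrace_subset_compl hab hc))), ?_⟩
  exact FourierHyp.dual_fourierFun hE hab F hc φ ζ
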